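/- Let $k$ be a field of characteristic $0$. Let $\mathbb{P}^2$ be the monoid scheme (over $\mathbb{F}_1$) glued from the affine monoid schemes of the fan with rays $u_0=(-1,-1)$, $u_1=(1,0)$, $u_2=(0,1)$; let $X_0,X_1,X_2$ be the homogeneous coordinates, with $x_1=X_1/X_0$, $x_2=X_2/X_0$. A $T$-sheaf is a coherent sheaf of $\mathcal{O}_{\mathbb{P}^2}$-modules (pointed sets with an action of the monoid structure sheaf) which is of type $\alpha$ (if a section $a$ of the structure sheaf satisfies $as=at$ for local sections $s,t$, then $s=t$ or $as=at=0$), and which on each of the three maximal affine charts $X_\sigma$ corresponds to a module admitting a grading by the monoid $S_\sigma$ of monomials regular on $X_\sigma$. The morphisms of the category $\mathrm{Coh}^T(\mathbb{P}^2)$ are the morphisms of sheaves that on stalks are injective away from the preimage of the base point. Let $H$ be the space of finitely supported $k$-valued functions on the set of isomorphism classes of $T$-sheaves, and put $$\delta_{[X]}\bullet\delta_{[Y]}=\sum_{[Z]} g^Z_{X,Y}\,\delta_{[Z]},\qquad g^Z_{X,Y}=\#\{Z'\subseteq Z \mid Z'\simeq Y,\ Z/Z'\simeq X\}.$$ Then: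 1. The numbers $g^Z_{X,Y}$ are finite and, for given $X,Y$, non-zero for only finitely many $[Z]$; the product $\bullet$ makes $H$ an associative algebra with unit $\delta_{[0]}$. The span $\mathfrak{n}^T_{\mathbb{P}^2}$ of the classes of the indecomposable $T$-sheaves is closed under the commutator, hence a Lie algebra, and it contains the classes $\mathcal{O}_i(n)$ of the push-forwards to $\mathbb{P}^2$ of the line bundles $\mathcal{O}_{\mathbb{P}^1}(n)$ on the boundary lines $\{X_i=0\}\simeq\mathbb{P}^1$, $i\in\{0,1,2\}$, $n\in\mathbb{Z}$. Let $\mathfrak{k}\subset\mathfrak{n}^T_{\mathbb{P}^2}$ be the Lie subalgebra generated by all $\mathcal{O}_i(n)$. Let $\mathbb{TF}\subset H$ be the subalgebra generated by the classes of the torsion-free $T$-sheaves, and $\mathbb{J}\subset\mathbb{TF}$ the ideal generated by the classes of those torsion-free $T$-sheaves that are not locally free. 2. $\mathbb{TF}$ is commutative, and $\mathbb{TF}/\mathbb{J}$ is the polynomial ring $k[x_n : n\in\mathbb{Z}]$ in the classes $x_n=[\mathcal{O}(n)]$ of the line bundles on $\mathbb{P}^2$. 3. For every $x\in\mathfrak{k}$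 one has $[x,\mathbb{TF}]\subset\mathbb{TF}$ and $[x,\mathbb{J}]\subset\mathbb{J}$; the adjoint action descends to a Lie algebra homomorphism $\rho$ from $\mathfrak{k}$ to the derivations of $k[x_n : n\in\mathbb{Z}]=\mathbb{TF}/\mathbb{J}$, and $\rho(\mathcal{O}_i(n))=x_n\,\partial/\partial x_{n-1}$ for all $i\in\{0,1,2\}$ and $n\in\mathbb{Z}$. 4. Let $\widetilde{\mathfrak{gl}}{}^-_\infty$ be the Lie algebra, under the commutator, of strictly lower triangular $\mathbb{Z}\times\mathbb{Z}$ matrices spanned by the matrix units $E_{i,j}$ with $i>j$. There is a surjective Lie algebra homomorphism $\nu:\mathfrak{k}\twoheadrightarrow\widetilde{\mathfrak{gl}}{}^-_\infty$ with $\nu(\mathcal{O}_i(n))=E_{n,n-1}$ for all $i\in\{0,1,2\}$ and $n\in\mathbb{Z}$, which is induced by $\rho$: $\rho(x)(x_m)=\sum_a \nu(x)_{a,m}\,x_a$ for all $x\in\mathfrak{k}$ and $m\in\mathbb{Z}$. -/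

import Mathlib

attribute [local instance 100] LieRing.ofAssociativeRing

namespace MonoidP2

open CategoryTheory

/- ## The fan of the projective plane

The rays are spanned by `u₀ = (-1,-1)`, `u₁ = (1,0)`, `u₂ = (0,1)`; every proper subset of the rays
spans a cone and there are no other cones. The maximal cone `σ_l` is spanned by the two rays other
than `u_l`. -/

/-- The cones of the fan of `ℙ²`, as proper subsets of the set of rays. -/
abbrev Cone : Type := {J : Finset (Fin 3) // J ≠ Finset.univ}

/-- The pairings of a character `e ∈ ℤ²` (the Laurent monomial `x₁^e.1 * x₂^e.2`) with the three
ray generators. In terms of homogeneous coordinates, with `x₁ = X₁/X₀` and `x₂ = X₂/X₀`,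
these are the exponents of `X₀`, `X₁`, `X₂`. -/
def pairing (e : ℤ × ℤ) : Fin 3 → ℤ := ![-e.1 - e.2, e.1, e.2]

theorem pairing_zero : pairing 0 = 0 := by
  funext j; fin_cases j <;> simp [pairing]

theorem pairing_add (e f : ℤ × ℤ) : pairing (e + f) = pairing e + pairing f := by
  funext j
  fin_cases j
  · simp [pairing]; ring
  · simp [pairing]
  · simp [pairing]

/-- `S_J`: the characters that are non-negative on the cone `J`. The coordinate monoid of the affine
open subscheme `X_J` is `S_J ∪ {0}`. -/
def S (J : Cone) : AddSubmonoid (ℤ × ℤ) where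
  carrier := {e | ∀ j ∈ J.1, 0 ≤ pairing e j}
  zero_mem' := by intro j _; simp [pairing_zero]
  add_mem' := by
    intro a b ha hb j hj
    have := ha j hj
    have := hb j hj
    simp only [pairing_add, Pi.add_apply]
    omega

theorem S_anti {J K : Cone} (h : K ≤ J) : S J ≤ S K := fun _ he j hj => he j (h hj)

/-- The maximal cone `σ_l`, spanned by the rays other than `u_l`. -/
def chart (l : Fin 3) : Cone :=
  ⟨{l}ᶜ, fun h => by
    have : l ∈ ({l}ᶜ : Finset (Fin 3)) := h ▸ Finset.mem_univ l
    simp at this⟩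

/- ## Sheaves -/

/-- A quasicoherent sheaf on the monoid scheme `ℙ²`.

The affine opens `X_J` form a basis of the topology of `ℙ²`, and `X_J` is the smallest open
neighbourhood of the point corresponding to `J`. So a sheaf is the same as its sections
(equivalently stalks) `M J` on the `X_J` together with the restriction maps, the sheaf condition being
vacuous. Each `M J` is a module over the monoid with zero `S_J ∪ {0}`, that is, a pointed set with an
action of the monoid `S_J` that fixes the base point `0` (the zero of the monoid acts by the
constant map `0`). The sheaf is quasicoherent if for every face `K` of `J` the restriction map
exhibits `M K` as the localization of `M J` at the elements of `S_J` that are invertible in `S_K`. -/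
structure QCoh : Type 1 where
  M : Cone → Type
  [pointed : ∀ J, Zero (M J)]
  act : ∀ {J : Cone}, S J → M J → M J
  zero_act : ∀ {J : Cone} (x : M J), act 0 x = x
  add_act : ∀ {J : Cone} (s t : S J) (x : M J), act (s + t) x = act s (act t x)
  act_zero : ∀ {J : Cone} (s : S J), act s (0 : M J) = 0
  res : ∀ {J K : Cone}, K ≤ J → M J → M K
  res_self : ∀ {J : Cone} (x : M J), res le_rfl x = x
  res_res : ∀ {J K L : Cone} (h : K ≤ J) (h' : L ≤ K) (x : M J),
    res h' (res h x) = res (h'.trans h) x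
  res_zero : ∀ {J K : Cone} (h : K ≤ J), res h (0 : M J) = 0
  res_act : ∀ {J K : Cone} (h : K ≤ J) (s : S J) (x : M J),
    res h (act s x) = act (AddSubmonoid.inclusion (S_anti h) s) (res h x)
  res_surj : ∀ {J K : Cone} (h : K ≤ J) (y : M K),
    ∃ s : S J, -(s : ℤ × ℤ) ∈ S K ∧ ∃ x : M J,
      act (AddSubmonoid.inclusion (S_anti h) s) y = res h x
  res_inj : ∀ {J K : Cone} (h : K ≤ J) (x x' : M J), res h x = res h x' →
    ∃ s : S J, -(s : ℤ × ℤ) ∈ S K ∧ act s x = act s x'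

attribute [instance] QCoh.pointed

/-- A coherent `T`-sheaf on `ℙ²`: a quasicoherent sheaf that is coherent (finitely generated on the
three maximal affine charts), of type `α` (multiplication by a section of the structure sheaf is
injective away from the preimage of zero), and admits on each maximal chart `X_σ` a grading
`M = ⨁_{γ ∈ S_σ} M_γ` with `S_σ` graded by itself. -/
structure TSheaf : Type 1 extends QCoh where
  fg : ∀ l : Fin 3, ∃ G : Finset (M (chart l)), ∀ x : M (chart l), x ≠ 0 →
    ∃ g ∈ G, ∃ s : S (chart l), x = act s g
  alpha : ∀ {J : Cone} (s : S J) (x y : M J), act s x = act s y → x = y ∨ act s x = 0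
  graded : ∀ l : Fin 3, ∃ deg : M (chart l) → S (chart l),
    ∀ (s : S (chart l)) (x : M (chart l)), act s x ≠ 0 → deg (act s x) = s + deg x

/-- Morphisms of `T`-sheaves: morphisms of modules on the stalks, compatible with restriction, which
are injective away from the preimage of zero. -/
@[ext]
structure Hom (F G : TSheaf) : Type where
  app : ∀ J : Cone, F.M J → G.M J
  map_zero : ∀ J, app J 0 = 0
  map_act : ∀ {J : Cone} (s : S J) (x : F.M J), app J (F.act s x) = G.act s (app J x)
  map_res : ∀ {J K : Cone} (h : K ≤ J) (x : F.M J), app K (F.res h x) = G.res h (app J x)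
  alpha : ∀ {J : Cone} (x y : F.M J), app J x = app J y → x = y ∨ app J x = 0

/-- The category `Coh^T(ℙ²)`. -/
instance : Category TSheaf where
  Hom := Hom
  id F :=
    { app := fun _ x => x
      map_zero := fun _ => rfl
      map_act := fun _ _ => rfl
      map_res := fun _ _ => rfl
      alpha := fun _ _ h => Or.inl h }
  comp f g :=
    { app := fun J x => g.app J (f.app J x)
      map_zero := fun J => by rw [f.map_zero, g.map_zero]
      map_act := fun s x => by rw [f.map_act, g.map_act]
      map_res := fun h x => by rw [f.map_res, g.map_res]
      alpha := fun {J} x y h => by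
        rcases g.alpha _ _ h with h' | h'
        · rcases f.alpha _ _ h' with h'' | h''
          · exact Or.inl h''
          · exact Or.inr (by rw [h'', g.map_zero])
        · exact Or.inr h' }

/-- The zero sheaf. -/
def zeroSheaf : TSheaf where
  M _ := Unit
  pointed _ := ⟨()⟩
  act _ x := x
  zero_act _ := rfl
  add_act _ _ _ := rfl
  act_zero _ := rfl
  res _ x := x
  res_self _ := rfl
  res_res _ _ _ := rfl
  res_zero _ := rfl
  res_act _ _ _ := rfl
  res_surj _ y := ⟨0, by simp, y, rfl⟩
  res_inj _ _ _ _ := ⟨0, by simp, rfl⟩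
  fg _ := ⟨∅, fun _ hx => absurd rfl hx⟩
  alpha _ _ _ h := Or.inl h
  graded _ := ⟨fun _ => 0, fun _ _ h => absurd rfl h⟩

/-- `F` is indecomposable: it is non-zero, and whenever it is the direct sum (wedge) of two
subsheaves, one of these is zero. -/
def IsIndecomposable (F : TSheaf) : Prop :=
  (∃ J, ∃ x : F.M J, x ≠ 0) ∧
  ∀ A B : ∀ J, Set (F.M J),
    (∀ J (s : S J), ∀ x ∈ A J, F.act s x ∈ A J) →
    (∀ J (s : S J), ∀ x ∈ B J, F.act s x ∈ B J) →
    (∀ J K (h : K ≤ J), ∀ x ∈ A J, F.res h x ∈ A K) →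
    (∀ J K (h : K ≤ J), ∀ x ∈ B J, F.res h x ∈ B K) →
    (∀ J, A J ∪ B J = Set.univ) → (∀ J, A J ∩ B J = {0}) →
    (∀ J, A J = {0}) ∨ (∀ J, B J = {0})

/-- `F` is torsion-free: in every stalk only `0` is annihilated by a non-zero element of the
monoid. -/
def IsTorsionFree (F : TSheaf) : Prop :=
  ∀ (J : Cone) (x : F.M J), x ≠ 0 → ∀ s : S J, F.act s x ≠ 0

/-- `F` is locally free: every stalk is a free module `⨁_{r < n} (S_J ∪ {0})`, with basis
`b₀, …, b_{n-1}`. -/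
def IsLocallyFree (F : TSheaf) : Prop :=
  ∀ J : Cone, ∃ (n : ℕ) (b : Fin n → F.M J), (∀ (r : Fin n) (s : S J), F.act s (b r) ≠ 0) ∧
    ∀ x : F.M J, x ≠ 0 → ∃! p : Fin n × S J, F.act p.2 (b p.1) = x

/- ## The line bundles on `ℙ²` and on the boundary lines

Let `I ⊆ {0,1,2}` and let `Z_I` be the closed subscheme `X_i = 0 (i ∈ I)`. The sections of
`𝒪_{Z_I}(d)` on `X_J` are `0` if `I ⊈ J`, and otherwise they are `0` and the Laurent monomials
`X₀^{a₀} X₁^{a₁} X₂^{a₂}` of degree `d` with `a_j ≥ 0` for `j ∈ J` and `a_i = 0` for `i ∈ I`. A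
monomial in `S_J` acts by multiplication, where monomials that do not satisfy the
conditions are `0`. -/

/-- The exponents of the non-zero sections of `𝒪_{Z_I}(d)` on `X_J`. -/
def Shape (I : Finset (Fin 3)) (d : ℤ) (J : Cone) (a : Fin 3 → ℤ) : Prop :=
  a 0 + a 1 + a 2 = d ∧ (∀ j ∈ J.1, 0 ≤ a j) ∧ ∀ i ∈ I, i ∈ J.1 ∧ a i = 0

/-- The section given by a Laurent monomial, or `none` (the base point) if the
conditions fail. -/
noncomputable def mono (I : Finset (Fin 3)) (d : ℤ) (J : Cone) (a : Fin 3 → ℤ) :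
    Option {a // Shape I d J a} :=
  open Classical in if h : Shape I d J a then some ⟨a, h⟩ else none

theorem pairing_sum (e : ℤ × ℤ) : pairing e 0 + pairing e 1 + pairing e 2 = 0 := by
  simp only [pairing, Matrix.cons_val]
  ring

theorem mono_pos {I : Finset (Fin 3)} {d : ℤ} {J : Cone} {a : Fin 3 → ℤ} (h : Shape I d J a) :
    mono I d J a = some ⟨a, h⟩ := by simp [mono, h]

theorem mono_neg {I : Finset (Fin 3)} {d : ℤ} {J : Cone} {a : Fin 3 → ℤ} (h : ¬ Shape I d J a) :
    mono I d J a = none := by simp [mono, h]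

/-- If a product of two elements of `S_J` does not kill a section, neither does the first factor. -/
theorem shape_of_add {I : Finset (Fin 3)} {d : ℤ} {J : Cone} {a : Fin 3 → ℤ} (ha : Shape I d J a)
    {s t : ℤ × ℤ} (hs : s ∈ S J) (ht : t ∈ S J) (h : Shape I d J (a + pairing t + pairing s)) :
    Shape I d J (a + pairing t) := by
  refine ⟨?_, ?_, ?_⟩
  · have := ha.1
    have := pairing_sum t
    simp only [Pi.add_apply]
    omega
  · intro j hj
    have := ha.2.1 j hj
    have := ht j hj
    simp only [Pi.add_apply]
    omega
  · intro i hi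
    obtain ⟨hiJ, h0⟩ := h.2.2 i hi
    have h1 := (ha.2.2 i hi).2
    have h2 := ht i hiJ
    have h3 := hs i hiJ
    simp only [Pi.add_apply] at h0 ⊢
    exact ⟨hiJ, by omega⟩

theorem shape_face {I : Finset (Fin 3)} {d : ℤ} {J K : Cone} (h : K ≤ J) {a : Fin 3 → ℤ}
    (ha : Shape I d J a) : Shape I d K a ↔ ∀ i ∈ I, i ∈ K.1 :=
  ⟨fun hK i hi => (hK.2.2 i hi).1,
    fun hI => ⟨ha.1, fun j hj => ha.2.1 j (h hj), fun i hi => ⟨hI i hi, (ha.2.2 i hi).2⟩⟩⟩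

/-- Multiplication of a section by a monomial. -/
noncomputable def monoAct (I : Finset (Fin 3)) (d : ℤ) {J : Cone} (s : S J) :
    Option {a // Shape I d J a} → Option {a // Shape I d J a}
  | none => none
  | some a => mono I d J (a.1 + pairing s)

/-- Restriction of a section. -/
noncomputable def monoRes (I : Finset (Fin 3)) (d : ℤ) {J : Cone} (K : Cone) :
    Option {a // Shape I d J a} → Option {a // Shape I d K a}
  | none => none
  | some a => mono I d K a.1

theorem monoAct_none {I : Finset (Fin 3)} {d : ℤ} {J : Cone} (s : S J) :
    monoAct I d s none = none := rfl
theorem monoAct_some {I : Finset (Fin 3)} {d : ℤ} {J : Cone} (s : S J)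
    (a : {a // Shape I d J a}) :
    monoAct I d s (some a) = mono I d J (a.1 + pairing s) := rfl
theorem monoRes_none {I : Finset (Fin 3)} {d : ℤ} {J K : Cone} :
    monoRes I d (J := J) K none = none := rfl
theorem monoRes_some {I : Finset (Fin 3)} {d : ℤ} {J K : Cone} (a : {a // Shape I d J a}) :
    monoRes I d K (some a) = mono I d K a.1 := rfl

theorem mono_eq_some {I : Finset (Fin 3)} {d : ℤ} {J : Cone} {a : Fin 3 → ℤ}
    (h : mono I d J a ≠ none) : Shape I d J a := by
  by_contra h'; exact h (mono_neg h')

theorem mono_inj {I : Finset (Fin 3)} {d : ℤ} {J : Cone} {a b : Fin 3 → ℤ}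
    (h : mono I d J a = mono I d J b) (ha : Shape I d J a) : a = b := by
  rw [mono_pos ha] at h
  by_cases hb : Shape I d J b
  · rw [mono_pos hb] at h
    simpa using h
  · rw [mono_neg hb] at h
    simp at h

/-- The sum of the exponent vectors `m • v_k` and `- m • v_l`, as a character, i.e. `(X_k/X_l)^m`. -/
def ratio (k l : Fin 3) (m : ℤ) : ℤ × ℤ :=
  ((if k = 1 then m else 0) - (if l = 1 then m else 0),
    (if k = 2 then m else 0) - (if l = 2 then m else 0))

theorem pairing_ratio (k l : Fin 3) (m : ℤ) (j : Fin 3) :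
    pairing (ratio k l m) j = (if k = j then m else 0) - (if l = j then m else 0) := by
  fin_cases k <;> fin_cases l <;> fin_cases j <;> simp [pairing, ratio]

theorem exists_notMem (J : Cone) : ∃ l, l ∉ J.1 := by
  by_contra h
  push Not at h
  exact J.2 (Finset.eq_univ_iff_forall.2 h)

/-- The degree of a section on the chart `σ_l`: its quotient by `X_l^d`. -/
def monoDeg (d : ℤ) (l : Fin 3) (a : Fin 3 → ℤ) : ℤ × ℤ :=
  (a 1 - (if l = 1 then d else 0), a 2 - (if l = 2 then d else 0))

theorem pairing_monoDeg {d : ℤ} {l : Fin 3} {a : Fin 3 → ℤ} (h : a 0 + a 1 + a 2 = d)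
    (j : Fin 3) : pairing (monoDeg d l a) j = a j - (if l = j then d else 0) := by
  fin_cases l <;> fin_cases j <;> simp [pairing, monoDeg] <;> omega

theorem monoDeg_mem {I : Finset (Fin 3)} {d : ℤ} {l : Fin 3} {a : Fin 3 → ℤ}
    (h : Shape I d (chart l) a) : monoDeg d l a ∈ S (chart l) := by
  intro j hj
  have hne : l ≠ j := fun e => by simp [chart, e] at hj
  have := h.2.1 j hj
  rw [pairing_monoDeg h.1]
  simpa [hne] using this

/-- The generator `X_l^d` on the chart `σ_l`. -/
def monoGen (d : ℤ) (l : Fin 3) : Fin 3 → ℤ := fun j => if l = j then d else 0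

theorem monoGen_add {d : ℤ} {l : Fin 3} {a : Fin 3 → ℤ} (h : a 0 + a 1 + a 2 = d) :
    monoGen d l + pairing (monoDeg d l a) = a := by
  funext j
  rw [Pi.add_apply, pairing_monoDeg h]
  simp [monoGen]

theorem shape_monoGen {I : Finset (Fin 3)} {d : ℤ} {l : Fin 3} {a : Fin 3 → ℤ}
    (h : Shape I d (chart l) a) : Shape I d (chart l) (monoGen d l) := by
  refine ⟨?_, ?_, ?_⟩
  · fin_cases l <;> simp [monoGen]
  · intro j hj
    have hne : l ≠ j := fun e => by simp [chart, e] at hj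
    simp [monoGen, hne]
  · intro i hi
    have hij := (h.2.2 i hi).1
    have hne : l ≠ i := fun e => by simp [chart, e] at hij
    exact ⟨hij, by simp [monoGen, hne]⟩

theorem monoAct_zero {I : Finset (Fin 3)} {d : ℤ} {J : Cone} (x : Option {a // Shape I d J a}) :
    monoAct I d (0 : S J) x = x := by
  rcases x with _ | a
  · rfl
  · rw [monoAct_some]
    simp only [ZeroMemClass.coe_zero, pairing_zero, add_zero]
    exact mono_pos a.2

theorem monoAct_add {I : Finset (Fin 3)} {d : ℤ} {J : Cone} (s t : S J)
    (x : Option {a // Shape I d J a}) :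
    monoAct I d (s + t) x = monoAct I d s (monoAct I d t x) := by
  rcases x with _ | a
  · rfl
  · have e : a.1 + pairing ((s + t : S J) : ℤ × ℤ) = a.1 + pairing t + pairing s := by
      rw [AddSubmonoid.coe_add, pairing_add]; abel
    rw [monoAct_some, monoAct_some, e]
    by_cases h : Shape I d J (a.1 + pairing t)
    · rw [mono_pos h, monoAct_some]
    · rw [mono_neg h, monoAct_none]
      exact mono_neg fun h' => h (shape_of_add a.2 s.2 t.2 h')

theorem monoRes_self {I : Finset (Fin 3)} {d : ℤ} {J : Cone} (x : Option {a // Shape I d J a}) :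
    monoRes I d J x = x := by
  rcases x with _ | a
  · rfl
  · exact mono_pos a.2

theorem monoRes_res {I : Finset (Fin 3)} {d : ℤ} {J K L : Cone} (h : K ≤ J) (h' : L ≤ K)
    (x : Option {a // Shape I d J a}) :
    monoRes I d L (monoRes I d K x) = monoRes I d L x := by
  rcases x with _ | a
  · rfl
  · rw [monoRes_some, monoRes_some]
    by_cases hK : Shape I d K a.1
    · rw [mono_pos hK, monoRes_some]
    · rw [mono_neg hK, monoRes_none]
      refine (mono_neg fun hL => hK ?_).symm
      rw [shape_face h a.2]
      exact fun i hi => h' ((hL.2.2 i hi).1)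

theorem monoRes_act {I : Finset (Fin 3)} {d : ℤ} {J K : Cone} (h : K ≤ J) (s : S J)
    (x : Option {a // Shape I d J a}) :
    monoRes I d K (monoAct I d s x) =
      monoAct I d (AddSubmonoid.inclusion (S_anti h) s) (monoRes I d K x) := by
  rcases x with _ | a
  · rfl
  · rw [monoAct_some, monoRes_some]
    by_cases hK : ∀ i ∈ I, i ∈ K.1
    · rw [mono_pos ((shape_face h a.2).2 hK), monoAct_some]
      simp only [AddSubmonoid.coe_inclusion]
      by_cases hs : Shape I d J (a.1 + pairing s)
      · rw [mono_pos hs, monoRes_some]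
      · rw [mono_neg hs, monoRes_none]
        refine (mono_neg fun hs' => hs ⟨hs'.1, ?_, ?_⟩).symm
        · intro j hj
          have := a.2.2.1 j hj
          have := s.2 j hj
          simp only [Pi.add_apply]
          omega
        · exact fun i hi => ⟨(a.2.2.2 i hi).1, (hs'.2.2 i hi).2⟩
    · rw [mono_neg fun h' => hK ((shape_face h a.2).1 h'), monoAct_none]
      by_cases hs : Shape I d J (a.1 + pairing s)
      · rw [mono_pos hs, monoRes_some]
        exact mono_neg fun h' => hK ((shape_face h hs).1 h')
      · rw [mono_neg hs, monoRes_none]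

theorem neg_mem_S {K : Cone} {s : ℤ × ℤ} (h : ∀ j ∈ K.1, pairing s j = 0) : -s ∈ S K := by
  intro j hj
  have h1 := pairing_add s (-s)
  rw [add_neg_cancel, pairing_zero] at h1
  have h2 := congrFun h1 j
  have := h j hj
  simp only [Pi.add_apply, Pi.zero_apply] at h2
  omega

/-- For a face `K` of `J` and a bound `N`, there is a monomial in `S_J` that is a unit in `S_K` and
has exponent at least `N` at the rays of `J` not in `K`. -/
theorem exists_unit {J K : Cone} (N : ℤ) (hN : 0 ≤ N) : ∃ s ∈ S J,
    (∀ j ∈ K.1, j ∈ J.1 → pairing s j = 0) ∧ (∀ j ∈ J.1, j ∉ K.1 → pairing s j = N) := by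
  obtain ⟨l, hl⟩ := exists_notMem J
  let c : Fin 3 → ℤ := fun j => if j ∈ J.1 ∧ j ∉ K.1 then N else 0
  have hc : ∀ j, 0 ≤ c j := fun j => by dsimp [c]; split_ifs <;> simp [hN]
  have key : ∀ j, l ≠ j →
      pairing (ratio 0 l (c 0) + (ratio 1 l (c 1) + ratio 2 l (c 2))) j = c j := by
    intro j hj
    simp only [pairing_add, Pi.add_apply, pairing_ratio, if_neg hj]
    fin_cases j <;> simp
  have hne : ∀ j ∈ J.1, l ≠ j := fun j hj e => hl (e ▸ hj)
  refine ⟨ratio 0 l (c 0) + (ratio 1 l (c 1) + ratio 2 l (c 2)),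
    fun j hj => ?_, fun j hj hjJ => ?_, fun j hj hjK => ?_⟩
  · rw [key j (hne j hj)]; exact hc j
  · rw [key j (hne j hjJ)]; simp [c, hj]
  · rw [key j (hne j hj)]; simp [c, hj, hjK]

theorem monoRes_surj {I : Finset (Fin 3)} {d : ℤ} {J K : Cone} (h : K ≤ J)
    (y : Option {a // Shape I d K a}) : ∃ s : S J, -(s : ℤ × ℤ) ∈ S K ∧
      ∃ x : Option {a // Shape I d J a},
        monoAct I d (AddSubmonoid.inclusion (S_anti h) s) y = monoRes I d K x := by
  rcases y with _ | a
  · exact ⟨0, by simp, none, rfl⟩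
  · obtain ⟨s, hs, h0, h1⟩ := exists_unit (J := J) (K := K) (|a.1 0| + |a.1 1| + |a.1 2|)
      (by positivity)
    have hJ : Shape I d J (a.1 + pairing s) := by
      refine ⟨?_, ?_, ?_⟩
      · have := a.2.1
        have := pairing_sum s
        simp only [Pi.add_apply]
        omega
      · intro j hj
        simp only [Pi.add_apply]
        by_cases hjK : j ∈ K.1
        · have := a.2.2.1 j hjK
          have := h0 j hjK hj
          omega
        · rw [h1 j hj hjK]
          have p0 := abs_nonneg (a.1 0)
          have p1 := abs_nonneg (a.1 1)
          have p2 := abs_nonneg (a.1 2)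
          have q : -|a.1 j| ≤ a.1 j := neg_abs_le _
          fin_cases j <;> simp at q ⊢ <;> linarith
      · intro i hi
        obtain ⟨hiK, hi0⟩ := a.2.2.2 i hi
        have := h0 i hiK (h hiK)
        simp only [Pi.add_apply]
        exact ⟨h hiK, by omega⟩
    refine ⟨⟨s, hs⟩, neg_mem_S fun j hj => h0 j hj (h hj), some ⟨_, hJ⟩, ?_⟩
    rw [monoAct_some, monoRes_some]
    rfl

theorem monoRes_inj {I : Finset (Fin 3)} {d : ℤ} {J K : Cone} (h : K ≤ J)
    (x x' : Option {a // Shape I d J a}) (hx : monoRes I d K x = monoRes I d K x') :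
    ∃ s : S J, -(s : ℤ × ℤ) ∈ S K ∧ monoAct I d s x = monoAct I d s x' := by
  by_cases hI : ∀ i ∈ I, i ∈ K.1
  · refine ⟨0, by simp, ?_⟩
    rcases x with _ | a <;> rcases x' with _ | b
    · rfl
    · rw [monoRes_none, monoRes_some, mono_pos ((shape_face h b.2).2 hI)] at hx
      simp at hx
    · rw [monoRes_none, monoRes_some, mono_pos ((shape_face h a.2).2 hI)] at hx
      simp at hx
    · rw [monoRes_some, monoRes_some] at hx
      have := Subtype.ext (mono_inj hx ((shape_face h a.2).2 hI))
      rw [this]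
  · obtain ⟨s, hs, h0, h1⟩ := exists_unit (J := J) (K := K) 1 (by norm_num)
    push Not at hI
    obtain ⟨i, hi, hiK⟩ := hI
    have kill : ∀ z : Option {a // Shape I d J a}, monoAct I d ⟨s, hs⟩ z = none := by
      intro z
      rcases z with _ | a
      · rfl
      · rw [monoAct_some]
        refine mono_neg fun hz => ?_
        obtain ⟨hiJ, hz0⟩ := hz.2.2 i hi
        have := (a.2.2.2 i hi).2
        have := h1 i hiJ hiK
        simp only [Pi.add_apply] at hz0
        omega
    exact ⟨⟨s, hs⟩, neg_mem_S fun j hj => h0 j hj (h hj), by rw [kill, kill]⟩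

/-- The `T`-sheaf `𝒪_{Z_I}(d)` on `ℙ²`, where `Z_I = {X_i = 0 for i ∈ I}`. -/
noncomputable def twist (I : Finset (Fin 3)) (d : ℤ) : TSheaf where
  M J := Option {a // Shape I d J a}
  pointed _ := ⟨none⟩
  act s x := monoAct I d s x
  zero_act := monoAct_zero
  add_act := monoAct_add
  act_zero _ := rfl
  res _ x := monoRes I d _ x
  res_self := monoRes_self
  res_res := monoRes_res
  res_zero _ := rfl
  res_act := monoRes_act
  res_surj := monoRes_surj
  res_inj := monoRes_inj
  fg l := by
    refine ⟨{mono I d (chart l) (monoGen d l)}, fun x hx => ?_⟩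
    rcases x with _ | a
    · exact absurd rfl hx
    · refine ⟨_, Finset.mem_singleton_self _, ⟨_, monoDeg_mem a.2⟩, ?_⟩
      rw [mono_pos (shape_monoGen a.2), monoAct_some]
      simp only [monoGen_add a.2.1]
      exact (mono_pos a.2).symm
  alpha {J} s x y h := by
    by_cases h0 : monoAct I d s x = none
    · exact Or.inr h0
    · refine Or.inl ?_
      rcases x with _ | a
      · exact absurd rfl h0
      rcases y with _ | b
      · exact absurd h h0
      rw [monoAct_some] at h0
      have := mono_inj h (mono_eq_some h0)
      rw [Subtype.ext (add_right_cancel this)]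
  graded l := by
    refine ⟨fun x => x.elim 0 fun a => ⟨monoDeg d l a.1, monoDeg_mem a.2⟩, fun s x hx => ?_⟩
    rcases x with _ | a
    · exact absurd rfl hx
    · have hs : Shape I d (chart l) (a.1 + pairing s) := mono_eq_some hx
      rw [monoAct_some, mono_pos hs]
      apply Subtype.ext
      simp only [Option.elim, AddSubmonoid.coe_add]
      ext <;> simp [monoDeg, pairing] <;> ring

/-- The line bundle `𝒪(m)` on `ℙ²`. -/
noncomputable def O (m : ℤ) : TSheaf := twist ∅ m

/-- `𝒪_i(n)`: the push-forward to `ℙ²` of `𝒪_{ℙ¹}(n)` on the boundary line `X_i = 0`, opposite to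
the vertex `p_i`. -/
noncomputable def lineO (i : Fin 3) (n : ℤ) : TSheaf := twist {i} n

theorem isTorsionFree_O (m : ℤ) : IsTorsionFree (O m) := by
  intro J x hx s
  rcases x with _ | a
  · exact absurd rfl hx
  · have h : Shape ∅ m J (a.1 + pairing s) := by
      refine ⟨?_, ?_, by simp⟩
      · have := a.2.1
        have := pairing_sum s
        simp only [Pi.add_apply]
        omega
      · intro j hj
        have := a.2.2.1 j hj
        have := s.2 j hj
        simp only [Pi.add_apply]
        omega
    change mono ∅ m J _ ≠ none
    rw [mono_pos h]
    simp

/- ## The Hall algebra -/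

/-- The set `Iso(Coh^T(ℙ²))` of isomorphism classes. -/
abbrev IsoClass : Type 1 := Quotient (isIsomorphicSetoid TSheaf)

/-- The isomorphism class `[F]`. -/
def cls (F : TSheaf) : IsoClass := Quotient.mk (isIsomorphicSetoid TSheaf) F

/-- The admissible subobjects `N ⊆ Z` with `N ≃ Y` and `Z/N ≃ X`. Here an admissible subobject of `Z`
is recorded by its underlying subsets of the stalks: the `N` are the images of `i` for the
admissible short exact sequences `Y ↪ Z ↠ X` given by `i` and `p`. -/
def subobjects (X Y Z : TSheaf) : Set (∀ J, Set (Z.M J)) :=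
  {N | ∃ (i : Hom Y Z) (p : Hom Z X),
    (∀ J, Function.Injective (i.app J)) ∧ (∀ J, Function.Surjective (p.app J)) ∧
    (∀ J, Set.range (i.app J) = N J) ∧ (∀ J, {z | p.app J z = 0} = N J)}

/-- The structure constant `g^c_{a,b}` of the Hall algebra: the number of admissible subobjects
`N ⊆ Z` with `[N] = b` and `[Z/N] = a`, where `[Z] = c`. -/
noncomputable def hallNumber (a b c : IsoClass) : ℕ :=
  (subobjects a.out b.out c.out).ncard

/-- The convolution product with structure constants `g^c_{a,b}` is well defined, associative, and
has unit `[0]`. -/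
structure HallWellDefined : Prop where
  finite_subobjects : ∀ X Y Z : TSheaf, (subobjects X Y Z).Finite
  finite_support : ∀ a b : IsoClass, {c | hallNumber a b c ≠ 0}.Finite
  assoc : ∀ a b c d : IsoClass,
    ∑ᶠ e, hallNumber a b e * hallNumber e c d = ∑ᶠ e, hallNumber b c e * hallNumber a e d
  zero_left : ∀ b c : IsoClass, hallNumber (cls zeroSheaf) b c = Set.indicator {b} 1 c
  zero_right : ∀ a c : IsoClass, hallNumber a (cls zeroSheaf) c = Set.indicator {a} 1 c

section HallAlg

variable (k : Type*) [CommRing k] (h : HallWellDefined)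

/-- The product of two delta functions, `δ_a • δ_b = ∑_c g^c_{a,b} δ_c`. -/
noncomputable def hallMulSingle (a b : IsoClass) : IsoClass →₀ k :=
  Finsupp.ofSupportFinite (fun c => (hallNumber a b c : k))
    ((h.finite_support a b).subset fun c hc hc' => hc (by simp [hc']))

/-- The convolution product, extended bilinearly from delta functions. -/
noncomputable def hallMul : (IsoClass →₀ k) →ₗ[k] (IsoClass →₀ k) →ₗ[k] (IsoClass →₀ k) :=
  Finsupp.linearCombination k fun a => Finsupp.linearCombination k fun b => hallMulSingle k h a b

theorem hallMul_single (a b : IsoClass) :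
    hallMul k h (Finsupp.single a 1) (Finsupp.single b 1) = hallMulSingle k h a b := by
  simp [hallMul]

theorem hallMulSingle_apply (a b c : IsoClass) :
    hallMulSingle k h a b c = (hallNumber a b c : k) := rfl

theorem hallMul_left (f : IsoClass →₀ k) (c d : IsoClass) :
    hallMul k h f (Finsupp.single c 1) d = f.sum fun e x => x * (hallNumber e c d : k) := by
  rw [hallMul, Finsupp.linearCombination_apply, Finsupp.sum, LinearMap.sum_apply,
    Finsupp.finsetSum_apply, Finsupp.sum]
  refine Finset.sum_congr rfl fun e _ => ?_
  simp [hallMulSingle_apply]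

theorem hallMul_right (f : IsoClass →₀ k) (a d : IsoClass) :
    hallMul k h (Finsupp.single a 1) f d = f.sum fun e x => x * (hallNumber a e d : k) := by
  rw [hallMul, Finsupp.linearCombination_single, one_smul, Finsupp.linearCombination_apply,
    Finsupp.sum, Finsupp.finsetSum_apply, Finsupp.sum]
  refine Finset.sum_congr rfl fun e _ => ?_
  simp [hallMulSingle_apply]

theorem hallMulSingle_sum (a b : IsoClass) (φ : IsoClass → ℕ) :
    ((hallMulSingle k h a b).sum fun e x => x * (φ e : k)) =
      ((∑ᶠ e, hallNumber a b e * φ e : ℕ) : k) := by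
  have hs : (Function.support fun e => hallNumber a b e * φ e) ⊆ (h.finite_support a b).toFinset := by
    intro e he
    simp only [Set.Finite.coe_toFinset, Set.mem_ofPred_eq]
    exact fun h0 => he (by simp [h0])
  rw [finsum_eq_sum_of_support_subset _ hs, Finsupp.sum_of_support_subset (s :=
    (h.finite_support a b).toFinset)]
  · push_cast
    rfl
  · intro e he
    rw [Finsupp.mem_support_iff, hallMulSingle_apply] at he
    simp only [Set.Finite.mem_toFinset, Set.mem_ofPred_eq]
    exact fun h0 => he (by simp [h0])
  · simp

theorem hallMul_assoc (f g l : IsoClass →₀ k) :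
    hallMul k h (hallMul k h f g) l = hallMul k h f (hallMul k h g l) := by
  induction f using Finsupp.induction_linear with
  | zero => simp
  | add f f' hf hf' => simp only [map_add, LinearMap.add_apply, hf, hf']
  | single a x =>
    induction g using Finsupp.induction_linear with
    | zero => simp
    | add f f' hf hf' => simp only [map_add, LinearMap.add_apply, hf, hf']
    | single b y =>
      induction l using Finsupp.induction_linear with
      | zero => simp
      | add f f' hf hf' => simp only [map_add, hf, hf']
      | single c z =>
        have key : hallMul k h (hallMul k h (Finsupp.single a 1) (Finsupp.single b 1))
              (Finsupp.single c 1) =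
            hallMul k h (Finsupp.single a 1)
              (hallMul k h (Finsupp.single b 1) (Finsupp.single c 1)) := by
          ext d
          rw [hallMul_single, hallMul_single, hallMul_left, hallMul_right, hallMulSingle_sum,
            hallMulSingle_sum, h.assoc]
        rw [← mul_one x, ← mul_one y, ← mul_one z, ← smul_eq_mul, ← smul_eq_mul (a := y),
          ← smul_eq_mul (a := z), ← Finsupp.smul_single, ← Finsupp.smul_single,
          ← Finsupp.smul_single]
        simp only [map_smul, LinearMap.smul_apply, key]

theorem hallMul_one_left (f : IsoClass →₀ k) :
    hallMul k h (Finsupp.single (cls zeroSheaf) 1) f = f := by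
  ext d
  rw [hallMul_right, Finsupp.sum, Finset.sum_eq_single d]
  · simp [h.zero_left]
  · intro e _ he
    simp [h.zero_left, he.symm]
  · intro hd
    simp [Finsupp.notMem_support_iff.1 hd]

theorem hallMul_one_right (f : IsoClass →₀ k) :
    hallMul k h f (Finsupp.single (cls zeroSheaf) 1) = f := by
  ext d
  rw [hallMul_left, Finsupp.sum, Finset.sum_eq_single d]
  · simp [h.zero_right]
  · intro e _ he
    simp [h.zero_right, he.symm]
  · intro hd
    simp [Finsupp.notMem_support_iff.1 hd]

/-- The Hall algebra of `Coh^T(ℙ²)` over `k`: finitely supported functions on the set of isomorphism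
classes, with the convolution product. -/
def HallAlg (k : Type*) [CommRing k] (_h : HallWellDefined) : Type _ := IsoClass →₀ k

noncomputable instance : AddCommGroup (HallAlg k h) := inferInstanceAs (AddCommGroup (IsoClass →₀ k))

noncomputable instance : Module k (HallAlg k h) := inferInstanceAs (Module k (IsoClass →₀ k))

noncomputable instance : Ring (HallAlg k h) :=
  { (inferInstance : AddCommGroup (HallAlg k h)) with
    mul := fun f g => hallMul k h f g
    one := (Finsupp.single (cls zeroSheaf) 1 : IsoClass →₀ k)
    mul_assoc := hallMul_assoc k h
    one_mul := hallMul_one_left k h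
    mul_one := hallMul_one_right k h
    left_distrib := fun f g g' => (hallMul k h f).map_add g g'
    right_distrib := fun f f' g => (hallMul k h).map_add₂ f f' g
    zero_mul := fun f => (hallMul k h).map_zero₂ f
    mul_zero := fun f => (hallMul k h f).map_zero }

noncomputable instance : Algebra k (HallAlg k h) :=
  Algebra.ofModule (fun r f g => (hallMul k h).map_smul₂ r f g)
    (fun r f g => (hallMul k h f).map_smul r g)

/-- The delta function of the isomorphism class of `F`. -/
noncomputable def δ (F : TSheaf) : HallAlg k h := (Finsupp.single (cls F) 1 : IsoClass →₀ k)

/-- The span of the classes of the indecomposable sheaves, the underlying space of the Hall Lie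
algebra `𝔫` (whose bracket is the commutator). -/
noncomputable def indecSpan : Submodule k (HallAlg k h) :=
  Submodule.span k {f | ∃ F, IsIndecomposable F ∧ f = δ k h F}

/-- The Lie algebra `𝔨` generated by the `𝒪_i(n)`. -/
noncomputable def lineLie : LieSubalgebra k (HallAlg k h) :=
  LieSubalgebra.lieSpan k (HallAlg k h) {f | ∃ i n, f = δ k h (lineO i n)}

/-- The generator `𝒪_i(n)` of `𝔨`. -/
noncomputable def lineGen (i : Fin 3) (n : ℤ) : lineLie k h :=
  ⟨δ k h (lineO i n), LieSubalgebra.subset_lieSpan ⟨i, n, rfl⟩⟩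

/-- The subalgebra generated by the classes of the torsion-free sheaves. -/
noncomputable def TF : Subalgebra k (HallAlg k h) :=
  Algebra.adjoin k {f | ∃ F, IsTorsionFree F ∧ f = δ k h F}

/-- The class `[𝒪(n)]`, as an element of `TF`. -/
noncomputable def xO (n : ℤ) : TF k h :=
  ⟨δ k h (O n), Algebra.subset_adjoin ⟨O n, isTorsionFree_O n, rfl⟩⟩

/-- The ideal of `TF` generated by the classes of the torsion-free sheaves that are not locally
free. -/
noncomputable def nonLocFree : Ideal (TF k h) :=
  Ideal.span {f | ∃ F, IsTorsionFree F ∧ ¬ IsLocallyFree F ∧ (f : HallAlg k h) = δ k h F}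

end HallAlg

/- ## Infinite matrices -/

/-- The space with basis `ℤ`, on which `ℤ × ℤ` matrices with finitely many non-zero entries act. -/
def Vec (k : Type*) [CommRing k] : Type _ := ℤ →₀ k

noncomputable instance (k : Type*) [CommRing k] : AddCommGroup (Vec k) :=
  inferInstanceAs (AddCommGroup (ℤ →₀ k))

noncomputable instance (k : Type*) [CommRing k] : Module k (Vec k) :=
  inferInstanceAs (Module k (ℤ →₀ k))

/-- The basis vector `e_i`. -/
noncomputable def basisVec (k : Type*) [CommRing k] (i : ℤ) : Vec k :=
  (Finsupp.single i 1 : ℤ →₀ k)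

/-- The `j`-th coordinate. -/
noncomputable def coord (k : Type*) [CommRing k] (j : ℤ) : Vec k →ₗ[k] k :=
  (Finsupp.lapply j : (ℤ →₀ k) →ₗ[k] k)

theorem coord_basisVec (k : Type*) [CommRing k] (i j : ℤ) :
    coord k j (basisVec k i) = if j = i then 1 else 0 := by
  change (Finsupp.single i (1 : k)) j = _
  simp [Finsupp.single_apply, eq_comm]

/-- The identification of `Vec k` with the span of the variables of `k[x_n : n ∈ ℤ]`, sending `e_n`
to `x_n`. -/
noncomputable def toVariables (k : Type*) [CommRing k] : Vec k →ₗ[k] MvPolynomial ℤ k :=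
  (Finsupp.linearCombination k MvPolynomial.X : (ℤ →₀ k) →ₗ[k] MvPolynomial ℤ k)

/-- The matrix unit `E_{i,j}`, sending `e_j` to `e_i` and the other basis vectors to `0`. -/
noncomputable def E (k : Type*) [CommRing k] (i j : ℤ) : Module.End k (Vec k) :=
  (coord k j).smulRight (basisVec k i)

theorem E_mul (k : Type*) [CommRing k] (i j i' j' : ℤ) :
    E k i j * E k i' j' = if j = i' then E k i j' else 0 := by
  refine LinearMap.ext fun v => ?_
  simp only [E, Module.End.mul_apply, LinearMap.smulRight_apply, map_smul, coord_basisVec]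
  split_ifs with h <;> simp

/-- The span of the `E_{i,j}` with `i > j`. -/
noncomputable def lowerSpan (k : Type*) [CommRing k] : Submodule k (Module.End k (Vec k)) :=
  Submodule.span k {f | ∃ i j : ℤ, j < i ∧ f = E k i j}

theorem lowerSpan_comm (k : Type*) [CommRing k] {x y : Module.End k (Vec k)}
    (hx : x ∈ lowerSpan k) (hy : y ∈ lowerSpan k) : x * y - y * x ∈ lowerSpan k := by
  refine Submodule.span_induction₂ (p := fun x y _ _ => x * y - y * x ∈ lowerSpan k)
    ?_ ?_ ?_ ?_ ?_ ?_ ?_ hx hy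
  · rintro _ _ ⟨i, j, hij, rfl⟩ ⟨i', j', hij', rfl⟩
    rw [E_mul, E_mul]
    refine sub_mem ?_ ?_
    · split_ifs with h
      · exact Submodule.subset_span ⟨i, j', by omega, rfl⟩
      · exact Submodule.zero_mem _
    · split_ifs with h
      · exact Submodule.subset_span ⟨i', j, by omega, rfl⟩
      · exact Submodule.zero_mem _
  · intro y _; simp
  · intro x _; simp
  · intro x y z _ _ _ h1 h2
    have e : (x + y) * z - z * (x + y) = (x * z - z * x) + (y * z - z * y) := by noncomm_ring
    rw [e]; exact Submodule.add_mem _ h1 h2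
  · intro x y z _ _ _ h1 h2
    have e : x * (y + z) - (y + z) * x = (x * y - y * x) + (x * z - z * x) := by noncomm_ring
    rw [e]; exact Submodule.add_mem _ h1 h2
  · intro r x y _ _ h1
    rw [smul_mul_assoc, mul_smul_comm, ← smul_sub]; exact Submodule.smul_mem _ r h1
  · intro r x y _ _ h1
    rw [smul_mul_assoc, mul_smul_comm, ← smul_sub]; exact Submodule.smul_mem _ r h1

/-- The Lie algebra of strictly lower triangular `ℤ × ℤ` matrices spanned by the `E_{i,j}` with
`i > j`, with the commutator bracket. -/
noncomputable def glMinus (k : Type*) [CommRing k] : LieSubalgebra k (Module.End k (Vec k)) :=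
  { lowerSpan k with lie_mem' := fun hx hy => lowerSpan_comm k hx hy }

end MonoidP2

namespace MonoidP2

open CategoryTheory

-- Type α and the gradings make a `T`-sheaf combinatorial: away from zero the monoids act freely
-- (`TSheaf.act_free`), so a section is a generator together with a character.
--
-- The finiteness statements reflect that ℙ² is proper. The three pairings of a character sum to
-- zero, so in `S (chart l)` only finitely many characters have their pairing with `u_l` bounded
-- below (`finite_chart_ge`). Such a bound is found by comparison with the neighbouring chart for a
-- section that is non-zero on a ray (`finite_overlap`), and from Dickson's lemma for a section that
-- vanishes on both rays. Hence the sets of morphisms, and with them the sets of subobjects, are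
-- finite. An extension `Z` of `X` by `Y` consists of the sections of `Y` and the non-zero sections
-- of `X`; only the products that fall into `Y` are extra data. Finitely many such products
-- determine `Z` (`nonempty_iso_of_extValues`), and each takes finitely many values
-- (`finite_extValues`). Associativity holds because both sides count the same flags.
--
-- Commutators are controlled by splitting. If the complement of a subobject `N`, with zero
-- restored, is again closed under action and restriction, then exchanging `N` with this complement
-- exchanges the roles of subobject and quotient (`ncard_subobjects_comm`), so `Z` drops out of the
-- commutator. This applies in three situations: to a decomposable extension of indecomposable
-- sheaves, so the indecomposables span a Lie algebra; to an extension with torsion-free quotient,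
-- so 𝕋𝔽 is commutative and the product of two classes is a multiple of the class of the direct sum;
-- and to an extension of 𝒪_i(n) by a torsion-free sheaf that is not torsion-free itself, so
-- bracketing with 𝒪_i(n) preserves 𝕋𝔽.
--
-- A torsion-free sheaf splits into the orbits of the torus on its generic stalk. It is locally free
-- exactly when each orbit has a generator in every stalk that it meets (`HasLeast`); a single orbit
-- is then described by three minimal exponents, that is, it is some 𝒪(n) (`nonempty_iso_O`). The
-- multiplicity of 𝒪(n) counts direct summands and is an invariant, which identifies 𝕋𝔽/𝕁 with the
-- polynomial ring; characteristic zero makes the multiplicities in the products invertible.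
--
-- The line X_i = 0 has a local equation, so the kernel of a surjection from a locally free sheaf
-- onto 𝒪_i(n) is locally free (`IsExact.hasLeast`). Hence the action preserves 𝕁, and modulo 𝕁 the
-- only extension of 𝒪_i(n) by a line bundle is given by X_i : 𝒪(n-1) → 𝒪(n), with one subobject.
-- This is the derivation x_n ∂/∂x_{n-1}. Its matrix on the variables is `E k n (n - 1)`, and
-- commutators of these produce every strictly lower triangular matrix unit.

/- ## Faces and charts -/

/-- The inclusion of `S_J` into `S_K` for a face `K` of `J`. -/
abbrev faceIncl {J K : Cone} (h : K ≤ J) : S J →+ S K := AddSubmonoid.inclusion (S_anti h)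

/-- The ray spanned by `u_i`. -/
def ray (i : Fin 3) : Cone := ⟨{i}, by fin_cases i <;> decide⟩

/-- The zero cone. -/
def torus : Cone := ⟨∅, by decide⟩

theorem torus_le (J : Cone) : torus ≤ J := Finset.empty_subset _

theorem ray_le {i : Fin 3} {J : Cone} (h : i ∈ J.1) : ray i ≤ J :=
  Finset.singleton_subset_iff.2 h

theorem mem_chart {i l : Fin 3} : i ∈ (chart l).1 ↔ i ≠ l := by simp [chart]

theorem exists_le_chart (K : Cone) : ∃ l, K ≤ chart l := by
  obtain ⟨l, hl⟩ := exists_notMem K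
  exact ⟨l, fun j hj => mem_chart.2 fun e => hl (e ▸ hj)⟩

theorem mem_S_torus (e : ℤ × ℤ) : e ∈ S torus := fun j hj => by simp [torus] at hj

theorem pairing_neg (e : ℤ × ℤ) : pairing (-e) = -pairing e := by
  have h := pairing_add e (-e)
  rw [add_neg_cancel, pairing_zero] at h
  exact (neg_eq_of_add_eq_zero_right h.symm).symm

theorem pairing_sub (e f : ℤ × ℤ) : pairing (e - f) = pairing e - pairing f := by
  rw [sub_eq_add_neg, pairing_add, pairing_neg, sub_eq_add_neg]

theorem pairing_injective : Function.Injective pairing := by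
  intro e f h
  have h1 := congrFun h 1
  have h2 := congrFun h 2
  simp only [pairing, Matrix.cons_val] at h1 h2
  exact Prod.ext h1 h2

theorem pairing_eq_zero_of_unit {J : Cone} {s : ℤ × ℤ} (h : s ∈ S J) (h' : -s ∈ S J) {j : Fin 3}
    (hj : j ∈ J.1) : pairing s j = 0 := by
  have h1 := h j hj
  have h2 := h' j hj
  rw [pairing_neg, Pi.neg_apply] at h2
  omega

/-- Every element of `S_K` becomes an element of `S_J` after adding an element of `S_J` that is a
unit of `S_K`. -/
theorem exists_unit_add {J K : Cone} (h : K ≤ J) {s : ℤ × ℤ} (hs : s ∈ S K) :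
    ∃ u : S J, -(u : ℤ × ℤ) ∈ S K ∧ (u : ℤ × ℤ) + s ∈ S J := by
  obtain ⟨u, hu, h0, h1⟩ := exists_unit (J := J) (K := K)
    (|pairing s 0| + |pairing s 1| + |pairing s 2|) (by positivity)
  refine ⟨⟨u, hu⟩, neg_mem_S fun j hj => h0 j hj (h hj), fun j hj => ?_⟩
  rw [pairing_add, Pi.add_apply]
  dsimp only
  by_cases hjK : j ∈ K.1
  · have := hs j hjK
    have := h0 j hjK hj
    omega
  · rw [h1 j hj hjK]
    have p0 := abs_nonneg (pairing s 0)
    have p1 := abs_nonneg (pairing s 1)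
    have p2 := abs_nonneg (pairing s 2)
    have q := neg_abs_le (pairing s j)
    fin_cases j <;> simp at q ⊢ <;> linarith

/- ## Elementary properties of `T`-sheaves -/

namespace TSheaf

variable (F : TSheaf) {J K L : Cone}

theorem act_comm (s t : S J) (x : F.M J) : F.act s (F.act t x) = F.act t (F.act s x) := by
  rw [← F.add_act, ← F.add_act, add_comm]

theorem act_neg_act (s : S J) (hs : -(s : ℤ × ℤ) ∈ S J) (x : F.M J) :
    F.act ⟨_, hs⟩ (F.act s x) = x := by
  rw [← F.add_act]
  convert F.zero_act x
  exact Subtype.ext (neg_add_cancel _)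

variable {F}

theorem act_cancel {s : S J} (hs : -(s : ℤ × ℤ) ∈ S J) {x y : F.M J}
    (h : F.act s x = F.act s y) : x = y := by
  rw [← F.act_neg_act s hs x, h, F.act_neg_act]

theorem act_unit_ne {s : S J} (hs : -(s : ℤ × ℤ) ∈ S J) {x : F.M J} (h : x ≠ 0) :
    F.act s x ≠ 0 := fun h' => h (act_cancel hs (h'.trans (F.act_zero s).symm))

theorem ne_of_act_ne {s : S J} {x : F.M J} (h : F.act s x ≠ 0) : x ≠ 0 :=
  fun h' => h (by rw [h', F.act_zero])

theorem ne_of_res_ne {h : K ≤ J} {x : F.M J} (hx : F.res h x ≠ 0) : x ≠ 0 :=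
  fun h' => hx (by rw [h', F.res_zero])

theorem act_cancel_of_ne {s : S J} {x y : F.M J} (h : F.act s x = F.act s y)
    (h0 : F.act s x ≠ 0) : x = y := (F.alpha s x y h).resolve_right h0

theorem res_eq_zero_of_act {h : K ≤ J} {s : S J} (hs : -(s : ℤ × ℤ) ∈ S K) {x : F.M J}
    (hx : F.act s x = 0) : F.res h x = 0 := by
  by_contra h0
  refine act_unit_ne (s := faceIncl h s) hs h0 ?_
  rw [← F.res_act, hx, F.res_zero]

theorem res_eq_zero_iff (h : K ≤ J) (x : F.M J) :
    F.res h x = 0 ↔ ∃ s : S J, -(s : ℤ × ℤ) ∈ S K ∧ F.act s x = 0 := by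
  refine ⟨fun hx => ?_, fun ⟨s, hs, hx⟩ => res_eq_zero_of_act hs hx⟩
  obtain ⟨s, hs, e⟩ := F.res_inj h x 0 (by rw [hx, F.res_zero])
  exact ⟨s, hs, by rw [e, F.act_zero]⟩

/-- Type α survives localization: sections that agree on a face agree after multiplication by a unit
of the face, and this multiple is non-zero. -/
theorem res_cancel (h : K ≤ J) {x y : F.M J} (e : F.res h x = F.res h y) (h0 : F.res h x ≠ 0) :
    x = y := by
  obtain ⟨s, hs, e⟩ := F.res_inj h x y e
  exact act_cancel_of_ne e fun h' => h0 (res_eq_zero_of_act hs h')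

/-- The grading recovers the character: the degree of `act s x` is `s + deg x`. -/
theorem act_free_chart {l : Fin 3} {s t : S (chart l)} {x : F.M (chart l)}
    (h : F.act s x = F.act t x) (h0 : F.act s x ≠ 0) : s = t := by
  obtain ⟨deg, hdeg⟩ := F.graded l
  have h1 := hdeg s x h0
  rw [h, hdeg t x (h ▸ h0)] at h1
  exact (add_right_cancel h1).symm

/-- Away from zero, the monoids act freely. -/
theorem act_free {s t : S J} {x : F.M J} (h : F.act s x = F.act t x) (h0 : F.act s x ≠ 0) :
    s = t := by
  -- Gradings exist only on the maximal charts. Units `u`, `v`, `w` of `S J` clear the denominators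
  -- of `x`, `s` and `t`, and the two sides are compared on a chart.
  obtain ⟨l, hl⟩ := exists_le_chart J
  obtain ⟨u, hu, y, hy⟩ := F.res_surj hl x
  obtain ⟨v, hv, hvs⟩ := exists_unit_add hl s.2
  obtain ⟨w, hw, hwt⟩ := exists_unit_add hl t.2
  have e1 : F.act (faceIncl hl (w + u + v)) (F.act s x) =
      F.res hl (F.act (w + ⟨_, hvs⟩) y) := by
    rw [F.res_act, ← hy, ← F.add_act, ← F.add_act]
    congr 1
    exact Subtype.ext (by simp; abel)
  have e2 : F.act (faceIncl hl (w + u + v)) (F.act t x) =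
      F.res hl (F.act (v + ⟨_, hwt⟩) y) := by
    rw [F.res_act, ← hy, ← F.add_act, ← F.add_act]
    congr 1
    exact Subtype.ext (by simp; abel)
  have hunit : -((faceIncl hl (w + u + v) : S J) : ℤ × ℤ) ∈ S J := by
    have := add_mem (add_mem hw hu) hv
    convert this using 1
    simp; abel
  have hne := act_unit_ne hunit h0
  have e3 := e1.symm.trans ((congrArg _ h).trans e2)
  rw [e1] at hne
  have e4 := act_free_chart (res_cancel hl e3 hne) (ne_of_res_ne hne)
  have e5 := congrArg Subtype.val e4
  simp only [AddSubmonoid.coe_add] at e5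
  have e6 : (w : ℤ × ℤ) + v + s = w + v + t := by
    rw [add_assoc, e5]; abel
  exact Subtype.ext (add_left_cancel e6)

/-- A generating set of a stalk. -/
theorem exists_gens (F : TSheaf) (J : Cone) : ∃ G : Finset (F.M J), ∀ x : F.M J, x ≠ 0 →
    ∃ g ∈ G, ∃ s : S J, x = F.act s g := by
  classical
  obtain ⟨l, hl⟩ := exists_le_chart J
  obtain ⟨G, hG⟩ := F.fg l
  refine ⟨G.image (F.res hl), fun x hx => ?_⟩
  obtain ⟨u, hu, y, hy⟩ := F.res_surj hl x
  have hy0 : y ≠ 0 := by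
    refine ne_of_res_ne (h := hl) ?_
    rw [← hy]
    exact act_unit_ne (s := faceIncl hl u) hu hx
  obtain ⟨g, hg, s, rfl⟩ := hG y hy0
  refine ⟨F.res hl g, Finset.mem_image_of_mem _ hg, ⟨_, hu⟩ + faceIncl hl s, ?_⟩
  rw [F.add_act, ← F.res_act, ← hy]
  exact (F.act_neg_act (faceIncl hl u) hu x).symm

end TSheaf

/- ## Morphisms -/

namespace Hom

variable {F G H : TSheaf}

/-- A morphism given by its graph. -/
theorem exists_of_rel (R : ∀ J, F.M J → G.M J → Prop) (total : ∀ J x, ∃ y, R J x y)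
    (unique : ∀ J x y y', R J x y → R J x y' → y = y') (zero : ∀ J, R J 0 0)
    (act : ∀ J (s : S J) x y, R J x y → R J (F.act s x) (G.act s y))
    (res : ∀ J K (h : K ≤ J) x y, R J x y → R K (F.res h x) (G.res h y))
    (alpha : ∀ J x x' y, R J x y → R J x' y → x = x' ∨ y = 0) :
    ∃ f : Hom F G, ∀ J x y, R J x y ↔ f.app J x = y := by
  choose f hf using total
  refine ⟨⟨f, fun J => unique _ _ _ _ (hf _ _) (zero J),
    fun s x => unique _ _ _ _ (hf _ _) (act _ _ _ _ (hf _ _)),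
    fun h x => unique _ _ _ _ (hf _ _) (res _ _ _ _ _ (hf _ _)), fun x y h =>
      alpha _ _ _ _ (hf _ _) (h ▸ hf _ _)⟩, fun J x y => ⟨fun h => unique _ _ _ _ (hf _ _) h, ?_⟩⟩
  rintro rfl
  exact hf J x

/-- The identity morphism. -/
def id (F : TSheaf) : Hom F F := 𝟙 F

/-- The composition of `g` after `f`. -/
def comp (g : Hom G H) (f : Hom F G) : Hom F H := CategoryStruct.comp (obj := TSheaf) f g

@[simp] theorem comp_app (g : Hom G H) (f : Hom F G) (J : Cone) (x : F.M J) :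
    (g.comp f).app J x = g.app J (f.app J x) := rfl

theorem cancel (f : Hom F G) {J : Cone} {x y : F.M J} (h : f.app J x = f.app J y)
    (h0 : f.app J x ≠ 0) : x = y := (f.alpha x y h).resolve_right h0

theorem ne_of_app_ne (f : Hom F G) {J : Cone} {x : F.M J} (h : f.app J x ≠ 0) : x ≠ 0 :=
  fun h' => h (by rw [h', f.map_zero])

/-- All maps on stalks are injective. -/
def Inj (f : Hom F G) : Prop := ∀ J, Function.Injective (f.app J)

/-- All maps on stalks are surjective. -/
def Surj (f : Hom F G) : Prop := ∀ J, Function.Surjective (f.app J)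

theorem Inj.app_ne {f : Hom F G} (hf : f.Inj) {J : Cone} {x : F.M J} (h : x ≠ 0) :
    f.app J x ≠ 0 := fun h' => h (hf J (h'.trans (f.map_zero J).symm))

/-- A morphism that vanishes on the kernel of a surjective morphism factors through it. -/
theorem Surj.desc {q : Hom F G} (hq : q.Surj) (f : Hom F H)
    (hk : ∀ J x, q.app J x = 0 → f.app J x = 0) : ∃ g : Hom G H, ∀ J x,
      g.app J (q.app J x) = f.app J x := by
  obtain ⟨g, hg⟩ := exists_of_rel (F := G) (G := H)
    (fun J b w => ∃ x, q.app J x = b ∧ f.app J x = w)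
    (fun J b => by obtain ⟨x, hx⟩ := hq J b; exact ⟨_, x, hx, rfl⟩)
    (by
      rintro J _ _ _ ⟨x, rfl, rfl⟩ ⟨x', h, rfl⟩
      rcases q.alpha _ _ h with h' | h'
      · rw [h']
      · rw [hk _ _ h', hk _ x (h ▸ h')])
    (fun J => ⟨0, q.map_zero J, f.map_zero J⟩)
    (by rintro J s _ _ ⟨x, rfl, rfl⟩; exact ⟨F.act s x, q.map_act _ _, f.map_act _ _⟩)
    (by rintro J K h _ _ ⟨x, rfl, rfl⟩; exact ⟨F.res h x, q.map_res _ _, f.map_res _ _⟩)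
    (by
      rintro J _ _ _ ⟨x, rfl, rfl⟩ ⟨x', rfl, h⟩
      rcases f.alpha _ _ h with h' | h'
      · exact Or.inl (by rw [h'])
      · exact Or.inr (h ▸ h'))
  exact ⟨g, fun J x => (hg J _ _).1 ⟨x, rfl, rfl⟩⟩

/-- A morphism whose range is contained in that of an injective morphism factors through it. -/
theorem Inj.lift {i : Hom G H} (hi : i.Inj) (f : Hom F H)
    (hr : ∀ J x, f.app J x ∈ Set.range (i.app J)) : ∃ g : Hom F G, ∀ J x,
      i.app J (g.app J x) = f.app J x := by
  obtain ⟨g, hg⟩ := exists_of_rel (F := F) (G := G) (fun J x y => i.app J y = f.app J x)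
    (fun J x => hr J x)
    (fun J x y y' h h' => hi J (h.trans h'.symm))
    (fun J => by rw [i.map_zero, f.map_zero])
    (fun J s x y h => by rw [i.map_act, f.map_act, h])
    (fun J K h x y e => by rw [i.map_res, f.map_res, e])
    (fun J x x' y h h' => by
      rcases f.alpha _ _ (h.symm.trans h') with e | e
      · exact Or.inl e
      · exact Or.inr (hi J (by rw [h, e, i.map_zero])))
  exact ⟨g, fun J x => (hg J x _).2 rfl⟩

/-- Compatibility of the inverse with action, restriction and condition α comes from lifting the
identity through the injective morphism `f`. -/
theorem nonempty_iso_of_bijective (f : Hom F G) (hi : f.Inj) (hs : f.Surj) : Nonempty (F ≅ G) := by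
  obtain ⟨g, hg⟩ := hi.lift (Hom.id G) (fun J x => hs J x)
  refine ⟨⟨f, g, ?_, ?_⟩⟩
  · exact Hom.ext (funext fun J => funext fun x => hi J (hg J _))
  · exact Hom.ext (funext fun J => funext fun x => hg J _)

theorem iso_hom_inv (e : F ≅ G) (J : Cone) (x : F.M J) :
    Hom.app e.inv J (Hom.app e.hom J x) = x := by
  have h := e.hom_inv_id
  exact congrFun (congrFun (congrArg Hom.app h) J) x

theorem iso_inv_hom (e : F ≅ G) (J : Cone) (x : G.M J) :
    Hom.app e.hom J (Hom.app e.inv J x) = x := by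
  have h := e.inv_hom_id
  exact congrFun (congrFun (congrArg Hom.app h) J) x

theorem inj_iso (e : F ≅ G) : Inj (e.hom : Hom F G) := fun J x y h => by
  rw [← iso_hom_inv e J x, h, iso_hom_inv]

theorem surj_iso (e : F ≅ G) : Surj (e.hom : Hom F G) := fun J x => ⟨_, iso_inv_hom e J x⟩

theorem Inj.comp {g : Hom G H} {f : Hom F G} (hg : g.Inj) (hf : f.Inj) : (g.comp f).Inj :=
  fun J => (hg J).comp (hf J)

theorem Surj.comp {g : Hom G H} {f : Hom F G} (hg : g.Surj) (hf : f.Surj) : (g.comp f).Surj :=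
  fun J => (hg J).comp (hf J)

end Hom

/- ## Finiteness of the sets of morphisms -/

/-- Dickson's lemma: every set of characters in `S_J` has a finite subset that generates it. -/
theorem exists_finite_basis {J : Cone} (P : Set (S J)) :
    ∃ B : Finset (S J), (∀ b ∈ B, b ∈ P) ∧ ∀ s ∈ P, ∃ b ∈ B, ∃ r, s = r + b := by
  classical
  -- The exponents along the rays of `J` map `S J` to ℕ³, and `φ t ≤ φ s` says exactly that `s - t`
  -- lies in `S J`. Minimal elements of the image form a finite antichain.
  let φ : S J → Fin 3 → ℕ := fun s j => if j ∈ J.1 then (pairing s j).toNat else 0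
  have hpwo : (φ '' P).IsPWO := Set.isPWO_of_wellQuasiOrderedLE _
  have hfin : {t | Minimal (· ∈ φ '' P) t}.Finite :=
    WellQuasiOrderedLE.finite_of_isAntichain (setOfPred_minimal_antichain _)
  have hpre : ∀ t : Fin 3 → ℕ, ∃ s, t ∈ φ '' P → s ∈ P ∧ φ s = t := fun t => by
    by_cases h : t ∈ φ '' P
    · obtain ⟨s, hs⟩ := h
      exact ⟨s, fun _ => hs⟩
    · exact ⟨0, fun h' => absurd h' h⟩
  choose g hg using hpre
  refine ⟨hfin.toFinset.image g, fun b hb => ?_, fun s hs => ?_⟩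
  · obtain ⟨t, ht, rfl⟩ := Finset.mem_image.1 hb
    exact (hg t ((Set.Finite.mem_toFinset _).1 ht).prop).1
  · obtain ⟨t, hts, ht⟩ := hpwo.exists_le_minimal (Set.mem_image_of_mem φ hs)
    refine ⟨g t, Finset.mem_image_of_mem _ ((Set.Finite.mem_toFinset _).2 ht), ⟨s - g t, ?_⟩, ?_⟩
    · intro j hj
      have h1 := hts j
      rw [← (hg t ht.prop).2] at h1
      simp only [φ, if_pos hj] at h1
      have h2 := s.2 j hj
      have h3 := (g t).2 j hj
      rw [pairing_sub, Pi.sub_apply]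
      omega
    · exact Subtype.ext (by simp)

/-- On `S (chart l)` the pairings with the two rays of the chart are non-negative and all three sum
to zero, so a lower bound at `l` bounds the other two from above. -/
theorem finite_chart_ge (l : Fin 3) (c : ℤ) : {s : S (chart l) | c ≤ pairing s l}.Finite := by
  refine Set.Finite.of_finite_image (f := fun s => pairing (s : ℤ × ℤ)) ?_ fun s _ t _ h =>
    Subtype.ext (pairing_injective h)
  refine (Set.finite_Icc (fun _ => -|c| : Fin 3 → ℤ) (fun _ => |c|)).subset ?_
  rintro _ ⟨s, hs, rfl⟩
  have hs' : c ≤ pairing s l := hs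
  have h := pairing_sum s
  have h0 : 0 ≠ l → 0 ≤ pairing (s : ℤ × ℤ) 0 := fun h => s.2 _ (mem_chart.2 h)
  have h1 : 1 ≠ l → 0 ≤ pairing (s : ℤ × ℤ) 1 := fun h => s.2 _ (mem_chart.2 h)
  have h2 : 2 ≠ l → 0 ≤ pairing (s : ℤ × ℤ) 2 := fun h => s.2 _ (mem_chart.2 h)
  have a1 := neg_abs_le c
  have a2 := abs_nonneg c
  rw [Set.mem_Icc, Pi.le_def, Pi.le_def, ← forall_and]
  intro j
  fin_cases l <;> simp at h0 h1 h2 hs' <;> fin_cases j <;> simp <;> constructor <;> linarith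

/-- The character `X_j/X_l`, an element of `S_{σ_l}`. -/
def coordChar (l j : Fin 3) (n : ℕ) : S (chart l) :=
  ⟨ratio j l n, fun i hi => by
    rw [pairing_ratio, if_neg (mem_chart.1 hi).symm]
    split_ifs <;> simp⟩

theorem pairing_coordChar (l j : Fin 3) (n : ℕ) (i : Fin 3) :
    pairing (coordChar l j n : ℤ × ℤ) i = (if j = i then (n : ℤ) else 0) - if l = i then (n : ℤ) else 0 :=
  pairing_ratio j l n i

/-- The third index. -/
theorem exists_third {i l : Fin 3} (h : i ≠ l) : ∃ j, j ≠ i ∧ j ≠ l := by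
  revert i l; decide

theorem eq_of_three {i j l : Fin 3} (h : i ≠ l) (hi : j ≠ i) (hl : j ≠ l) (m : Fin 3) :
    m = i ∨ m = j ∨ m = l := by
  revert i j l m; decide

theorem pairing_sum_three {i j l : Fin 3} (h : i ≠ l) (hi : j ≠ i) (hl : j ≠ l) (e : ℤ × ℤ) :
    pairing e i + pairing e j + pairing e l = 0 := by
  have := pairing_sum e
  fin_cases i <;> fin_cases j <;> fin_cases l <;> simp at h hi hl ⊢ <;> linarith

/-! ### Finiteness of the values of morphisms on a chart -/

namespace TSheaf

variable {F : TSheaf}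

theorem ray_le_chart {i l : Fin 3} (h : i ≠ l) : ray i ≤ chart l := ray_le (mem_chart.2 h)

/-- If sections `s g` over `σ_l` are, up to a fixed unit, equal on the ray `i` to
multiples of a section `g'` over `σ_j`, then `s` lies in a finite set. -/
theorem finite_overlap {i j l : Fin 3} (hil : i ≠ l) (hji : j ≠ i) (hjl : j ≠ l)
    (g : F.M (chart l)) (g' : F.M (chart j)) (T : S (ray i)) (hT : -(T : ℤ × ℤ) ∈ S (ray i)) :
    {s : S (chart l) | F.res (ray_le_chart hil) (F.act s g) ≠ 0 ∧ ∃ s' : S (chart j),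
      F.act T (F.res (ray_le_chart hil) (F.act s g)) =
        F.res (ray_le_chart hji.symm) (F.act s' g')}.Finite := by
  set A := {s : S (chart l) | F.res (ray_le_chart hil) (F.act s g) ≠ 0 ∧ ∃ s' : S (chart j),
      F.act T (F.res (ray_le_chart hil) (F.act s g)) =
        F.res (ray_le_chart hji.symm) (F.act s' g')} with hA
  rcases A.eq_empty_or_nonempty with h | h
  · rw [h]; exact Set.finite_empty
  -- Minimality of `s₀` along the ray `i` makes `s - s₀` an element of `S (ray i)` for every other
  -- `s` in the set.
  obtain ⟨s₀, hs₀, hmin⟩ := WellFounded.has_min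
    (InvImage.wf (fun s : S (chart l) => (pairing s i).toNat) Nat.lt_wfRel.wf) A h
  obtain ⟨h0, s₀', e₀⟩ := hs₀
  refine (finite_chart_ge l (pairing s₀ l - pairing s₀' l)).subset ?_
  rintro s ⟨h1, s', e⟩
  have hle : (pairing s₀ i).toNat ≤ (pairing s i).toNat :=
    not_lt.1 fun h' => hmin s ⟨h1, s', e⟩ h'
  have p0 := s₀.2 i (mem_chart.2 hil)
  have p1 := s.2 i (mem_chart.2 hil)
  have hd : (s : ℤ × ℤ) - s₀ ∈ S (ray i) := by
    intro m hm
    obtain rfl := Finset.mem_singleton.1 hm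
    rw [pairing_sub, Pi.sub_apply]
    omega
  have e2 : F.res (ray_le_chart hil) (F.act s g) =
      F.act ⟨_, hd⟩ (F.res (ray_le_chart hil) (F.act s₀ g)) := by
    rw [F.res_act, F.res_act, ← F.add_act]
    congr 1
    exact Subtype.ext (by simp)
  have e3 : F.act (⟨_, hd⟩ + faceIncl (ray_le_chart hji.symm) s₀')
      (F.res (ray_le_chart hji.symm) g') = F.act (faceIncl (ray_le_chart hji.symm) s')
      (F.res (ray_le_chart hji.symm) g') := by
    rw [F.add_act, ← F.res_act, ← F.res_act, ← e₀, ← e, e2, F.act_comm]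
  have h2 : F.act (⟨_, hd⟩ + faceIncl (ray_le_chart hji.symm) s₀')
      (F.res (ray_le_chart hji.symm) g') ≠ 0 := by
    rw [e3, ← F.res_act, ← e]
    exact act_unit_ne hT h1
  -- By freeness `s - s₀ + s₀' = s'`. The ray `l` belongs to `chart j`, so `s'` pairs non-negatively
  -- with it, and this bounds the pairing of `s` with `l` from below.
  have e4 := congrArg (fun t : S (ray i) => pairing t l) (act_free e3 h2)
  have p2 := s'.2 l (mem_chart.2 hjl.symm)
  simp only [AddSubmonoid.coe_add, AddSubmonoid.coe_inclusion, pairing_add, pairing_sub,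
    Pi.add_apply, Pi.sub_apply] at e4
  change pairing s₀ l - pairing s₀' l ≤ pairing s l
  omega

/-- A unit of the ray `i` is on the chart `σ_l` a power of the other coordinate. -/
theorem unit_ray {i l : Fin 3} (hil : i ≠ l) {u : S (chart l)}
    (hu : -(u : ℤ × ℤ) ∈ S (ray i)) : pairing u i = 0 :=
  pairing_eq_zero_of_unit (J := ray i) (S_anti (ray_le_chart hil) u.2) hu
    (Finset.mem_singleton_self i)

/-- By Dickson's lemma the multiples vanishing on both rays are generated by finitely many `b`. Each
`act b g` is killed by a power of either coordinate of the chart, which leaves finitely many further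
multiples that are non-zero. -/
theorem finite_supported_at_point {l : Fin 3} (g : F.M (chart l)) :
    {s : S (chart l) | F.act s g ≠ 0 ∧ ∀ i, ∀ h : i ≠ l,
      F.res (ray_le_chart h) (F.act s g) = 0}.Finite := by
  obtain ⟨B, hB, hgen⟩ := exists_finite_basis
    {s : S (chart l) | ∀ i, ∀ h : i ≠ l, F.res (ray_le_chart h) (F.act s g) = 0}
  have key : ∀ b ∈ B, {r : S (chart l) | F.act (r + b) g ≠ 0}.Finite := by
    intro b hb
    have hb' : ∀ i, ∃ u : S (chart l), i ≠ l → -(u : ℤ × ℤ) ∈ S (ray i) ∧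
        F.act u (F.act b g) = 0 := fun i => by
      by_cases h : i ≠ l
      · obtain ⟨u, hu⟩ := (res_eq_zero_iff _ _).1 (hB b hb i h)
        exact ⟨u, fun _ => hu⟩
      · exact ⟨0, fun h' => absurd h' h⟩
    choose u hu using hb'
    obtain ⟨i, hil⟩ := exists_ne l
    obtain ⟨j, hji, hjl⟩ := exists_third hil
    refine (finite_chart_ge l (-(pairing (u i) j) - pairing (u j) i)).subset fun r hr => ?_
    -- `u i` is a unit on the ray `i`, hence involves only the coordinate `j`; if `r` is divisible
    -- by it, then `r + b` kills `g`.
    have bound : ∀ i j : Fin 3, i ≠ l → j ≠ i → j ≠ l → pairing r j < pairing (u i) j := by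
      intro i j hil hji hjl
      by_contra hlt
      refine hr ?_
      have hd : (r : ℤ × ℤ) - u i ∈ S (chart l) := by
        intro m hm
        have hz := unit_ray hil (hu i hil).1
        have p := r.2 m hm
        rw [pairing_sub, Pi.sub_apply]
        rcases eq_of_three hil hji hjl m with rfl | rfl | rfl
        · omega
        · omega
        · exact absurd rfl (mem_chart.1 hm)
      have : r = ⟨_, hd⟩ + u i := Subtype.ext (by simp)
      rw [this, F.add_act, F.add_act, (hu i hil).2, F.act_zero]
    have b1 := bound i j hil hji hjl
    have b2 := bound j i hjl hji.symm hil
    have b3 := pairing_sum_three hil hji hjl r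
    change _ ≤ pairing r l
    omega
  refine (Set.Finite.biUnion B.finite_toSet fun b hb => (key b hb).image (· + b)).subset ?_
  rintro s ⟨hs, hs'⟩
  obtain ⟨b, hb, r, rfl⟩ := hgen s hs'
  exact Set.mem_biUnion hb ⟨r, hs, rfl⟩

/-- If `x` is non-zero on the ray `i`, it coincides there up to a unit with a section over the other
chart containing this ray. -/
theorem exists_other_chart {i j l : Fin 3} (hil : i ≠ l) (hji : j ≠ i) (x : F.M (chart l)) :
    ∃ T : S (ray i), -(T : ℤ × ℤ) ∈ S (ray i) ∧ ∃ x' : F.M (chart j),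
      F.act T (F.res (ray_le_chart hil) x) = F.res (ray_le_chart hji.symm) x' := by
  obtain ⟨u, hu, x', e⟩ := F.res_surj (ray_le_chart hji.symm) (F.res (ray_le_chart hil) x)
  exact ⟨_, hu, x', e⟩

/-- An image that vanishes on both rays is covered by `finite_supported_at_point`. If it is non-zero
on the ray `i`, then `y` agrees there, up to a unit depending on `y` alone, with a section over the
other chart; applying `f` to both puts the image in the scope of `finite_overlap`. -/
theorem finite_hom_app (F G : TSheaf) {l : Fin 3} (y : F.M (chart l)) :
    {z | ∃ f : Hom F G, f.app _ y = z}.Finite := by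
  classical
  obtain ⟨A, hA⟩ := G.exists_gens (chart l)
  have key : ∀ g ∈ A, {s : S (chart l) | G.act s g ≠ 0 ∧
      ∃ f : Hom F G, f.app _ y = G.act s g}.Finite := by
    intro g _
    have key2 : ∀ i, ∀ hil : i ≠ l, {s : S (chart l) | (∃ f : Hom F G, f.app _ y = G.act s g) ∧
        G.res (ray_le_chart hil) (G.act s g) ≠ 0}.Finite := by
      intro i hil
      obtain ⟨j, hji, hjl⟩ := exists_third hil
      obtain ⟨T, hT, y', e⟩ := exists_other_chart (j := j) hil hji y
      obtain ⟨A', hA'⟩ := G.exists_gens (chart j)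
      refine (Set.Finite.biUnion A'.finite_toSet fun g' _ =>
        finite_overlap hil hji hjl g g' T hT).subset ?_
      rintro s ⟨⟨f, hf⟩, h0⟩
      have e' : G.act T (G.res (ray_le_chart hil) (G.act s g)) =
          G.res (ray_le_chart hji.symm) (f.app _ y') := by
        rw [← hf, ← f.map_res, ← f.map_act, e, f.map_res]
      have hne : f.app _ y' ≠ 0 := by
        refine ne_of_res_ne (h := ray_le_chart hji.symm) ?_
        rw [← e']
        exact act_unit_ne hT h0
      obtain ⟨g', hg', s', hs'⟩ := hA' _ hne
      exact Set.mem_biUnion hg' ⟨h0, s', by rw [e', hs']⟩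
    refine ((finite_supported_at_point g).union
      (Set.finite_iUnion fun i : {i : Fin 3 // i ≠ l} => key2 i.1 i.2)).subset ?_
    rintro s ⟨h0, hf⟩
    by_cases h : ∀ i, ∀ h : i ≠ l, G.res (ray_le_chart h) (G.act s g) = 0
    · exact Or.inl ⟨h0, h⟩
    · push Not at h
      obtain ⟨i, hil, hi⟩ := h
      exact Or.inr (Set.mem_iUnion.2 ⟨⟨i, hil⟩, hf, hi⟩)
  refine ((Set.Finite.biUnion A.finite_toSet fun g hg =>
    (key g hg).image fun s => G.act s g).union (Set.finite_singleton 0)).subset ?_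
  rintro z ⟨f, hf⟩
  by_cases hz : z = 0
  · exact Or.inr hz
  · obtain ⟨g, hg, s, rfl⟩ := hA z hz
    exact Or.inl (Set.mem_biUnion hg ⟨s, ⟨hz, f, hf⟩, rfl⟩)

end TSheaf

/-- After multiplication by a unit every section over `J` is the restriction of a section over a
chart, and units can be cancelled. -/
theorem Hom.ext_of_chart {F G : TSheaf} {f f' : Hom F G}
    (h : ∀ l x, f.app (chart l) x = f'.app (chart l) x) : f = f' := by
  refine Hom.ext (funext fun J => funext fun x => ?_)
  obtain ⟨l, hl⟩ := exists_le_chart J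
  obtain ⟨u, hu, y, e⟩ := F.res_surj hl x
  refine TSheaf.act_cancel (s := faceIncl hl u) hu ?_
  rw [← f.map_act, ← f'.map_act, e, f.map_res, f'.map_res, h]

/-- The sets of morphisms in `Coh^T(ℙ²)` are finite. -/
instance finite_hom (F G : TSheaf) : Finite (Hom F G) := by
  choose A hA using fun l => F.exists_gens (chart l)
  have hfin : ∀ l, ∀ g : A l, Finite {z | ∃ f : Hom F G, f.app _ g.1 = z} :=
    fun l g => (TSheaf.finite_hom_app F G g.1).to_subtype
  let Φ : Hom F G → ∀ l, ∀ g : A l, {z | ∃ f : Hom F G, f.app _ g.1 = z} :=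
    fun f l g => ⟨f.app _ g.1, f, rfl⟩
  refine Finite.of_injective Φ fun f f' h => Hom.ext_of_chart fun l x => ?_
  by_cases hx : x = 0
  · rw [hx, f.map_zero, f'.map_zero]
  · obtain ⟨g, hg, s, rfl⟩ := hA l x hx
    have := congrArg Subtype.val (congrFun (congrFun h l) ⟨g, hg⟩)
    rw [f.map_act, f'.map_act]
    exact congrArg _ this

theorem finite_subobjects (X Y Z : TSheaf) : (subobjects X Y Z).Finite := by
  refine (Set.finite_range fun f : Hom Y Z => fun J => Set.range (f.app J)).subset ?_
  rintro N ⟨i, _, _, _, h, _⟩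
  exact ⟨i, funext h⟩

/- ## Finiteness of the sets of extensions -/

/-- `Y → Z → X` is an admissible short exact sequence. -/
structure IsExact {X Y Z : TSheaf} (i : Hom Y Z) (p : Hom Z X) : Prop where
  inj : i.Inj
  surj : p.Surj
  ker : ∀ {J} {z : Z.M J}, p.app J z = 0 → ∃ y, i.app J y = z
  comp : ∀ {J} (y : Y.M J), p.app J (i.app J y) = 0

theorem mem_subobjects {X Y Z : TSheaf} {N : ∀ J, Set (Z.M J)} :
    N ∈ subobjects X Y Z ↔ ∃ (i : Hom Y Z) (p : Hom Z X), IsExact i p ∧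
      ∀ J, Set.range (i.app J) = N J := by
  constructor
  · rintro ⟨i, p, hi, hp, h, h'⟩
    refine ⟨i, p, ⟨hi, hp, fun {J z} hz => ?_, fun {J} y => ?_⟩, h⟩
    · have : z ∈ N J := h' J ▸ hz
      rwa [← h J] at this
    · have : i.app J y ∈ N J := h J ▸ Set.mem_range_self y
      rwa [← h' J] at this
  · rintro ⟨i, p, he, h⟩
    refine ⟨i, p, he.inj, he.surj, h, fun J => ?_⟩
    rw [← h J]
    ext z
    exact ⟨fun hz => he.ker hz, by rintro ⟨y, rfl⟩; exact he.comp y⟩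

/-- The values `y = m z` in `Y`, where `z` is a lift of `x` to an extension of `X` by `Y`. -/
def extValues (X Y : TSheaf) {l : Fin 3} (x : X.M (chart l)) (m : S (chart l)) :
    Set (Y.M (chart l)) :=
  {y | ∃ (Z : TSheaf) (i : Hom Y Z) (p : Hom Z X), IsExact i p ∧
    ∃ z, p.app _ z = x ∧ i.app _ y = Z.act m z}

/-- The characters `s` with zero pairing at `i` are powers of the coordinate `j`. Once one such
power of `g`, times a unit of the ray, is divisible by `e`, so are all higher powers; this bounds
the exponent at `j`. -/
theorem finite_extValues_aux {Y : TSheaf} {i j l : Fin 3} (hil : i ≠ l) (hji : j ≠ i)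
    (hjl : j ≠ l) (g : Y.M (chart l)) (e : S (chart l)) :
    {s : S (chart l) | pairing s i = 0 ∧ (∀ y, Y.act s g ≠ Y.act e y) ∧
      ∃ u : S (chart l), -(u : ℤ × ℤ) ∈ S (ray i) ∧ ∃ y, Y.act u (Y.act s g) = Y.act e y}.Finite := by
  rcases Set.eq_empty_or_nonempty {s : S (chart l) | pairing s i = 0 ∧
      (∀ y, Y.act s g ≠ Y.act e y) ∧
      ∃ u : S (chart l), -(u : ℤ × ℤ) ∈ S (ray i) ∧ ∃ y, Y.act u (Y.act s g) = Y.act e y} with h | h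
  · rw [h]; exact Set.finite_empty
  obtain ⟨s₀, h0, -, u, hu, y₀, e₀⟩ := h
  refine (finite_chart_ge l (-(pairing u j + pairing s₀ j))).subset ?_
  rintro s ⟨h1, h2, -⟩
  have hlt : pairing s j < pairing u j + pairing s₀ j := by
    by_contra hlt
    have hd : (s : ℤ × ℤ) - (u + s₀) ∈ S (chart l) := by
      intro m hm
      have := TSheaf.unit_ray hil hu
      rw [pairing_sub, pairing_add, Pi.sub_apply, Pi.add_apply]
      rcases eq_of_three hil hji hjl m with rfl | rfl | rfl
      · omega
      · omega
      · exact absurd rfl (mem_chart.1 hm)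
    have hs : s = ⟨_, hd⟩ + (u + s₀) := Subtype.ext (by simp)
    refine h2 (Y.act ⟨_, hd⟩ y₀) ?_
    rw [Y.act_comm, ← e₀, ← Y.add_act, ← Y.add_act, add_assoc, ← hs]
  have := pairing_sum_three hil hji hjl s
  change _ ≤ pairing s l
  omega

/-- The critical case, in which the last factor `coordChar l i 1` of `m` carries the lift of `x`
into `Y`. A non-zero value is then not divisible by this coordinate, so only the exponent at the
third ray `j` remains to be bounded. -/
theorem finite_extValues_step (X Y : TSheaf) {i l : Fin 3} (hil : i ≠ l) (x : X.M (chart l))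
    (m m' : S (chart l)) (hm : m = coordChar l i 1 + m') (h : X.act m x = 0)
    (h' : X.act m' x ≠ 0) : (extValues X Y x m).Finite := by
  obtain ⟨j, hji, hjl⟩ := exists_third hil
  set e := coordChar l i 1 with he
  obtain ⟨A, hA⟩ := Y.exists_gens (chart l)
  obtain ⟨A', hA'⟩ := Y.exists_gens (chart j)
  -- The unit `T` must not depend on the extension. It is built from `X` alone: `x` agrees on the
  -- ray up to a unit with `x'` over `chart j`, `v` clears the denominators of `m`, and `w` kills
  -- the resulting multiple of `x'`. In any extension the same multiple of a lift of `x'` then lies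
  -- in `Y`.
  obtain ⟨T, hT, hTx⟩ : ∃ T : S (ray i), -(T : ℤ × ℤ) ∈ S (ray i) ∧
      ∀ (Z : TSheaf) (ι : Hom Y Z) (p : Hom Z X), IsExact ι p → ∀ z y, p.app _ z = x →
        ι.app _ y = Z.act m z → X.res (TSheaf.ray_le_chart hil) x ≠ 0 → ∃ y' : Y.M (chart j),
          Y.act T (Y.res (TSheaf.ray_le_chart hil) y) = Y.res (TSheaf.ray_le_chart hji.symm) y' := by
    by_cases hx : X.res (TSheaf.ray_le_chart hil) x = 0
    · exact ⟨0, by simp, fun _ _ _ _ _ _ _ _ h0 => absurd hx h0⟩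
    obtain ⟨T, hT, x', hx'⟩ := TSheaf.exists_other_chart (j := j) hil hji x
    obtain ⟨v, hv, hvm⟩ := exists_unit_add (TSheaf.ray_le_chart hji.symm)
      (S_anti (TSheaf.ray_le_chart hil) m.2)
    have e1 : faceIncl (TSheaf.ray_le_chart hji.symm) ⟨_, hvm⟩ =
      faceIncl (TSheaf.ray_le_chart hji.symm) v + faceIncl (TSheaf.ray_le_chart hil) m := rfl
    obtain ⟨w, hw, hw0⟩ := (TSheaf.res_eq_zero_iff (TSheaf.ray_le_chart hji.symm)
        (X.act ⟨_, hvm⟩ x')).1 (by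
      rw [X.res_act, ← hx', e1, X.add_act, X.act_comm _ T, ← X.res_act, h, X.res_zero,
        X.act_zero, X.act_zero])
    refine ⟨faceIncl (TSheaf.ray_le_chart hji.symm) w +
      (faceIncl (TSheaf.ray_le_chart hji.symm) v + T), ?_, fun Z ι p hex z y hz hy _ => ?_⟩
    · have := add_mem hw (add_mem hv hT)
      convert this using 1
      simp; abel
    obtain ⟨z', hz'⟩ := hex.surj _ x'
    have e2 : Z.act T (Z.res (TSheaf.ray_le_chart hil) z) =
        Z.res (TSheaf.ray_le_chart hji.symm) z' := by
      refine p.cancel ?_ ?_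
      · rw [p.map_act, p.map_res, p.map_res, hz, hz', hx']
      · rw [p.map_act, p.map_res, hz]
        exact TSheaf.act_unit_ne hT hx
    obtain ⟨y', hy'⟩ := hex.ker (z := Z.act (w + ⟨_, hvm⟩) z') (by
      rw [p.map_act, hz', X.add_act, hw0])
    refine ⟨y', hex.inj _ ?_⟩
    rw [ι.map_res, hy', ι.map_act, ι.map_res, hy, Z.res_act, Z.res_act, ← e2, ← Z.add_act,
      ← Z.add_act]
    congr 1
    exact Subtype.ext (by simp; abel)
  have key : ∀ g ∈ A, {s : S (chart l) | Y.act s g ≠ 0 ∧ Y.act s g ∈ extValues X Y x m}.Finite := by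
    intro g _
    refine ((finite_extValues_aux hil hji hjl g e).union (Set.Finite.biUnion A'.finite_toSet
      fun g' _ => TSheaf.finite_overlap hil hji hjl g g' T hT)).subset ?_
    rintro s ⟨hs0, Z, ι, p, hex, z, hz, hy⟩
    -- If the value were `e` times a section of `Y`, cancelling `e` would put the lift times `m'`
    -- into `Y`, against `h'`.
    have hnot : ∀ y, Y.act s g ≠ Y.act e y := by
      intro y' hy'
      rw [hm, Z.add_act, hy', ι.map_act] at hy
      have h0 : Z.act e (ι.app _ y') ≠ 0 := by
        rw [← ι.map_act, ← hy']
        exact hex.inj.app_ne hs0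
      have := TSheaf.act_cancel_of_ne hy h0
      refine h' ?_
      rw [← hz, ← p.map_act, ← this, hex.comp]
    have hsi : pairing s i = 0 := by
      by_contra hne
      have hd : (s : ℤ × ℤ) - e ∈ S (chart l) := by
        intro k hk
        have h1 := s.2 k hk
        have h2 := s.2 i (mem_chart.2 hil)
        rw [pairing_sub, Pi.sub_apply, he, pairing_coordChar, if_neg (mem_chart.1 hk).symm]
        split_ifs with hik
        · subst hik; push_cast; omega
        · omega
      refine hnot (Y.act ⟨_, hd⟩ g) ?_
      rw [← Y.add_act]
      congr 1
      exact Subtype.ext (by simp)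
    -- If the value or `x` vanishes on the ray `i`, a unit of the ray makes the value divisible by
    -- `e`, and `finite_extValues_aux` applies. Otherwise the value is compared with a section over
    -- `chart j`.
    by_cases hy0 : Y.res (TSheaf.ray_le_chart hil) (Y.act s g) = 0
    · obtain ⟨u, hu, hu0⟩ := (TSheaf.res_eq_zero_iff _ _).1 hy0
      exact Or.inl ⟨hsi, hnot, u, hu, 0, by rw [hu0, Y.act_zero]⟩
    by_cases hx : X.res (TSheaf.ray_le_chart hil) x = 0
    · obtain ⟨u, hu, hu0⟩ := (TSheaf.res_eq_zero_iff _ _).1 hx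
      obtain ⟨y', hy'⟩ := hex.ker (z := Z.act u z) (by rw [p.map_act, hz, hu0])
      refine Or.inl ⟨hsi, hnot, u, hu, Y.act m' y', hex.inj _ ?_⟩
      rw [ι.map_act, hy, Z.act_comm, ← hy', ι.map_act, ι.map_act, hm, Z.add_act]
    · obtain ⟨y', hy'⟩ := hTx Z ι p hex z _ hz hy hx
      have hne : y' ≠ 0 := by
        refine TSheaf.ne_of_res_ne (h := TSheaf.ray_le_chart hji.symm) ?_
        rw [← hy']
        exact TSheaf.act_unit_ne hT hy0
      obtain ⟨g', hg', s', hs'⟩ := hA' _ hne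
      exact Or.inr (Set.mem_biUnion hg' ⟨hy0, s', by rw [hy', hs']⟩)
  refine ((Set.Finite.biUnion A.finite_toSet fun g hg =>
    (key g hg).image fun s => Y.act s g).union (Set.finite_singleton 0)).subset ?_
  intro y hy
  by_cases hy0 : y = 0
  · exact Or.inr hy0
  · obtain ⟨g, hg, s, rfl⟩ := hA y hy0
    exact Or.inl (Set.mem_biUnion hg ⟨s, ⟨hy0, hy⟩, rfl⟩)

/-- Induction on the total degree of `m`: a coordinate dividing `m` is removed. If the shorter
character still kills `x`, the values are multiples of the values for it; otherwise
`finite_extValues_step` applies. The trivial character cannot occur, since `x` is non-zero. -/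
theorem finite_extValues (X Y : TSheaf) {l : Fin 3} (x : X.M (chart l)) (hx : x ≠ 0)
    (m : S (chart l)) (h : X.act m x = 0) : (extValues X Y x m).Finite := by
  induction hn : (-pairing m l).toNat using Nat.strong_induction_on generalizing m with
  | _ n ih =>
  obtain ⟨i, hil, hi⟩ : ∃ i, i ≠ l ∧ 0 < pairing m i := by
    by_contra hcon
    push Not at hcon
    have hz : ∀ i, i ≠ l → pairing (m : ℤ × ℤ) i = 0 := fun i hi =>
      le_antisymm (hcon i hi) (m.2 i (mem_chart.2 hi))
    obtain ⟨i, hil⟩ := exists_ne l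
    obtain ⟨j, hji, hjl⟩ := exists_third hil
    have hs := pairing_sum_three hil hji hjl m
    have h0 : pairing (m : ℤ × ℤ) = pairing 0 := by
      rw [pairing_zero]
      funext k
      have h1 := hz i hil
      have h2 := hz j hjl
      rcases eq_of_three hil hji hjl k with rfl | rfl | rfl
      · exact h1
      · exact h2
      · simp only [Pi.zero_apply]; omega
    have : m = 0 := Subtype.ext (pairing_injective h0)
    rw [this, X.zero_act] at h
    exact hx h
  have hd : (m : ℤ × ℤ) - coordChar l i 1 ∈ S (chart l) := by
    intro k hk
    have h1 := m.2 k hk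
    rw [pairing_sub, Pi.sub_apply, pairing_coordChar, if_neg (mem_chart.1 hk).symm]
    split_ifs with hik
    · subst hik; push_cast; omega
    · omega
  have hm : m = coordChar l i 1 + ⟨_, hd⟩ := Subtype.ext (by simp)
  by_cases h' : X.act ⟨_, hd⟩ x = 0
  · refine ((ih _ ?_ ⟨_, hd⟩ h' rfl).image (Y.act (coordChar l i 1))).subset ?_
    · have h1 := pairing_coordChar l i 1 l
      rw [if_neg hil, if_pos rfl] at h1
      obtain ⟨j, hji, hjl⟩ := exists_third hil
      have hs := pairing_sum_three hil hji hjl m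
      have := m.2 j (mem_chart.2 hjl)
      rw [pairing_sub, Pi.sub_apply, h1]
      push_cast
      omega
    · rintro y ⟨Z, ι, p, hex, z, hz, hy⟩
      obtain ⟨y', hy'⟩ := hex.ker (z := Z.act ⟨_, hd⟩ z) (by rw [p.map_act, hz, h'])
      refine ⟨y', ⟨Z, ι, p, hex, z, hz, hy'⟩, hex.inj _ ?_⟩
      rw [ι.map_act, hy', hy, ← Z.add_act, ← hm]
  · exact finite_extValues_step X Y hil x m _ hm h h'

/-- Two extensions of `X` by `Y` with the same values on generators are isomorphic. -/
theorem nonempty_iso_of_extValues {X Y Z Z' : TSheaf} {i : Hom Y Z} {p : Hom Z X}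
    (hex : IsExact i p) {i' : Hom Y Z'} {p' : Hom Z' X} (hex' : IsExact i' p')
    (G : ∀ l, Finset (X.M (chart l)))
    (hG : ∀ l, ∀ x : X.M (chart l), x ≠ 0 → ∃ g ∈ G l, ∃ s, x = X.act s g)
    (B : ∀ l, X.M (chart l) → Finset (S (chart l)))
    (hB₀ : ∀ l g, ∀ b ∈ B l g, X.act b g = 0)
    (hB : ∀ l g s, X.act s g = 0 → ∃ b ∈ B l g, ∃ r, s = r + b)
    (h : ∀ l, ∀ g ∈ G l, g ≠ 0 → ∀ b ∈ B l g, ∀ y, (∃ z, p.app _ z = g ∧ i.app _ y = Z.act b z) →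
      ∃ z, p'.app _ z = g ∧ i'.app _ y = Z'.act b z) : Nonempty (Z ≅ Z') := by
  -- The graph of the isomorphism: sections of `Y` correspond to themselves, and sections outside
  -- `Y` correspond when they have the same image in `X`.
  let R : ∀ J, Z.M J → Z'.M J → Prop := fun J z z' =>
    (∃ y, i.app J y = z ∧ i'.app J y = z') ∨ (p.app J z ≠ 0 ∧ p.app J z = p'.app J z')
  have act_chart : ∀ l (s : S (chart l)) z z', R _ z z' → R _ (Z.act s z) (Z'.act s z') := by
    rintro l s z z' (⟨y, rfl, rfl⟩ | ⟨h0, e⟩)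
    · exact Or.inl ⟨Y.act s y, i.map_act _ _, i'.map_act _ _⟩
    -- The only problem is a product that falls into `Y`. Then `z = t w` with `w` a lift of a
    -- generator `g`, and `s + t = r + b` with `b` in the basis of the annihilator of `g`, so the
    -- product is `r` times a prescribed value.
    by_cases hs : X.act s (p.app _ z) = 0
    · obtain ⟨g, hg, t, ht⟩ := hG l _ h0
      have hg0 : g ≠ 0 := TSheaf.ne_of_act_ne (ht ▸ h0)
      rw [ht, ← X.add_act] at hs
      obtain ⟨b, hb, r, hr⟩ := hB l g _ hs
      obtain ⟨w, hw⟩ := hex.surj _ g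
      have hz : z = Z.act t w := p.cancel (by rw [p.map_act, hw, ht]) h0
      obtain ⟨y, hy⟩ := hex.ker (z := Z.act (s + t) w) (by rw [p.map_act, hw, hs])
      have hbg := hB₀ l g b hb
      obtain ⟨yb, hyb⟩ := hex.ker (z := Z.act b w) (by rw [p.map_act, hw, hbg])
      obtain ⟨w', hw', hyb'⟩ := h l g hg hg0 b hb yb ⟨w, hw, hyb⟩
      have hz' : z' = Z'.act t w' := p'.cancel (by rw [p'.map_act, hw', ← e, ht]) (e ▸ h0)
      refine Or.inl ⟨Y.act r yb, ?_, ?_⟩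
      · rw [i.map_act, hyb, hz, ← Z.add_act, ← Z.add_act, hr]
      · rw [i'.map_act, hyb', hz', ← Z'.add_act, ← Z'.add_act, hr]
    · exact Or.inr ⟨by rwa [p.map_act], by rw [p.map_act, p'.map_act, e]⟩
  have cancel : ∀ J (t : S J), -(t : ℤ × ℤ) ∈ S J → ∀ z z', R _ (Z.act t z) (Z'.act t z') →
      R _ z z' := by
    rintro J t ht z z' (⟨y, h1, h2⟩ | ⟨h0, e⟩)
    · refine Or.inl ⟨Y.act ⟨_, ht⟩ y, ?_, ?_⟩
      · rw [i.map_act, h1, Z.act_neg_act]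
      · rw [i'.map_act, h2, Z'.act_neg_act]
    · rw [p.map_act] at h0 e
      rw [p'.map_act] at e
      exact Or.inr ⟨TSheaf.ne_of_act_ne h0, TSheaf.act_cancel ht e⟩
  have res_chart : ∀ l K (hK : K ≤ chart l) z z', R _ z z' → R _ (Z.res hK z) (Z'.res hK z') := by
    rintro l K hK z z' hR
    rcases hR with ⟨y, rfl, rfl⟩ | ⟨h0, e⟩
    · exact Or.inl ⟨Y.res hK y, i.map_res _ _, i'.map_res _ _⟩
    by_cases hs : X.res hK (p.app _ z) = 0
    · obtain ⟨u, hu, hu0⟩ := (TSheaf.res_eq_zero_iff _ _).1 hs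
      refine cancel K (faceIncl hK u) hu _ _ ?_
      rw [← Z.res_act, ← Z'.res_act]
      rcases act_chart l u z z' (Or.inr ⟨h0, e⟩) with ⟨y, h1, h2⟩ | ⟨h1, -⟩
      · exact Or.inl ⟨Y.res hK y, by rw [i.map_res, h1], by rw [i'.map_res, h2]⟩
      · exact absurd (by rw [p.map_act, hu0]) h1
    · exact Or.inr ⟨by rwa [p.map_res], by rw [p.map_res, p'.map_res, e]⟩
  -- Up to a unit, a related pair over a face comes from a related pair over a chart. This carries
  -- compatibility with action and restriction from the charts to all stalks.
  have lift : ∀ l K (hK : K ≤ chart l) z z', R _ z z' → ∃ u : S (chart l),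
      -(u : ℤ × ℤ) ∈ S K ∧ ∃ w w', R _ w w' ∧ Z.act (faceIncl hK u) z = Z.res hK w ∧
        Z'.act (faceIncl hK u) z' = Z'.res hK w' := by
    rintro l K hK z z' (⟨y, rfl, rfl⟩ | ⟨h0, e⟩)
    · obtain ⟨u, hu, w, hw⟩ := Y.res_surj hK y
      exact ⟨u, hu, _, _, Or.inl ⟨w, rfl, rfl⟩, by rw [← i.map_act, ← i.map_res, hw],
        by rw [← i'.map_act, ← i'.map_res, hw]⟩
    · obtain ⟨u, hu, w, hw⟩ := Z.res_surj hK z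
      obtain ⟨w', hw'⟩ := hex'.surj _ (p.app _ w)
      have e1 : X.act (faceIncl hK u) (p.app K z) = X.res hK (p.app _ w) := by
        rw [← p.map_act, hw, p.map_res]
      have hne : X.res hK (p.app _ w) ≠ 0 := by
        rw [← e1]; exact TSheaf.act_unit_ne hu h0
      refine ⟨u, hu, w, w', Or.inr ⟨TSheaf.ne_of_res_ne hne, hw'.symm⟩, hw, p'.cancel ?_ ?_⟩
      · rw [p'.map_act, p'.map_res, hw', ← e, e1]
      · rwa [p'.map_act, ← e, e1]
  have act : ∀ K (s : S K) z z', R _ z z' → R _ (Z.act s z) (Z'.act s z') := by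
    intro K s z z' hR
    obtain ⟨l, hl⟩ := exists_le_chart K
    obtain ⟨u, hu, w, w', hw, e, e'⟩ := lift l K hl z z' hR
    obtain ⟨v, hv, hvs⟩ := exists_unit_add hl s.2
    refine cancel K (faceIncl hl (v + u)) ?_ _ _ ?_
    · have := add_mem hv hu
      convert this using 1
      simp; abel
    have e1 : faceIncl hl (v + u) + s = faceIncl hl ⟨_, hvs⟩ + faceIncl hl u :=
      Subtype.ext (by simp; abel)
    rw [← Z.add_act, ← Z'.add_act, e1, Z.add_act, Z'.add_act, e, e', ← Z.res_act, ← Z'.res_act]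
    exact res_chart l K hl _ _ (act_chart l _ _ _ hw)
  have res : ∀ K L (hL : L ≤ K) z z', R _ z z' → R _ (Z.res hL z) (Z'.res hL z') := by
    intro K L hL z z' hR
    obtain ⟨l, hl⟩ := exists_le_chart K
    obtain ⟨u, hu, w, w', hw, e, e'⟩ := lift l K hl z z' hR
    refine cancel L (faceIncl hL (faceIncl hl u)) (S_anti hL hu) _ _ ?_
    rw [← Z.res_act, ← Z'.res_act, e, e', Z.res_res, Z'.res_res]
    exact res_chart l L _ _ _ hw
  obtain ⟨f, hf⟩ := Hom.exists_of_rel (F := Z) (G := Z') R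
    (fun J z => by
      by_cases hz : p.app J z = 0
      · obtain ⟨y, rfl⟩ := hex.ker hz
        exact ⟨_, Or.inl ⟨y, rfl, rfl⟩⟩
      · obtain ⟨z', hz'⟩ := hex'.surj J (p.app J z)
        exact ⟨z', Or.inr ⟨hz, hz'.symm⟩⟩)
    (by
      rintro J z z₁ z₂ (⟨y, rfl, rfl⟩ | ⟨h0, e⟩) (⟨y', h1, rfl⟩ | ⟨h0', e'⟩)
      · rw [hex.inj J h1]
      · exact absurd (hex.comp y) h0'
      · rw [← h1] at h0; exact absurd (hex.comp y') h0
      · exact p'.cancel (e.symm.trans e') (e ▸ h0))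
    (fun J => Or.inl ⟨0, i.map_zero J, i'.map_zero J⟩) act (fun J K h z z' => res J K h z z')
    (by
      rintro J z z₁ z₂ (⟨y, rfl, rfl⟩ | ⟨h0, e⟩) (⟨y', rfl, h1⟩ | ⟨h0', e'⟩)
      · exact Or.inl (by rw [hex'.inj J h1])
      · rw [hex'.comp] at e'; exact absurd e' h0'
      · rw [← h1, hex'.comp] at e; exact absurd e h0
      · exact Or.inl (p.cancel (e.trans e'.symm) h0))
  refine Hom.nonempty_iso_of_bijective f (fun J z w hzw => ?_) fun J z' => ?_
  · have h1 := (hf J z _).2 rfl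
    have h2 := (hf J w _).2 hzw.symm
    rcases h1 with ⟨y, rfl, h1⟩ | ⟨h0, e⟩ <;> rcases h2 with ⟨y', rfl, h2⟩ | ⟨h0', e'⟩
    · rw [hex'.inj J (h1.trans h2.symm)]
    · rw [← h1, hex'.comp] at e'; exact absurd e' h0'
    · rw [← h2, hex'.comp] at e; exact absurd e h0
    · exact p.cancel (e.trans e'.symm) h0
  · by_cases hz : p'.app J z' = 0
    · obtain ⟨y, rfl⟩ := hex'.ker hz
      exact ⟨_, (hf J _ _).1 (Or.inl ⟨y, rfl, rfl⟩)⟩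
    · obtain ⟨z, hz'⟩ := hex.surj J (p'.app J z')
      exact ⟨z, (hf J _ _).1 (Or.inr ⟨by rwa [hz'], hz'⟩)⟩

theorem hallNumber_ne_zero {a b c : IsoClass} (h : hallNumber a b c ≠ 0) :
    ∃ (i : Hom b.out c.out) (p : Hom c.out a.out), IsExact i p := by
  obtain ⟨N, hN⟩ := Set.nonempty_of_ncard_ne_zero h
  obtain ⟨i, p, he, -⟩ := mem_subobjects.1 hN
  exact ⟨i, p, he⟩

/-- For each generator of the quotient and each basis element of its annihilator, an extension is
assigned the set of its values. These sets are subsets of finite sets, and together they determine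
the extension. -/
theorem finite_support_hallNumber (a b : IsoClass) : {c | hallNumber a b c ≠ 0}.Finite := by
  choose G hG using fun l => a.out.exists_gens (chart l)
  choose B hB₀ hB using fun l (x : a.out.M (chart l)) =>
    exists_finite_basis {s : S (chart l) | a.out.act s x = 0}
  have hfin : ∀ l, ∀ g : G l, ∀ m : B l g.1,
      Finite {A | A ⊆ {y | g.1 ≠ 0 ∧ y ∈ extValues a.out b.out g.1 m.1}} := by
    intro l g m
    refine (Set.Finite.finite_subsets ?_).to_subtype
    by_cases hg : g.1 = 0
    · refine Set.finite_empty.subset fun y hy => hy.1 hg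
    · exact (finite_extValues _ _ g.1 hg m.1 (hB₀ l g.1 m.1 m.2)).subset fun y hy => hy.2
  choose i p hex using fun c : {c | hallNumber a b c ≠ 0} => hallNumber_ne_zero c.2
  let Φ : {c | hallNumber a b c ≠ 0} → ∀ l, ∀ g : G l, ∀ m : B l g.1,
      {A | A ⊆ {y | g.1 ≠ 0 ∧ y ∈ extValues a.out b.out g.1 m.1}} := fun c l g m =>
    ⟨{y | g.1 ≠ 0 ∧ ∃ z, (p c).app _ z = g ∧ (i c).app _ y = c.1.out.act m z},
      fun y ⟨hg, z, hz, hy⟩ => ⟨hg, c.1.out, i c, p c, hex c, z, hz, hy⟩⟩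
  have hinj : Function.Injective Φ := by
    intro c d hcd
    have e := nonempty_iso_of_extValues (hex c) (hex d) G hG B hB₀ hB
      fun l g hg hg0 m hm y ⟨z, hz, hy⟩ => by
        have h1 := congrArg Subtype.val (congrFun (congrFun (congrFun hcd l) ⟨g, hg⟩) ⟨m, hm⟩)
        have h2 : y ∈ (Φ c l ⟨g, hg⟩ ⟨m, hm⟩).1 := ⟨hg0, z, hz, hy⟩
        rw [h1] at h2
        exact h2.2
    refine Subtype.ext ?_
    rw [← Quotient.out_eq c.1, ← Quotient.out_eq d.1]
    exact Quotient.sound e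
  exact Set.finite_coe_iff.1 (Finite.of_injective Φ hinj)

/- ## Subsheaves and quotients -/

/-- A quasicoherent subsheaf, recorded by its underlying subsets of the stalks. -/
structure IsSub (F : TSheaf) (N : ∀ J, Set (F.M J)) : Prop where
  zero : ∀ J, 0 ∈ N J
  act : ∀ {J} (s : S J) {x}, x ∈ N J → F.act s x ∈ N J
  res : ∀ {J K} (h : K ≤ J) {x}, x ∈ N J → F.res h x ∈ N K
  coh : ∀ {J K} (h : K ≤ J) {y}, y ∈ N K → ∃ s : S J, -(s : ℤ × ℤ) ∈ S K ∧ ∃ x ∈ N J,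
    F.act (faceIncl h s) y = F.res h x

namespace IsSub

variable {F : TSheaf} {N : ∀ J, Set (F.M J)}

/-- A subsheaf as a `T`-sheaf. -/
def sub (h : IsSub F N) : TSheaf where
  M J := N J
  pointed J := ⟨⟨0, h.zero J⟩⟩
  act s x := ⟨F.act s x.1, h.act s x.2⟩
  zero_act x := Subtype.ext (F.zero_act _)
  add_act s t x := Subtype.ext (F.add_act s t _)
  act_zero s := Subtype.ext (F.act_zero s)
  res hJ x := ⟨F.res hJ x.1, h.res hJ x.2⟩
  res_self x := Subtype.ext (F.res_self _)
  res_res hK hL x := Subtype.ext (F.res_res hK hL _)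
  res_zero hK := Subtype.ext (F.res_zero hK)
  res_act hK s x := Subtype.ext (F.res_act hK s _)
  res_surj hK y := by
    obtain ⟨s, hs, x, hx, e⟩ := h.coh hK y.2
    exact ⟨s, hs, ⟨x, hx⟩, Subtype.ext e⟩
  res_inj hK x x' e := by
    obtain ⟨s, hs, e⟩ := F.res_inj hK x.1 x'.1 (congrArg Subtype.val e)
    exact ⟨s, hs, Subtype.ext e⟩
  fg l := by
    classical
    obtain ⟨G, hG⟩ := F.fg l
    -- The multiples of a generator that lie in `N` are generated by finitely many of them, by
    -- Dickson's lemma.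
    choose B hB hB' using fun g : F.M (chart l) =>
      exists_finite_basis {s : S (chart l) | F.act s g ∈ N (chart l)}
    let A : Finset (F.M (chart l)) := G.biUnion fun g => (B g).image fun b => F.act b g
    refine ⟨A.subtype _, fun x hx => ?_⟩
    obtain ⟨g, hg, s, hs⟩ := hG x.1 fun h0 => hx (Subtype.ext h0)
    have hmem : F.act s g ∈ N (chart l) := hs ▸ x.2
    obtain ⟨b, hb, r, rfl⟩ := hB' g s hmem
    refine ⟨⟨F.act b g, hB g b hb⟩, ?_, r, Subtype.ext ?_⟩
    · rw [Finset.mem_subtype, Finset.mem_biUnion]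
      exact ⟨g, hg, Finset.mem_image_of_mem _ hb⟩
    · rw [hs, F.add_act]
  alpha s x y e := (F.alpha s x.1 y.1 (congrArg Subtype.val e)).imp Subtype.ext Subtype.ext
  graded l := by
    obtain ⟨deg, hdeg⟩ := F.graded l
    exact ⟨fun x => deg x.1, fun s x hx => hdeg s x.1 fun h0 => hx (Subtype.ext h0)⟩

/-- The inclusion of a subsheaf. -/
def incl (h : IsSub F N) : Hom h.sub F where
  app _ x := x.1
  map_zero _ := rfl
  map_act _ _ := rfl
  map_res _ _ := rfl
  alpha _ _ e := Or.inl (Subtype.ext e)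

/-- The relation collapsing a subset to a point. -/
def collapse (N : ∀ J, Set (F.M J)) (J : Cone) : Setoid (F.M J) where
  r x y := x = y ∨ (x ∈ N J ∧ y ∈ N J)
  iseqv :=
    { refl := fun _ => Or.inl rfl
      symm := fun h => h.imp Eq.symm And.symm
      trans := by
        rintro x y z (rfl | ⟨h1, h2⟩) (rfl | ⟨h3, h4⟩)
        · exact Or.inl rfl
        · exact Or.inr ⟨h3, h4⟩
        · exact Or.inr ⟨h1, h2⟩
        · exact Or.inr ⟨h1, h4⟩ }

theorem mk_eq_zero_iff (h : IsSub F N) {J : Cone} {x : F.M J} :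
    Quotient.mk (collapse N J) x = Quotient.mk (collapse N J) 0 ↔ x ∈ N J := by
  refine ⟨fun e => ?_, fun e => Quotient.sound (Or.inr ⟨e, h.zero J⟩)⟩
  rcases Quotient.exact e with e | e
  · exact e ▸ h.zero J
  · exact e.1

/-- The quotient by a subsheaf. -/
def quo (h : IsSub F N) : TSheaf where
  M J := Quotient (collapse N J)
  pointed J := ⟨Quotient.mk (collapse N J) 0⟩
  act s := Quotient.map (F.act s) (by
    rintro _ _ (rfl | ⟨h1, h2⟩)
    · exact Or.inl rfl
    · exact Or.inr ⟨h.act s h1, h.act s h2⟩)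
  zero_act := by rintro J ⟨x⟩; exact congrArg (Quotient.mk _) (F.zero_act x)
  add_act := by rintro J s t ⟨x⟩; exact congrArg (Quotient.mk _) (F.add_act s t x)
  act_zero s := congrArg (Quotient.mk _) (F.act_zero s)
  res hK := Quotient.map (F.res hK) (by
    rintro _ _ (rfl | ⟨h1, h2⟩)
    · exact Or.inl rfl
    · exact Or.inr ⟨h.res hK h1, h.res hK h2⟩)
  res_self := by rintro J ⟨x⟩; exact congrArg (Quotient.mk _) (F.res_self x)
  res_res := by rintro J K L hK hL ⟨x⟩; exact congrArg (Quotient.mk _) (F.res_res hK hL x)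
  res_zero hK := congrArg (Quotient.mk _) (F.res_zero hK)
  res_act := by rintro J K hK s ⟨x⟩; exact congrArg (Quotient.mk _) (F.res_act hK s x)
  res_surj := by
    rintro J K hK ⟨y⟩
    obtain ⟨s, hs, x, e⟩ := F.res_surj hK y
    exact ⟨s, hs, Quotient.mk _ x, congrArg (Quotient.mk _) e⟩
  res_inj := by
    rintro J K hK ⟨x⟩ ⟨x'⟩ e
    rcases Quotient.exact e with e | ⟨h1, h2⟩
    · obtain ⟨s, hs, e⟩ := F.res_inj hK x x' e
      exact ⟨s, hs, congrArg (Quotient.mk _) e⟩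
    · have key : ∀ x : F.M J, F.res hK x ∈ N K → ∃ s : S J, -(s : ℤ × ℤ) ∈ S K ∧
          F.act s x ∈ N J := by
        intro x hx
        obtain ⟨s, hs, n, hn, e⟩ := h.coh hK hx
        have e' : F.res hK (F.act s x) = F.res hK n := by rw [F.res_act, ← e]
        obtain ⟨t, ht, e''⟩ := F.res_inj hK _ _ e'
        refine ⟨t + s, ?_, ?_⟩
        · have := add_mem ht hs
          convert this using 1
          simp; abel
        · rw [F.add_act, e'']
          exact h.act t hn
      obtain ⟨s, hs, hsx⟩ := key x h1
      obtain ⟨t, ht, htx⟩ := key x' h2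
      refine ⟨t + s, ?_, Quotient.sound (Or.inr ⟨?_, ?_⟩)⟩
      · have := add_mem ht hs
        convert this using 1
        simp; abel
      · rw [F.add_act]; exact h.act t hsx
      · rw [add_comm, F.add_act]; exact h.act s htx
  fg l := by
    classical
    obtain ⟨G, hG⟩ := F.fg l
    refine ⟨G.image (Quotient.mk _), ?_⟩
    rintro ⟨x⟩ hx
    obtain ⟨g, hg, s, hs⟩ := hG x fun h0 => hx (congrArg (Quotient.mk _) h0)
    exact ⟨_, Finset.mem_image_of_mem _ hg, s, congrArg (Quotient.mk _) hs⟩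
  alpha := by
    rintro J s ⟨x⟩ ⟨y⟩ e
    rcases Quotient.exact e with e | ⟨h1, -⟩
    · exact (F.alpha s x y e).imp (congrArg (Quotient.mk _)) (congrArg (Quotient.mk _))
    · exact Or.inr (h.mk_eq_zero_iff.2 h1)
  graded l := by
    obtain ⟨deg, hdeg⟩ := F.graded l
    refine ⟨fun x => deg x.out, ?_⟩
    rintro s ⟨x⟩ hx
    have hx' : F.act s x ∉ N (chart l) := fun h' => hx (h.mk_eq_zero_iff.2 h')
    have hx'' : x ∉ N (chart l) := fun h' => hx' (h.act s h')
    -- Outside `N` the classes are singletons, so the chosen representative is the section itself.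
    have out_eq : ∀ y, y ∉ N (chart l) →
        (Quotient.mk (collapse N (chart l)) y).out = y := fun y hy =>
      (Quotient.exact (Quotient.out_eq (Quotient.mk (collapse N (chart l)) y))).resolve_right
        fun h' => hy h'.2
    change deg (Quotient.mk (collapse N (chart l)) (F.act s x)).out =
      s + deg (Quotient.mk (collapse N (chart l)) x).out
    rw [out_eq _ hx', out_eq _ hx'']
    exact hdeg s x fun h0 => hx' (h0 ▸ h.zero _)

/-- The projection to the quotient. -/
def proj (h : IsSub F N) : Hom F h.quo where
  app _ x := Quotient.mk _ x
  map_zero _ := rfl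
  map_act _ _ := rfl
  map_res _ _ := rfl
  alpha _ _ e := (Quotient.exact e).imp id fun h' => h.mk_eq_zero_iff.2 h'.1

theorem isExact (h : IsSub F N) : IsExact h.incl h.proj where
  inj _ _ _ e := Subtype.ext e
  surj _ x := Quotient.exists_rep x
  ker hz := ⟨⟨_, h.mk_eq_zero_iff.1 hz⟩, rfl⟩
  comp y := h.mk_eq_zero_iff.2 y.2

end IsSub

theorem Hom.Inj.isSub_range {F G : TSheaf} {f : Hom F G} (_ : f.Inj) :
    IsSub G fun J => Set.range (f.app J) where
  zero J := ⟨0, f.map_zero J⟩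
  act s := by rintro _ ⟨y, rfl⟩; exact ⟨_, f.map_act _ _⟩
  res h := by rintro _ ⟨y, rfl⟩; exact ⟨_, f.map_res _ _⟩
  coh h := by
    rintro _ ⟨y, rfl⟩
    obtain ⟨s, hs, x, e⟩ := F.res_surj h y
    exact ⟨s, hs, _, ⟨x, rfl⟩, by rw [← f.map_act, e, f.map_res]⟩

/-- For coherence, a section of the kernel over `K` comes, up to a unit, from a section `x` over `J`
whose image dies on `K`; a further unit moves `x` into the kernel. -/
theorem Hom.isSub_ker {F G : TSheaf} (f : Hom F G) : IsSub F fun J => {x | f.app J x = 0} := by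
  refine ⟨f.map_zero, fun {J} s x hx => ?_, fun {J K} h x hx => ?_, fun {J K} h y hy => ?_⟩ <;>
    simp only [Set.mem_ofPred_eq] at *
  · rw [f.map_act, hx, G.act_zero]
  · rw [f.map_res, hx, G.res_zero]
  · obtain ⟨s, hs, x, e⟩ := F.res_surj h y
    have : G.res h (f.app _ x) = 0 := by rw [← f.map_res, ← e, f.map_act, hy, G.act_zero]
    obtain ⟨u, hu, hu0⟩ := (TSheaf.res_eq_zero_iff _ _).1 this
    refine ⟨u + s, ?_, F.act u x, by rw [f.map_act, hu0], ?_⟩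
    · have := add_mem hu hs
      convert this using 1
      simp; abel
    · rw [F.res_act, ← e, ← F.add_act]
      rfl

theorem Hom.Inj.exists_coker {F G : TSheaf} {f : Hom F G} (hf : f.Inj) :
    ∃ (E : TSheaf) (p : Hom G E), IsExact f p := by
  have h := hf.isSub_range.isExact
  exact ⟨_, hf.isSub_range.proj, hf, h.surj, fun hz => by
    obtain ⟨⟨_, y, rfl⟩, e⟩ := h.ker hz
    exact ⟨y, e⟩, fun y => h.comp ⟨_, y, rfl⟩⟩

theorem Hom.Surj.exists_ker {F G : TSheaf} {f : Hom F G} (hf : f.Surj) :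
    ∃ (E : TSheaf) (i : Hom E F), IsExact i f :=
  ⟨_, f.isSub_ker.incl, f.isSub_ker.isExact.inj, hf, fun hz => ⟨⟨_, hz⟩, rfl⟩, fun y => y.2⟩

/- ## Structure constants -/

theorem cls_eq_iff {F G : TSheaf} : cls F = cls G ↔ Nonempty (F ≅ G) := Quotient.eq

theorem cls_out (c : IsoClass) : cls c.out = c := Quotient.out_eq c

theorem nonempty_iso_out (F : TSheaf) : Nonempty ((cls F).out ≅ F) := cls_eq_iff.1 (cls_out _)

theorem IsExact.congr_left {X Y Y' Z : TSheaf} {i : Hom Y Z} {p : Hom Z X} (h : IsExact i p)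
    (e : Y' ≅ Y) : IsExact (i.comp (e.hom : Hom Y' Y)) p where
  inj := h.inj.comp (Hom.inj_iso e)
  surj := h.surj
  ker hz := by
    obtain ⟨y, rfl⟩ := h.ker hz
    exact ⟨Hom.app e.inv _ y, by rw [Hom.comp_app, Hom.iso_inv_hom]⟩
  comp y := h.comp _

theorem IsExact.congr_right {X X' Y Z : TSheaf} {i : Hom Y Z} {p : Hom Z X} (h : IsExact i p)
    (e : X ≅ X') : IsExact i ((e.hom : Hom X X').comp p) where
  inj := h.inj
  surj := (Hom.surj_iso e).comp h.surj
  ker {J z} hz := h.ker (by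
    by_contra h0
    exact (Hom.inj_iso e).app_ne h0 hz)
  comp y := by rw [Hom.comp_app, h.comp, Hom.map_zero]

theorem IsExact.congr_mid {X Y Z Z' : TSheaf} {i : Hom Y Z} {p : Hom Z X} (h : IsExact i p)
    (e : Z ≅ Z') : IsExact ((e.hom : Hom Z Z').comp i) (p.comp (e.inv : Hom Z' Z)) where
  inj := (Hom.inj_iso e).comp h.inj
  surj := h.surj.comp (Hom.surj_iso e.symm)
  ker {J z} hz := by
    obtain ⟨y, hy⟩ := h.ker hz
    exact ⟨y, by rw [Hom.comp_app, hy, Hom.iso_inv_hom]⟩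
  comp y := by rw [Hom.comp_app, Hom.comp_app, Hom.iso_hom_inv, h.comp]

theorem subobjects_subset {X X' Y Y' Z : TSheaf} (e : X ≅ X') (e' : Y ≅ Y') :
    subobjects X Y Z ⊆ subobjects X' Y' Z := by
  intro N hN
  obtain ⟨i, p, h, hr⟩ := mem_subobjects.1 hN
  refine mem_subobjects.2 ⟨_, _, (h.congr_left e'.symm).congr_right e, fun J => ?_⟩
  rw [← hr J]
  ext z
  constructor
  · rintro ⟨y, rfl⟩; exact ⟨_, rfl⟩
  · rintro ⟨y, rfl⟩; exact ⟨Hom.app e'.hom J y, by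
      rw [Hom.comp_app]; exact congrArg _ (Hom.iso_hom_inv e' J y)⟩

theorem ncard_subobjects_le {X Y Z Z' : TSheaf} (e : Z ≅ Z') :
    (subobjects X Y Z).ncard ≤ (subobjects X Y Z').ncard := by
  refine Set.ncard_le_ncard_of_injOn (fun N J => Hom.app e.hom J '' N J) ?_ ?_
    (finite_subobjects _ _ _)
  · intro N hN
    obtain ⟨i, p, h, hr⟩ := mem_subobjects.1 hN
    refine mem_subobjects.2 ⟨_, _, h.congr_mid e, fun J => ?_⟩
    rw [← hr J, ← Set.range_comp]
    rfl
  · intro N _ N' _ h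
    funext J
    exact Set.image_injective.2 (Hom.inj_iso e J) (congrFun h J)

/-- Frees the structure constants from the chosen representatives in their definition. -/
theorem hallNumber_cls (X Y Z : TSheaf) :
    hallNumber (cls X) (cls Y) (cls Z) = (subobjects X Y Z).ncard := by
  obtain ⟨e⟩ := nonempty_iso_out X
  obtain ⟨e'⟩ := nonempty_iso_out Y
  obtain ⟨e''⟩ := nonempty_iso_out Z
  rw [hallNumber, (subobjects_subset e e').antisymm (subobjects_subset e.symm e'.symm)]
  exact (ncard_subobjects_le e'').antisymm (ncard_subobjects_le e''.symm)

/-- Counting a set fibred over a disjoint family of finite sets. -/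
theorem ncard_fibration {α β γ : Type*} {A : Set (α × β)} (hA : A.Finite) (T : γ → Set α)
    (hT : ∀ e, (T e).Finite) (disj : ∀ e e' x, x ∈ T e → x ∈ T e' → e = e') (n : γ → ℕ)
    (h1 : ∀ x ∈ A, ∃ e, x.1 ∈ T e) (h2 : ∀ e, ∀ x ∈ T e, {y | (x, y) ∈ A}.ncard = n e) :
    A.ncard = ∑ᶠ e, n e * (T e).ncard := by
  classical
  -- By disjointness at most one index has `x` in its set; `κ x` records it.
  have hκ : ∀ x : α, ∃ e : Option γ, ∀ e', x ∈ T e' ↔ e = some e' := fun x => by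
    by_cases h : ∃ e, x ∈ T e
    · obtain ⟨e, he⟩ := h
      exact ⟨some e, fun e' => ⟨fun h' => congrArg some (disj _ _ _ he h'), fun h' => by
        rwa [← Option.some.inj h']⟩⟩
    · exact ⟨none, fun e' => ⟨fun h' => absurd ⟨e', h'⟩ h, fun h' => by simp at h'⟩⟩
  choose κ hκ using hκ
  have fib : ∀ e, (hA.toFinset.filter fun x => κ x.1 = some e).card = n e * (T e).ncard := by
    intro e
    rw [Set.ncard_eq_toFinset_card _ (hT e), mul_comm, ← smul_eq_mul]
    rw [Finset.card_eq_sum_card_fiberwise (f := Prod.fst) (t := (hT e).toFinset)]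
    · rw [← Finset.sum_const]
      refine Finset.sum_congr rfl fun x hx => ?_
      rw [Set.Finite.mem_toFinset] at hx
      rw [← h2 e x hx, ← Set.ncard_coe_finset]
      refine Set.ncard_congr (fun y _ => y.2) ?_ ?_ ?_
      · rintro ⟨a, b⟩ h
        simp only [Finset.coe_filter, Finset.mem_filter, Set.Finite.mem_toFinset,
          Set.mem_ofPred_eq] at h
        obtain ⟨⟨h3, -⟩, rfl⟩ := h
        exact h3
      · rintro ⟨a, b⟩ ⟨a', b'⟩ h h' (rfl : b = b')
        simp only [Finset.coe_filter, Finset.mem_filter, Set.Finite.mem_toFinset,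
          Set.mem_ofPred_eq] at h h'
        rw [h.2, h'.2]
      · intro b hb
        refine ⟨(x, b), ?_, rfl⟩
        simp only [Finset.coe_filter, Finset.mem_filter, Set.Finite.mem_toFinset,
          Set.mem_ofPred_eq]
        exact ⟨⟨hb, (hκ x e).1 hx⟩, trivial⟩
    · intro x hx
      have := (Finset.mem_filter.1 hx).2
      exact (Set.Finite.mem_toFinset _).2 ((hκ _ _).2 this)
  let E : Finset γ := (hA.toFinset.image fun x => κ x.1).eraseNone
  have hs : (Function.support fun e => n e * (T e).ncard) ⊆ E := by
    intro e he
    change n e * (T e).ncard ≠ 0 at he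
    rw [← fib e] at he
    obtain ⟨x, hx⟩ := Finset.card_ne_zero.1 he
    rw [Finset.mem_filter] at hx
    exact Finset.mem_coe.2 (Finset.mem_eraseNone.2
      (Finset.mem_image.2 ⟨x, hx.1, hx.2⟩))
  rw [finsum_eq_sum_of_support_subset _ hs, Set.ncard_eq_toFinset_card _ hA,
    Finset.card_eq_sum_card_fiberwise (f := fun x => κ x.1) (t := E.map Function.Embedding.some)]
  · rw [Finset.sum_map]
    exact Finset.sum_congr rfl fun e _ => fib e
  · intro x hx
    obtain ⟨e, he⟩ := h1 x ((Set.Finite.mem_toFinset _).1 hx)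
    have h3 := (hκ _ _).1 he
    refine Finset.mem_coe.2 (Finset.mem_map.2 ⟨e, Finset.mem_eraseNone.2
      (Finset.mem_image.2 ⟨x, hx, h3⟩), h3.symm⟩)

theorem IsExact.ker_eq {X Y Z : TSheaf} {i : Hom Y Z} {p : Hom Z X} (h : IsExact i p) (J : Cone) :
    {z | p.app J z = 0} = Set.range (i.app J) := by
  ext z
  exact ⟨fun hz => h.ker hz, by rintro ⟨y, rfl⟩; exact h.comp y⟩

/-- Two quotients with the same kernel are isomorphic. -/
theorem Hom.Surj.iso_of_ker {Z X X' : TSheaf} {p : Hom Z X} {p' : Hom Z X'} (hp : p.Surj)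
    (hp' : p'.Surj) (hk : ∀ J x, p.app J x = 0 ↔ p'.app J x = 0) :
    ∃ e : X ≅ X', ∀ J x, Hom.app e.hom J (p.app J x) = p'.app J x := by
  obtain ⟨f, hf⟩ := hp.desc p' fun J x => (hk J x).1
  obtain ⟨g, hg⟩ := hp'.desc p fun J x => (hk J x).2
  refine ⟨⟨f, g, ?_, ?_⟩, hf⟩
  · refine Hom.ext (funext fun J => funext fun x => ?_)
    obtain ⟨z, rfl⟩ := hp J x
    exact (congrArg _ (hf J z)).trans (hg J z)
  · refine Hom.ext (funext fun J => funext fun x => ?_)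
    obtain ⟨z, rfl⟩ := hp' J x
    exact (congrArg _ (hg J z)).trans (hf J z)

/-- Two subsheaves with the same image are isomorphic. -/
theorem Hom.Inj.iso_of_range {Z Y Y' : TSheaf} {i : Hom Y Z} {i' : Hom Y' Z} (hi : i.Inj)
    (hi' : i'.Inj) (hr : ∀ J, Set.range (i.app J) = Set.range (i'.app J)) :
    ∃ e : Y ≅ Y', ∀ J x, i'.app J (Hom.app e.hom J x) = i.app J x := by
  obtain ⟨f, hf⟩ := hi'.lift i fun J x => hr J ▸ ⟨x, rfl⟩
  obtain ⟨g, hg⟩ := hi.lift i' fun J x => hr J ▸ ⟨x, rfl⟩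
  refine ⟨⟨f, g, ?_, ?_⟩, hf⟩
  · exact Hom.ext (funext fun J => funext fun x => hi J ((hg J _).trans (hf J x)))
  · exact Hom.ext (funext fun J => funext fun x => hi' J ((hf J _).trans (hg J x)))

/-- The flags `N ⊆ L ⊆ Z` with `N ≃ W`, `L/N ≃ Y` and `Z/L ≃ X`. -/
def flags (X Y W Z : TSheaf) : Set ((∀ J, Set (Z.M J)) × (∀ J, Set (Z.M J))) :=
  {P | ∃ (E : TSheaf) (i : Hom E Z) (r : Hom Z X), IsExact i r ∧ (∀ J, Set.range (i.app J) = P.1 J) ∧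
    ∃ (j : Hom W E) (q : Hom E Y), IsExact j q ∧ ∀ J, Set.range ((i.comp j).app J) = P.2 J}

/-- The flags, described by subobjects of the quotient `Z/N`. -/
def flags' (X Y W Z : TSheaf) : Set ((∀ J, Set (Z.M J)) × (∀ J, Set (Z.M J))) :=
  {P | ∃ (E : TSheaf) (j : Hom W Z) (p : Hom Z E), IsExact j p ∧
    (∀ J, Set.range (j.app J) = P.1 J) ∧
    ∃ (k : Hom Y E) (r : Hom E X), IsExact k r ∧ ∀ J, {z | (r.comp p).app J z = 0} = P.2 J}

/-- The isomorphism theorems in this category: subobjects `L` of `Z` containing `N` correspond to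
subobjects of `Z/N`, with `Z/L` and `L/N` as the quotients. -/
theorem mem_flags_iff {X Y W Z : TSheaf} (N L : ∀ J, Set (Z.M J)) :
    (L, N) ∈ flags X Y W Z ↔ (N, L) ∈ flags' X Y W Z := by
  constructor
  · rintro ⟨E, i, r, hir, hi, j, q, hjq, hj⟩
    obtain ⟨E', p, hp⟩ := (hir.inj.comp hjq.inj).exists_coker
    obtain ⟨k, hk⟩ := hjq.surj.desc (p.comp i) fun J x hx => by
      obtain ⟨w, rfl⟩ := hjq.ker hx
      exact hp.comp w
    obtain ⟨r', hr'⟩ := hp.surj.desc r fun J z hz => by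
      obtain ⟨w, rfl⟩ := hp.ker hz
      exact hir.comp _
    have ker : ∀ {J} {x : E.M J}, p.app J (i.app J x) = 0 → q.app J x = 0 := by
      intro J x hx
      obtain ⟨w, hw⟩ := hp.ker hx
      rw [← hir.inj J hw]
      exact hjq.comp w
    refine ⟨E', i.comp j, p, hp, hj, k, r', ⟨fun J y y' h => ?_, fun J x => ?_, fun {J z} hz => ?_,
      fun {J} y => ?_⟩, fun J => ?_⟩
    · obtain ⟨x, rfl⟩ := hjq.surj J y
      obtain ⟨x', rfl⟩ := hjq.surj J y'
      rw [hk, hk] at h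
      rcases p.alpha _ _ h with h' | h'
      · rw [hir.inj J h']
      · rw [ker h', ker (x := x') (h.symm.trans h')]
    · obtain ⟨z, rfl⟩ := hir.surj J x
      exact ⟨_, hr' J z⟩
    · obtain ⟨z, rfl⟩ := hp.surj J z
      rw [hr'] at hz
      obtain ⟨x, rfl⟩ := hir.ker hz
      exact ⟨_, hk J x⟩
    · obtain ⟨x, rfl⟩ := hjq.surj J y
      rw [hk, Hom.comp_app, hr', hir.comp]
    · refine Eq.trans ?_ (hi J)
      rw [← hir.ker_eq]
      ext z
      simp only [Set.mem_ofPred_eq, Hom.comp_app, hr']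
  · rintro ⟨E', j, p, hp, hj, k, r, hkr, hL⟩
    obtain ⟨E, i, hi⟩ := (hkr.surj.comp hp.surj).exists_ker
    obtain ⟨j', hj'⟩ := hi.inj.lift j fun J w => hi.ker (by
      rw [Hom.comp_app, hp.comp, r.map_zero])
    obtain ⟨q, hq⟩ := hkr.inj.lift (p.comp i) fun J x => hkr.ker (hi.comp x)
    refine ⟨E, i, r.comp p, hi, fun J => (hi.ker_eq J).symm.trans (hL J), j', q, ⟨fun J w w' h => ?_,
      fun J y => ?_, fun {J x} hx => ?_, fun {J} w => ?_⟩, fun J => ?_⟩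
    · refine hp.inj J ?_
      rw [← hj', h, hj']
    · obtain ⟨z, hz⟩ := hp.surj J (k.app J y)
      obtain ⟨x, rfl⟩ := hi.ker (z := z) (by rw [Hom.comp_app, hz, hkr.comp])
      exact ⟨x, hkr.inj J (by rw [hq, ← hz, Hom.comp_app])⟩
    · have h0 : p.app J (i.app J x) = 0 := by
        have := hq J x
        rw [hx, k.map_zero] at this
        exact this.symm
      obtain ⟨w, hw⟩ := hp.ker h0
      exact ⟨w, hi.inj J (by rw [hj', hw])⟩
    · refine hkr.inj J ?_
      rw [hq, Hom.comp_app, hj', hp.comp, k.map_zero]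
    · refine Eq.trans ?_ (hj J)
      congr 1
      funext w
      rw [Hom.comp_app, hj']

theorem finite_flags (X Y W Z : TSheaf) : (flags X Y W Z).Finite := by
  refine (((Set.finite_range fun f : Hom Z X => fun J => {z | f.app J z = 0}).prod
    (Set.finite_range fun f : Hom W Z => fun J => Set.range (f.app J)))).subset ?_
  rintro ⟨L, N⟩ ⟨E, i, r, hir, hi, j, q, hjq, hj⟩
  refine ⟨⟨r, funext fun J => ?_⟩, i.comp j, funext hj⟩
  rw [← hi J, ← hir.ker_eq]

/-- The flags are sorted by the isomorphism class of the larger subobject `L`; over a fixed `L` they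
are the subobjects of `L`. -/
theorem ncard_flags (X Y W Z : TSheaf) : (flags X Y W Z).ncard =
    ∑ᶠ e : IsoClass, (subobjects Y W e.out).ncard * (subobjects X e.out Z).ncard := by
  refine ncard_fibration (finite_flags X Y W Z) (fun e : IsoClass => subobjects X e.out Z)
    (fun e => finite_subobjects _ _ _) ?_ (fun e : IsoClass => (subobjects Y W e.out).ncard) ?_ ?_
  · intro e e' L hL hL'
    obtain ⟨i, p, h, hr⟩ := mem_subobjects.1 hL
    obtain ⟨i', p', h', hr'⟩ := mem_subobjects.1 hL'
    obtain ⟨f, -⟩ := h.inj.iso_of_range h'.inj fun J => (hr J).trans (hr' J).symm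
    rw [← cls_out e, ← cls_out e']
    exact cls_eq_iff.2 ⟨f⟩
  · rintro ⟨L, N⟩ ⟨E, i, r, hir, hi, -⟩
    obtain ⟨f⟩ := nonempty_iso_out E
    exact ⟨cls E, subobjects_subset (Iso.refl X) f.symm (mem_subobjects.2 ⟨i, r, hir, hi⟩)⟩
  · intro e L hL
    obtain ⟨i, r, hir, hi⟩ := mem_subobjects.1 hL
    have hinj : Function.Injective fun (N : ∀ J, Set (e.out.M J)) J => i.app J '' N J :=
      fun N N' h => funext fun J => Set.image_injective.2 (hir.inj J) (congrFun h J)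
    rw [← Set.ncard_image_of_injective _ hinj]
    congr 1
    ext N
    constructor
    · rintro ⟨E, i', r', hir', hi', j, q, hjq, hj⟩
      obtain ⟨f, hf⟩ := hir'.inj.iso_of_range hir.inj fun J => (hi' J).trans (hi J).symm
      refine ⟨_, mem_subobjects.2 ⟨_, _, hjq.congr_mid f, fun J => rfl⟩, funext fun J => ?_⟩
      change i.app J '' _ = N J
      rw [← Set.range_comp]
      refine Eq.trans ?_ (hj J)
      congr 1
      funext w
      exact hf J _
    · rintro ⟨N', hN', rfl⟩
      obtain ⟨j, q, hjq, hj⟩ := mem_subobjects.1 hN'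
      refine ⟨_, i, r, hir, hi, j, q, hjq, fun J => ?_⟩
      change _ = i.app J '' N' J
      rw [← hj J, ← Set.range_comp]
      rfl

/-- Here the sorting is by the class of `Z/N`; over a fixed `N` the flags are the subobjects of the
quotient, via preimages. -/
theorem ncard_flags' (X Y W Z : TSheaf) : (flags' X Y W Z).ncard =
    ∑ᶠ e : IsoClass, (subobjects X Y e.out).ncard * (subobjects e.out W Z).ncard := by
  have hfin : (flags' X Y W Z).Finite := by
    refine Set.Finite.of_finite_image (f := Prod.swap) ((finite_flags X Y W Z).subset ?_)
      Prod.swap_injective.injOn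
    rintro _ ⟨⟨N, L⟩, h, rfl⟩
    exact (mem_flags_iff N L).2 h
  refine ncard_fibration hfin (fun e : IsoClass => subobjects e.out W Z)
    (fun e => finite_subobjects _ _ _) ?_ (fun e : IsoClass => (subobjects X Y e.out).ncard) ?_ ?_
  · intro e e' L hL hL'
    obtain ⟨i, p, h, hr⟩ := mem_subobjects.1 hL
    obtain ⟨i', p', h', hr'⟩ := mem_subobjects.1 hL'
    obtain ⟨f, -⟩ := h.surj.iso_of_ker h'.surj fun J x => by
      have h1 := h.ker_eq J
      rw [hr J, ← hr' J, ← h'.ker_eq J] at h1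
      exact Set.ext_iff.1 h1 x
    rw [← cls_out e, ← cls_out e']
    exact cls_eq_iff.2 ⟨f⟩
  · rintro ⟨N, L⟩ ⟨E, j, p, hjp, hj, -⟩
    obtain ⟨f⟩ := nonempty_iso_out E
    exact ⟨cls E, subobjects_subset f.symm (Iso.refl W) (mem_subobjects.2 ⟨j, p, hjp, hj⟩)⟩
  · intro e N hN
    obtain ⟨j, p, hjp, hj⟩ := mem_subobjects.1 hN
    have hinj : Function.Injective fun (N : ∀ J, Set (e.out.M J)) J => p.app J ⁻¹' N J :=
      fun N N' h => funext fun J => (Set.preimage_injective.2 (hjp.surj J)) (congrFun h J)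
    rw [← Set.ncard_image_of_injective _ hinj]
    congr 1
    ext L
    constructor
    · rintro ⟨E, j', p', hjp', hj', k, r, hkr, hL⟩
      obtain ⟨f, hf⟩ := hjp'.surj.iso_of_ker hjp.surj fun J x => by
        have h1 := (hjp'.ker_eq J).trans ((hj' J).trans ((hj J).symm.trans (hjp.ker_eq J).symm))
        exact Set.ext_iff.1 h1 x
      refine ⟨_, mem_subobjects.2 ⟨_, _, hkr.congr_mid f, fun J => rfl⟩, funext fun J => ?_⟩
      refine Eq.trans ?_ (hL J)
      dsimp only
      rw [← (hkr.congr_mid f).ker_eq]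
      ext z
      simp only [Set.mem_preimage, Set.mem_ofPred_eq, Hom.comp_app, ← hf, Hom.iso_hom_inv]
    · rintro ⟨L', hL', rfl⟩
      obtain ⟨k, r, hkr, hk⟩ := mem_subobjects.1 hL'
      refine ⟨_, j, p, hjp, hj, k, r, hkr, fun J => ?_⟩
      change _ = p.app J ⁻¹' L' J
      rw [← hk J, ← hkr.ker_eq]
      rfl

theorem hall_assoc (a b c d : IsoClass) :
    ∑ᶠ e, hallNumber a b e * hallNumber e c d = ∑ᶠ e, hallNumber b c e * hallNumber a e d := by
  have h := ncard_flags a.out b.out c.out d.out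
  have h' := ncard_flags' a.out b.out c.out d.out
  refine h'.symm.trans (Eq.trans ?_ h)
  rw [← Set.ncard_image_of_injective _ Prod.swap_injective]
  congr 1
  ext ⟨L, N⟩
  rw [mem_flags_iff]
  exact ⟨by rintro ⟨⟨_, _⟩, h, ⟨⟩⟩; exact h, fun h => ⟨(N, L), h, rfl⟩⟩

/-! ### The zero sheaf as the unit -/

theorem zeroSheaf_eq_zero {J : Cone} (x : zeroSheaf.M J) : x = 0 := rfl

/-- The zero morphism to the zero sheaf. -/
def toZero (F : TSheaf) : Hom F zeroSheaf :=
  ⟨fun _ _ => 0, fun _ => rfl, fun _ _ => rfl, fun _ _ => rfl, fun _ _ _ => Or.inr rfl⟩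

/-- The zero morphism from the zero sheaf. -/
def ofZero (F : TSheaf) : Hom zeroSheaf F :=
  ⟨fun _ _ => 0, fun _ => rfl, fun s _ => (F.act_zero s).symm, fun h _ => (F.res_zero h).symm,
    fun _ _ _ => Or.inr rfl⟩

theorem hall_zero_left (b c : IsoClass) :
    hallNumber (cls zeroSheaf) b c = Set.indicator {b} 1 c := by
  rw [← cls_out b, ← cls_out c, hallNumber_cls]
  by_cases h : cls c.out = cls b.out
  · rw [h, Set.indicator_of_mem (Set.mem_singleton _), Pi.one_apply, Set.ncard_eq_one]
    obtain ⟨e⟩ := cls_eq_iff.1 h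
    refine ⟨fun _ => Set.univ, Set.eq_singleton_iff_unique_mem.2 ⟨?_, fun N hN => ?_⟩⟩
    · exact mem_subobjects.2 ⟨(e.inv : Hom _ _), toZero _, ⟨Hom.inj_iso e.symm,
        fun J x => ⟨0, rfl⟩, fun {J} z _ => Hom.surj_iso e.symm J z, fun _ => rfl⟩,
        fun J => (Hom.surj_iso e.symm J).range_eq⟩
    · obtain ⟨i, p, hip, hi⟩ := mem_subobjects.1 hN
      funext J
      rw [← hi J, ← hip.ker_eq]
      exact Set.eq_univ_of_forall fun x => rfl
  · rw [Set.indicator_of_notMem (mt Set.mem_singleton_iff.1 h), Set.ncard_eq_zero (finite_subobjects _ _ _)]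
    refine Set.eq_empty_of_forall_notMem fun N hN => h ?_
    obtain ⟨i, p, hip, hi⟩ := mem_subobjects.1 hN
    obtain ⟨e⟩ := Hom.nonempty_iso_of_bijective i hip.inj fun J z => hip.ker (zeroSheaf_eq_zero _)
    exact cls_eq_iff.2 ⟨e.symm⟩

theorem hall_zero_right (a c : IsoClass) :
    hallNumber a (cls zeroSheaf) c = Set.indicator {a} 1 c := by
  rw [← cls_out a, ← cls_out c, hallNumber_cls]
  by_cases h : cls c.out = cls a.out
  · rw [h, Set.indicator_of_mem (Set.mem_singleton _), Pi.one_apply, Set.ncard_eq_one]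
    obtain ⟨e⟩ := cls_eq_iff.1 h
    refine ⟨fun _ => {0}, Set.eq_singleton_iff_unique_mem.2 ⟨?_, fun N hN => ?_⟩⟩
    · refine mem_subobjects.2 ⟨ofZero _, (e.hom : Hom _ _), ⟨fun J x y _ => rfl,
        Hom.surj_iso e, fun {J z} hz => ⟨0, ?_⟩, fun {J} y => Hom.map_zero _ J⟩,
        fun J => ?_⟩
      · exact Hom.inj_iso e J ((Hom.map_zero _ J).trans hz.symm)
      · exact Set.range_eq_singleton_iff.2 fun _ => rfl
    · obtain ⟨i, p, hip, hi⟩ := mem_subobjects.1 hN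
      funext J
      rw [← hi J]
      exact Set.range_eq_singleton_iff.2 fun y => by
        rw [zeroSheaf_eq_zero y, i.map_zero]
  · rw [Set.indicator_of_notMem (mt Set.mem_singleton_iff.1 h), Set.ncard_eq_zero (finite_subobjects _ _ _)]
    refine Set.eq_empty_of_forall_notMem fun N hN => h ?_
    obtain ⟨i, p, hip, hi⟩ := mem_subobjects.1 hN
    obtain ⟨e⟩ := Hom.nonempty_iso_of_bijective p (fun J z w hzw => by
      rcases p.alpha _ _ hzw with h' | h'
      · exact h'
      · obtain ⟨y, rfl⟩ := hip.ker h'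
        obtain ⟨y', rfl⟩ := hip.ker (hzw.symm.trans h')
        rfl) hip.surj
    exact cls_eq_iff.2 ⟨e⟩

theorem hallWellDefined : HallWellDefined :=
  ⟨finite_subobjects, finite_support_hallNumber, hall_assoc, hall_zero_left, hall_zero_right⟩

/- ## Split extensions -/

/-- A family of subsets of the stalks is closed under the action and under restriction. -/
structure IsClosedFamily (F : TSheaf) (N : ∀ J, Set (F.M J)) : Prop where
  act : ∀ {J} (s : S J) {x}, x ∈ N J → F.act s x ∈ N J
  res : ∀ {J K} (h : K ≤ J) {x}, x ∈ N J → F.res h x ∈ N K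

/-- The union of the complement with `{0}`. -/
def compl {F : TSheaf} (N : ∀ J, Set (F.M J)) : ∀ J, Set (F.M J) := fun J => {x | x ∈ N J → x = 0}

theorem mem_compl {F : TSheaf} {N : ∀ J, Set (F.M J)} {J : Cone} {x : F.M J} :
    x ∈ compl N J ↔ (x ∈ N J → x = 0) := Iff.rfl

theorem compl_compl {F : TSheaf} {N : ∀ J, Set (F.M J)} (h : ∀ J, 0 ∈ N J) :
    compl (compl N) = N := by
  funext J
  ext x
  rw [mem_compl, mem_compl]
  refine ⟨fun h' => ?_, fun h' h'' => h'' h'⟩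
  by_contra hx
  exact hx (h' (fun h'' => absurd h'' hx) ▸ h J)

theorem zero_mem_of_mem_subobjects {X Y Z : TSheaf} {N : ∀ J, Set (Z.M J)}
    (h : N ∈ subobjects X Y Z) (J : Cone) : 0 ∈ N J := by
  obtain ⟨i, p, -, hi⟩ := mem_subobjects.1 h
  rw [← hi J]
  exact ⟨0, i.map_zero J⟩

/-- The projection to `X` maps the complement bijectively, and collapsing the complement leaves a
copy of `Y`. -/
theorem compl_mem_subobjects {X Y Z : TSheaf} {N : ∀ J, Set (Z.M J)} (h : N ∈ subobjects X Y Z)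
    (hN : IsClosedFamily Z (compl N)) : compl N ∈ subobjects Y X Z := by
  obtain ⟨i, p, hip, hi⟩ := mem_subobjects.1 h
  have ker : ∀ {J} {z : Z.M J}, p.app J z = 0 ↔ z ∈ N J := fun {J z} => by
    rw [← hi J, ← hip.ker_eq]; rfl
  have h0 : ∀ J, (0 : Z.M J) ∈ compl N J := fun J _ => rfl
  obtain ⟨i', hi'⟩ := Hom.exists_of_rel (F := X) (G := Z)
    (fun J x z => p.app J z = x ∧ z ∈ compl N J)
    (fun J x => by
      by_cases hx : x = 0
      · exact ⟨0, by rw [hx, p.map_zero], h0 J⟩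
      · obtain ⟨z, hz⟩ := hip.surj J x
        exact ⟨z, hz, fun hz' => absurd (hz ▸ ker.2 hz') hx⟩)
    (by
      rintro J _ z z' ⟨rfl, h1⟩ ⟨h2, h3⟩
      rcases p.alpha _ _ h2 with h4 | h4
      · exact h4.symm
      · rw [h3 (ker.1 h4), h1 (ker.1 (h2 ▸ h4))])
    (fun J => ⟨p.map_zero J, h0 J⟩)
    (by rintro J s _ z ⟨rfl, h1⟩; exact ⟨p.map_act _ _, hN.act s h1⟩)
    (by rintro J K hK _ z ⟨rfl, h1⟩; exact ⟨p.map_res _ _, hN.res hK h1⟩)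
    (by rintro J _ _ z ⟨rfl, h1⟩ ⟨rfl, h2⟩; exact Or.inl rfl)
  obtain ⟨p', hp'⟩ := Hom.exists_of_rel (F := Z) (G := Y)
    (fun J z y => i.app J y = z ∨ (z ∈ compl N J ∧ y = 0))
    (fun J z => by
      by_cases hz : z ∈ N J
      · obtain ⟨y, hy⟩ := (hi J).symm ▸ hz
        exact ⟨y, Or.inl hy⟩
      · exact ⟨0, Or.inr ⟨fun h => absurd h hz, rfl⟩⟩)
    (by
      have key : ∀ {J} {y : Y.M J}, i.app J y ∈ compl N J → y = 0 := fun {J y} h1 =>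
        hip.inj J ((h1 (hi J ▸ ⟨y, rfl⟩)).trans (i.map_zero J).symm)
      rintro J z y y' (rfl | ⟨h1, rfl⟩) (h2 | ⟨h2, rfl⟩)
      · exact hip.inj J h2.symm
      · exact key h2
      · subst h2; exact (key h1).symm
      · rfl)
    (fun J => Or.inl (i.map_zero J))
    (by
      rintro J s z y (rfl | ⟨h1, rfl⟩)
      · exact Or.inl (i.map_act _ _)
      · exact Or.inr ⟨hN.act s h1, Y.act_zero s⟩)
    (by
      rintro J K hK z y (rfl | ⟨h1, rfl⟩)
      · exact Or.inl (i.map_res _ _)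
      · exact Or.inr ⟨hN.res hK h1, Y.res_zero hK⟩)
    (by
      rintro J z z' y (rfl | ⟨h1, rfl⟩) (rfl | ⟨h2, h3⟩)
      · exact Or.inl rfl
      · exact Or.inr h3
      · exact Or.inr rfl
      · exact Or.inr rfl)
  have hr : ∀ J, Set.range (i'.app J) = compl N J := by
    intro J
    ext z
    constructor
    · rintro ⟨x, hx⟩; exact ((hi' J _ _).2 hx).2
    · intro hz; exact ⟨_, (hi' J _ _).1 ⟨rfl, hz⟩⟩
  refine mem_subobjects.2 ⟨i', p', ⟨?_, ?_, ?_, ?_⟩, hr⟩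
  · intro J x x' h
    rw [← ((hi' J x _).2 rfl).1, ← ((hi' J x' _).2 rfl).1, h]
  · intro J y
    exact ⟨_, (hp' J _ _).1 (Or.inl rfl)⟩
  · intro J z hz
    have hz' : z ∈ compl N J := by
      rcases (hp' J _ _).2 hz with h | h
      · rw [← h, i.map_zero]; exact h0 J
      · exact h.1
    rwa [← hr J] at hz'
  · intro J x
    exact (hp' J _ _).1 (Or.inr ⟨hr J ▸ ⟨x, rfl⟩, rfl⟩)

/-- Passing to the complement is an involution. This is the source of all vanishing of commutator
coefficients. -/
theorem ncard_subobjects_comm {X Y Z : TSheaf}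
    (h : ∀ N ∈ subobjects X Y Z, IsClosedFamily Z (compl N))
    (h' : ∀ N ∈ subobjects Y X Z, IsClosedFamily Z (compl N)) :
    (subobjects X Y Z).ncard = (subobjects Y X Z).ncard := by
  refine Set.ncard_congr (fun N _ => compl N) (fun N hN => compl_mem_subobjects hN (h N hN))
    (fun N N' hN hN' e => ?_) fun N hN => ⟨compl N, compl_mem_subobjects hN (h' N hN),
      compl_compl (zero_mem_of_mem_subobjects hN)⟩
  rw [← compl_compl (zero_mem_of_mem_subobjects hN), e,
    compl_compl (zero_mem_of_mem_subobjects hN')]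

theorem mem_iff_of_isExact {X Y Z : TSheaf} {N : ∀ J, Set (Z.M J)} {i : Hom Y Z} {p : Hom Z X}
    (hip : IsExact i p) (hi : ∀ J, Set.range (i.app J) = N J) {J : Cone} {z : Z.M J} :
    z ∈ N J ↔ p.app J z = 0 := by
  rw [← hi J, ← hip.ker_eq]; rfl

theorem res_ne_zero_of_torsionFree {F : TSheaf} (hF : IsTorsionFree F) {J K : Cone} (h : K ≤ J)
    {x : F.M J} (hx : x ≠ 0) : F.res h x ≠ 0 := fun h0 => by
  obtain ⟨s, -, hs⟩ := (TSheaf.res_eq_zero_iff h x).1 h0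
  exact hF J x hx s hs

/-- A section outside `N` has non-zero image in `X`, and in a torsion-free sheaf neither the action
nor restriction can kill this image. So extensions with torsion-free quotient split. -/
theorem isClosedFamily_compl_of_torsionFree {X Y Z : TSheaf} (hX : IsTorsionFree X)
    {N : ∀ J, Set (Z.M J)} (h : N ∈ subobjects X Y Z) : IsClosedFamily Z (compl N) := by
  obtain ⟨i, p, hip, hi⟩ := mem_subobjects.1 h
  constructor
  · intro J s z hz hsz
    by_contra h0
    have hz0 := mt hz (TSheaf.ne_of_act_ne h0)
    rw [mem_iff_of_isExact hip hi] at hz0 hsz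
    rw [p.map_act] at hsz
    exact hX J _ hz0 s hsz
  · intro J K hK z hz hsz
    by_contra h0
    have hz0 := mt hz (TSheaf.ne_of_res_ne h0)
    rw [mem_iff_of_isExact hip hi] at hz0 hsz
    rw [p.map_res] at hsz
    exact res_ne_zero_of_torsionFree hX hK hz0 hsz

/- ## Decompositions -/

/-- `F` is the direct sum of the subsheaves `A` and `B`. -/
structure IsDecomp (F : TSheaf) (A B : ∀ J, Set (F.M J)) : Prop where
  left : IsClosedFamily F A
  right : IsClosedFamily F B
  union : ∀ J, A J ∪ B J = Set.univ
  inter : ∀ J, A J ∩ B J = {0}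

theorem IsDecomp.symm {F : TSheaf} {A B : ∀ J, Set (F.M J)} (h : IsDecomp F A B) :
    IsDecomp F B A :=
  ⟨h.right, h.left, fun J => by rw [Set.union_comm, h.union], fun J => by
    rw [Set.inter_comm, h.inter]⟩

theorem IsDecomp.zero_mem {F : TSheaf} {A B : ∀ J, Set (F.M J)} (h : IsDecomp F A B) (J : Cone) :
    0 ∈ A J ∩ B J := by rw [h.inter]; rfl

theorem IsDecomp.eq_zero {F : TSheaf} {A B : ∀ J, Set (F.M J)} (h : IsDecomp F A B) {J : Cone}
    {x : F.M J} (hA : x ∈ A J) (hB : x ∈ B J) : x = 0 := by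
  have : x ∈ A J ∩ B J := ⟨hA, hB⟩
  rwa [h.inter] at this

theorem IsDecomp.mem_or {F : TSheaf} {A B : ∀ J, Set (F.M J)} (h : IsDecomp F A B) {J : Cone}
    (x : F.M J) : x ∈ A J ∨ x ∈ B J := by
  have : x ∈ A J ∪ B J := by rw [h.union]; trivial
  exact this

theorem isIndecomposable_iff {F : TSheaf} : IsIndecomposable F ↔ (∃ J, ∃ x : F.M J, x ≠ 0) ∧
    ∀ A B, IsDecomp F A B → (∀ J, A J = {0}) ∨ ∀ J, B J = {0} := by
  refine and_congr_right fun _ => ⟨fun h A B hd => h A B (fun _ s _ hx => hd.left.act s hx)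
    (fun _ s _ hx => hd.right.act s hx) (fun _ _ hK _ hx => hd.left.res hK hx)
    (fun _ _ hK _ hx => hd.right.res hK hx) hd.union hd.inter,
    fun h A B h1 h2 h3 h4 h5 h6 => h A B ⟨⟨fun s _ hx => h1 _ s _ hx, fun hK _ hx => h3 _ _ hK _ hx⟩,
      ⟨fun s _ hx => h2 _ s _ hx, fun hK _ hx => h4 _ _ hK _ hx⟩, h5, h6⟩⟩

theorem IsDecomp.comap {F G : TSheaf} {A B : ∀ J, Set (G.M J)} (h : IsDecomp G A B) {f : Hom F G}
    (hf : f.Inj) : IsDecomp F (fun J => f.app J ⁻¹' A J) (fun J => f.app J ⁻¹' B J) := by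
  refine ⟨⟨fun s x hx => ?_, fun hK x hx => ?_⟩, ⟨fun s x hx => ?_, fun hK x hx => ?_⟩,
    fun J => ?_, fun J => ?_⟩
  · rw [Set.mem_preimage, f.map_act]; exact h.left.act s hx
  · rw [Set.mem_preimage, f.map_res]; exact h.left.res hK hx
  · rw [Set.mem_preimage, f.map_act]; exact h.right.act s hx
  · rw [Set.mem_preimage, f.map_res]; exact h.right.res hK hx
  · rw [← Set.preimage_union, h.union, Set.preimage_univ]
  · ext x
    rw [← Set.preimage_inter, h.inter]
    exact ⟨fun hx => hf J (hx.trans (f.map_zero J).symm), by rintro rfl; exact f.map_zero J⟩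

/-- The images meet only in zero, since by condition α a morphism identifies different sections only
by sending them to zero. -/
theorem IsDecomp.map {F G : TSheaf} {A B : ∀ J, Set (F.M J)} (h : IsDecomp F A B) {f : Hom F G}
    (hf : f.Surj) : IsDecomp G (fun J => f.app J '' A J) (fun J => f.app J '' B J) := by
  refine ⟨⟨fun s x hx => ?_, fun hK x hx => ?_⟩, ⟨fun s x hx => ?_, fun hK x hx => ?_⟩,
    fun J => ?_, fun J => ?_⟩
  · obtain ⟨a, ha, rfl⟩ := hx; exact ⟨_, h.left.act s ha, f.map_act _ _⟩
  · obtain ⟨a, ha, rfl⟩ := hx; exact ⟨_, h.left.res hK ha, f.map_res _ _⟩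
  · obtain ⟨a, ha, rfl⟩ := hx; exact ⟨_, h.right.act s ha, f.map_act _ _⟩
  · obtain ⟨a, ha, rfl⟩ := hx; exact ⟨_, h.right.res hK ha, f.map_res _ _⟩
  · rw [← Set.image_union, h.union, Set.image_univ, (hf J).range_eq]
  · ext x
    constructor
    · rintro ⟨⟨a, ha, rfl⟩, b, hb, e⟩
      rcases f.alpha _ _ e with rfl | h0
      · rw [h.eq_zero ha hb]; exact f.map_zero J
      · exact e.symm.trans h0
    · rintro rfl
      exact ⟨⟨0, (h.zero_mem J).1, f.map_zero J⟩, 0, (h.zero_mem J).2, f.map_zero J⟩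

/-- In a decomposable extension of indecomposable sheaves the subsheaf is a direct summand. -/
theorem isClosedFamily_compl_of_isDecomp {X Y Z : TSheaf} (hX : IsIndecomposable X)
    (hY : IsIndecomposable Y) {A B : ∀ J, Set (Z.M J)} (hd : IsDecomp Z A B)
    (hA : ¬ ∀ J, A J = {0}) (hB : ¬ ∀ J, B J = {0}) {N : ∀ J, Set (Z.M J)}
    (h : N ∈ subobjects X Y Z) : IsClosedFamily Z (compl N) := by
  obtain ⟨i, p, hip, hi⟩ := mem_subobjects.1 h
  -- Since `Y` is indecomposable, `N` lies in one summand, here `A`. Since `X` is indecomposable,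
  -- one summand dies in the quotient. It cannot be `B`, which meets `N` only in zero and is
  -- non-zero; so `A ⊆ N`, and the complement of `N` is `B`.
  have main : ∀ {A B : ∀ J, Set (Z.M J)}, IsDecomp Z A B → (¬ ∀ J, B J = {0}) →
      (∀ J, i.app J ⁻¹' B J = {0}) → IsClosedFamily Z (compl N) := by
    intro A B hd hB hBY
    have hNA : ∀ {J} {z : Z.M J}, z ∈ N J → z ∈ B J → z = 0 := by
      intro J z hz hzB
      rw [← hi J] at hz
      obtain ⟨y, rfl⟩ := hz
      have hy : y ∈ i.app J ⁻¹' B J := hzB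
      rw [hBY J] at hy
      rw [show y = 0 from hy, i.map_zero]
    rcases (isIndecomposable_iff.1 hX).2 _ _ (hd.map hip.surj) with h1 | h1
    · have e : compl N = B := by
        funext J
        ext z
        refine ⟨fun hz => (hd.mem_or z).elim (fun hzA => ?_) id, fun hzB hz => hNA hz hzB⟩
        have hpz : p.app J z ∈ p.app J '' A J := ⟨z, hzA, rfl⟩
        rw [h1 J] at hpz
        rw [hz ((mem_iff_of_isExact hip hi).2 hpz)]
        exact (hd.zero_mem J).2
      rw [e]
      exact hd.right
    · refine absurd (fun J => Set.eq_singleton_iff_unique_mem.2 ⟨(hd.zero_mem J).2, fun z hz => ?_⟩) hB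
      have hpz : p.app J z ∈ p.app J '' B J := ⟨z, hz, rfl⟩
      rw [h1 J] at hpz
      exact hNA ((mem_iff_of_isExact hip hi).2 hpz) hz
  rcases (isIndecomposable_iff.1 hY).2 _ _ (hd.comap hip.inj) with h1 | h1
  · exact main hd.symm hA h1
  · exact main hd hB h1

theorem ncard_subobjects_comm_of_indecomposable {X Y Z : TSheaf} (hX : IsIndecomposable X)
    (hY : IsIndecomposable Y) (hZ : ¬ IsIndecomposable Z) :
    (subobjects X Y Z).ncard = (subobjects Y X Z).ncard := by
  rw [isIndecomposable_iff, not_and_or] at hZ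
  rcases hZ with hZ | hZ
  · have empty : ∀ {X Y : TSheaf}, IsIndecomposable Y → ∀ N, N ∉ subobjects X Y Z := by
      intro X Y hY N hN
      obtain ⟨i, p, hip, -⟩ := mem_subobjects.1 hN
      obtain ⟨J, y, hy⟩ := hY.1
      exact hZ ⟨J, _, hip.inj.app_ne hy⟩
    exact ncard_subobjects_comm (fun N hN => absurd hN (empty hY N))
      fun N hN => absurd hN (empty hX N)
  · push Not at hZ
    obtain ⟨A, B, hd, hA, hB⟩ := hZ
    have hA' : ¬ ∀ J, A J = {0} := fun h => by obtain ⟨J, hJ⟩ := hA; exact hJ (h J)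
    have hB' : ¬ ∀ J, B J = {0} := fun h => by obtain ⟨J, hJ⟩ := hB; exact hJ (h J)
    exact ncard_subobjects_comm
      (fun N hN => isClosedFamily_compl_of_isDecomp hX hY hd hA' hB' hN)
      fun N hN => isClosedFamily_compl_of_isDecomp hY hX hd hA' hB' hN

/- ## Coefficients -/

section Coefficients

variable (k : Type*) [CommRing k] (h : HallWellDefined)

/-- The value of a function on isomorphism classes. -/
noncomputable def coeff (c : IsoClass) : HallAlg k h →ₗ[k] k :=
  (Finsupp.lapply c : (IsoClass →₀ k) →ₗ[k] k)

variable {k h}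

theorem hallAlg_ext {f g : HallAlg k h} (e : ∀ c, coeff k h c f = coeff k h c g) : f = g :=
  Finsupp.ext (M := k) e

theorem coeff_δ (c : IsoClass) (F : TSheaf) :
    coeff k h c (δ k h F) = Set.indicator {cls F} 1 c := by
  classical
  change (Finsupp.single (cls F) (1 : k)) c = _
  rw [Finsupp.single_apply, Set.indicator_apply]
  simp [eq_comm]

theorem coeff_mul (c : IsoClass) (X Y : TSheaf) :
    coeff k h c (δ k h X * δ k h Y) = (hallNumber (cls X) (cls Y) c : k) := by
  change hallMul k h (Finsupp.single (cls X) 1) (Finsupp.single (cls Y) 1) c = _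
  rw [hallMul_single, hallMulSingle_apply]

theorem mem_span_δ {P : TSheaf → Prop} {f : HallAlg k h}
    (hf : ∀ c, coeff k h c f ≠ 0 → P c.out) :
    f ∈ Submodule.span k {g | ∃ F, P F ∧ g = δ k h F} := by
  have e : f = (f : IsoClass →₀ k).sum fun c r => r • δ k h c.out := by
    have h1 : ∀ (c : IsoClass) (r : k), r • δ k h c.out = (Finsupp.single c r : IsoClass →₀ k) := by
      intro c r
      rw [δ, cls_out]
      exact (Finsupp.smul_single r c (1 : k)).trans (by rw [smul_eq_mul, mul_one])
    simp only [h1]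
    exact (Finsupp.sum_single (f : IsoClass →₀ k)).symm
  rw [e]
  refine Submodule.sum_mem _ fun c hc => Submodule.smul_mem _ _ (Submodule.subset_span
    ⟨c.out, hf c (Finsupp.mem_support_iff.1 hc), rfl⟩)

/-- Invariance of `P` under isomorphism is needed because `c.out` is only some representative of
`c`. -/
theorem coeff_of_mem_span {P : TSheaf → Prop} (hP : ∀ {F G : TSheaf}, (F ≅ G) → P F → P G)
    {f : HallAlg k h} (hf : f ∈ Submodule.span k {g | ∃ F, P F ∧ g = δ k h F}) (c : IsoClass)
    (hc : coeff k h c f ≠ 0) : P c.out := by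
  by_contra hPc
  refine hc (Submodule.span_induction (p := fun f _ => coeff k h c f = 0) ?_ (map_zero _) ?_ ?_ hf)
  · rintro _ ⟨F, hF, rfl⟩
    rw [coeff_δ, Set.indicator_of_notMem]
    intro e
    obtain ⟨e⟩ := cls_eq_iff.1 ((cls_out c).trans e)
    exact hPc (hP e.symm hF)
  · intro x y _ _ hx hy
    rw [map_add, hx, hy, add_zero]
  · intro r x _ hx
    rw [map_smul, hx, smul_zero]

theorem coeff_commutator (c : IsoClass) (X Y : TSheaf) :
    coeff k h c (δ k h X * δ k h Y - δ k h Y * δ k h X) =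
      ((subobjects X Y c.out).ncard : k) - (subobjects Y X c.out).ncard := by
  rw [map_sub, coeff_mul, coeff_mul, ← hallNumber_cls, ← hallNumber_cls, cls_out]

theorem commutator_mem_span {V : Submodule k (HallAlg k h)}
    {s : Set (HallAlg k h)} (hV : ∀ x ∈ s, ∀ y ∈ s, x * y - y * x ∈ V) {x y : HallAlg k h}
    (hx : x ∈ Submodule.span k s) (hy : y ∈ Submodule.span k s) : x * y - y * x ∈ V := by
  refine Submodule.span_induction₂ (p := fun x y _ _ => x * y - y * x ∈ V)
    (fun x y hx hy => hV x hx y hy) ?_ ?_ ?_ ?_ ?_ ?_ hx hy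
  · intro y _; simp
  · intro x _; simp
  · intro x y z _ _ _ h1 h2
    have e : (x + y) * z - z * (x + y) = (x * z - z * x) + (y * z - z * y) := by noncomm_ring
    rw [e]; exact V.add_mem h1 h2
  · intro x y z _ _ _ h1 h2
    have e : x * (y + z) - (y + z) * x = (x * y - y * x) + (x * z - z * x) := by noncomm_ring
    rw [e]; exact V.add_mem h1 h2
  · intro r x y _ _ h1
    rw [smul_mul_assoc, mul_smul_comm, ← smul_sub]; exact V.smul_mem r h1
  · intro r x y _ _ h1
    rw [smul_mul_assoc, mul_smul_comm, ← smul_sub]; exact V.smul_mem r h1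

/-- At a decomposable or zero `Z` the two structure constants agree, so the coefficient of the
commutator vanishes. -/
theorem commutator_mem_indecSpan {x y : HallAlg k h} (hx : x ∈ indecSpan k h)
    (hy : y ∈ indecSpan k h) : x * y - y * x ∈ indecSpan k h := by
  refine commutator_mem_span ?_ hx hy
  rintro _ ⟨X, hX, rfl⟩ _ ⟨Y, hY, rfl⟩
  refine mem_span_δ fun c hc => ?_
  by_contra hZ
  rw [coeff_commutator, ncard_subobjects_comm_of_indecomposable hX hY hZ, sub_self] at hc
  exact hc rfl

end Coefficients

/- ## The sheaves `𝒪_i(n)` are indecomposable -/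

theorem exists_pairing {v : Fin 3 → ℤ} (hv : v 0 + v 1 + v 2 = 0) : ∃ e, pairing e = v := by
  refine ⟨(v 1, v 2), funext fun j => ?_⟩
  fin_cases j <;> simp [pairing]
  omega

/-- On the ray `i` two non-zero sections have exponent zero at `i`, so their quotient is a unit of
`S (ray i)`. -/
theorem lineO_transitive {i : Fin 3} {n : ℤ} {x y : (lineO i n).M (ray i)} (hx : x ≠ 0)
    (hy : y ≠ 0) : ∃ s : S (ray i), (lineO i n).act s x = y := by
  rcases x with _ | a
  · exact absurd rfl hx
  rcases y with _ | b
  · exact absurd rfl hy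
  have ha := a.2
  have hb := b.2
  obtain ⟨e, he⟩ := exists_pairing (v := b.1 - a.1) (by
    have := ha.1
    have := hb.1
    simp only [Pi.sub_apply]
    omega)
  have hi0 := (ha.2.2 i (Finset.mem_singleton_self i)).2
  have hi1 := (hb.2.2 i (Finset.mem_singleton_self i)).2
  refine ⟨⟨e, fun j hj => ?_⟩, ?_⟩
  · obtain rfl := Finset.mem_singleton.1 hj
    rw [he, Pi.sub_apply]
    omega
  · change mono {i} n (ray i) (a.1 + pairing e) = some b
    rw [he, add_sub_cancel, mono_pos hb]

theorem lineO_res_ne {i : Fin 3} {n : ℤ} {J : Cone} {x : (lineO i n).M J} (hx : x ≠ 0) :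
    ∃ h : i ∈ J.1, (lineO i n).res (ray_le h) x ≠ 0 := by
  rcases x with _ | a
  · exact absurd rfl hx
  have h := (a.2.2.2 i (Finset.mem_singleton_self i)).1
  refine ⟨h, ?_⟩
  change mono {i} n (ray i) a.1 ≠ none
  rw [mono_pos ((shape_face (ray_le h) a.2).2 (by simp [ray]))]
  exact Option.some_ne_none _

theorem lineO_ray_nonempty (i : Fin 3) (n : ℤ) : ∃ x : (lineO i n).M (ray i), x ≠ 0 := by
  obtain ⟨l, hl⟩ := exists_ne i
  refine ⟨some ⟨monoGen n l, ?_, ?_, ?_⟩, Option.some_ne_none _⟩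
  · fin_cases l <;> simp [monoGen]
  · intro j hj
    obtain rfl := Finset.mem_singleton.1 hj
    simp [monoGen, hl]
  · intro j hj
    obtain rfl := Finset.mem_singleton.1 hj
    exact ⟨Finset.mem_singleton_self _, by simp [monoGen, hl]⟩

/-- A sheaf all of whose sections are determined by a transitive stalk is indecomposable. -/
theorem isIndecomposable_of_transitive {F : TSheaf} {K : Cone} {x : F.M K} (hx : x ≠ 0)
    (htrans : ∀ y, y ≠ 0 → ∃ s, F.act s x = y)
    (hres : ∀ (J : Cone) (y : F.M J), y ≠ 0 → ∃ h : K ≤ J, F.res h y ≠ 0) :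
    IsIndecomposable F := by
  have main : ∀ A B, IsDecomp F A B → x ∈ A K → ∀ J, B J = {0} := by
    intro A B hd hxA J
    refine Set.eq_singleton_iff_unique_mem.2 ⟨(hd.zero_mem J).2, fun y hy => ?_⟩
    by_contra hy0
    obtain ⟨h, hne⟩ := hres J y hy0
    obtain ⟨s, hs⟩ := htrans _ hne
    exact hne (hd.eq_zero (hs ▸ hd.left.act s hxA) (hd.right.res _ hy))
  refine isIndecomposable_iff.2 ⟨⟨_, x, hx⟩, fun A B hd => ?_⟩
  rcases hd.mem_or x with h | h
  · exact Or.inr (main A B hd h)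
  · exact Or.inl (main B A hd.symm h)

theorem isIndecomposable_lineO (i : Fin 3) (n : ℤ) : IsIndecomposable (lineO i n) := by
  obtain ⟨x, hx⟩ := lineO_ray_nonempty i n
  refine isIndecomposable_of_transitive hx (fun y hy => lineO_transitive hx hy) fun J y hy => ?_
  obtain ⟨h, h'⟩ := lineO_res_ne hy
  exact ⟨ray_le h, h'⟩

/-- The Hall Lie algebra spanned by the indecomposable sheaves contains `𝔨`. -/
theorem exists_indecSpan_lieSubalgebra (k : Type*) [CommRing k] (h : HallWellDefined) :
    ∃ n : LieSubalgebra k (HallAlg k h), n.toSubmodule = indecSpan k h ∧ lineLie k h ≤ n := by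
  refine ⟨{ indecSpan k h with lie_mem' := fun hx hy => commutator_mem_indecSpan hx hy }, rfl, ?_⟩
  refine LieSubalgebra.lieSpan_le.2 ?_
  rintro _ ⟨i, n, rfl⟩
  exact Submodule.subset_span ⟨_, isIndecomposable_lineO i n, rfl⟩

/- ## Torsion-free sheaves -/

theorem IsTorsionFree.of_inj {F G : TSheaf} (hG : IsTorsionFree G) {f : Hom F G} (hf : f.Inj) :
    IsTorsionFree F := fun J x hx s hs =>
  hG J _ (hf.app_ne hx) s (by rw [← f.map_act, hs, f.map_zero])

theorem IsTorsionFree.of_iso {F G : TSheaf} (e : F ≅ G) (hF : IsTorsionFree F) :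
    IsTorsionFree G := hF.of_inj (Hom.inj_iso e.symm)

theorem isTorsionFree_cls_out {F : TSheaf} (hF : IsTorsionFree F) : IsTorsionFree (cls F).out := by
  obtain ⟨e⟩ := nonempty_iso_out F
  exact hF.of_iso e.symm

theorem IsExact.isTorsionFree {X Y Z : TSheaf} {i : Hom Y Z} {p : Hom Z X} (h : IsExact i p)
    (hX : IsTorsionFree X) (hY : IsTorsionFree Y) : IsTorsionFree Z := by
  intro J z hz s hs
  by_cases h0 : p.app J z = 0
  · obtain ⟨y, rfl⟩ := h.ker h0
    refine hY J y (i.ne_of_app_ne hz) s (h.inj J ?_)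
    rw [i.map_act, hs, i.map_zero]
  · exact hX J _ h0 s (by rw [← p.map_act, hs, p.map_zero])

theorem isTorsionFree_zeroSheaf : IsTorsionFree zeroSheaf := fun _ _ hx => absurd rfl hx

section TorsionFree

variable {k : Type*} [CommRing k] {h : HallWellDefined}

theorem one_eq_δ : (1 : HallAlg k h) = δ k h zeroSheaf := rfl

/-- Extensions of torsion-free sheaves are torsion-free, so the span of their classes is already
closed under products and contains the unit. -/
theorem mem_TF_iff_mem_span {f : HallAlg k h} :
    f ∈ TF k h ↔ f ∈ Submodule.span k {g | ∃ F, IsTorsionFree F ∧ g = δ k h F} := by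
  set V := Submodule.span k {g | ∃ F, IsTorsionFree F ∧ g = δ k h F} with hV
  have hmul : V * V ≤ V := by
    rw [hV, Submodule.span_mul_span, Submodule.span_le]
    rintro _ ⟨_, ⟨X, hX, rfl⟩, _, ⟨Y, hY, rfl⟩, rfl⟩
    refine mem_span_δ fun c hc => ?_
    change coeff k h c (δ k h X * δ k h Y) ≠ 0 at hc
    rw [coeff_mul] at hc
    obtain ⟨i, p, hip⟩ := hallNumber_ne_zero (a := cls X) (b := cls Y) (c := c)
      fun h0 => hc (by rw [h0, Nat.cast_zero])
    exact hip.isTorsionFree (isTorsionFree_cls_out hX) (isTorsionFree_cls_out hY)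
  refine ⟨fun hf => ?_, fun hf => ?_⟩
  · refine Algebra.adjoin_induction (p := fun f _ => f ∈ V) (fun x hx => Submodule.subset_span hx)
      (fun r => ?_) (fun x y _ _ => V.add_mem)
      (fun x y _ _ hx hy => hmul (Submodule.mul_mem_mul hx hy)) hf
    rw [Algebra.algebraMap_eq_smul_one, one_eq_δ]
    exact V.smul_mem _ (Submodule.subset_span ⟨_, isTorsionFree_zeroSheaf, rfl⟩)
  · have hle : V ≤ Subalgebra.toSubmodule (TF k h) :=
      Submodule.span_le.2 fun x hx => Algebra.subset_adjoin hx
    exact hle hf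

theorem mem_TF_iff {f : HallAlg k h} :
    f ∈ TF k h ↔ ∀ c, coeff k h c f ≠ 0 → IsTorsionFree c.out := by
  rw [mem_TF_iff_mem_span]
  exact ⟨fun hf c => coeff_of_mem_span IsTorsionFree.of_iso hf c, mem_span_δ⟩

theorem δ_mem_TF {F : TSheaf} (hF : IsTorsionFree F) : δ k h F ∈ TF k h :=
  Algebra.subset_adjoin ⟨F, hF, rfl⟩

theorem TF_mul_comm (a b : TF k h) : a * b = b * a := by
  refine Subtype.ext (sub_eq_zero.1 ?_)
  refine (Submodule.mem_bot k).1 (commutator_mem_span (V := ⊥) ?_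
    (mem_TF_iff_mem_span.1 a.2) (mem_TF_iff_mem_span.1 b.2))
  rintro _ ⟨X, hX, rfl⟩ _ ⟨Y, hY, rfl⟩
  rw [Submodule.mem_bot]
  refine hallAlg_ext fun c => ?_
  rw [coeff_commutator, map_zero, ncard_subobjects_comm
    (fun N hN => isClosedFamily_compl_of_torsionFree hX hN)
    (fun N hN => isClosedFamily_compl_of_torsionFree hY hN), sub_self]

end TorsionFree

/- ## Locally free sheaves -/

/-- Two sections have the same generic orbit. -/
def SameOrbit (F : TSheaf) {J K : Cone} (x : F.M J) (y : F.M K) : Prop :=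
  ∃ t : S torus, F.act t (F.res (torus_le J) x) = F.res (torus_le K) y

namespace SameOrbit

variable {F : TSheaf} {J K L : Cone} {x : F.M J} {y : F.M K} {z : F.M L}

theorem refl (x : F.M J) : SameOrbit F x x := ⟨0, F.zero_act _⟩

theorem symm (h : SameOrbit F x y) : SameOrbit F y x := by
  obtain ⟨t, ht⟩ := h
  exact ⟨⟨-t, mem_S_torus _⟩, by rw [← ht, F.act_neg_act]⟩

theorem trans (h : SameOrbit F x y) (h' : SameOrbit F y z) : SameOrbit F x z := by
  obtain ⟨t, ht⟩ := h
  obtain ⟨t', ht'⟩ := h'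
  exact ⟨t' + t, by rw [F.add_act, ht, ht']⟩

theorem act_right (x : F.M J) (s : S J) : SameOrbit F x (F.act s x) :=
  ⟨faceIncl (torus_le J) s, by rw [F.res_act]⟩

theorem res_right (x : F.M J) (h : K ≤ J) : SameOrbit F x (F.res h x) :=
  ⟨0, by rw [F.zero_act, F.res_res]⟩

theorem ne_zero (hF : IsTorsionFree F) (h : SameOrbit F x y) (hx : x ≠ 0) : y ≠ 0 := by
  obtain ⟨t, ht⟩ := h
  refine TSheaf.ne_of_res_ne (h := torus_le K) ?_
  rw [← ht]
  exact hF _ _ (res_ne_zero_of_torsionFree hF _ hx) _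

theorem map {G : TSheaf} (f : Hom F G) (h : SameOrbit F x y) :
    SameOrbit G (f.app J x) (f.app K y) := by
  obtain ⟨t, ht⟩ := h
  exact ⟨t, by rw [← f.map_res, ← f.map_act, ht, f.map_res]⟩

theorem of_map {G : TSheaf} {f : Hom F G} (hf : f.Inj)
    (h : SameOrbit G (f.app J x) (f.app K y)) : SameOrbit F x y := by
  obtain ⟨t, ht⟩ := h
  exact ⟨t, hf _ (by rw [f.map_act, f.map_res, ht, f.map_res])⟩

end SameOrbit

/-- In every stalk, every generic orbit that meets the stalk contains a section that
generates all others. -/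
def HasLeast (F : TSheaf) : Prop := ∀ (J : Cone) (x : F.M J), x ≠ 0 →
  ∃ b : F.M J, b ≠ 0 ∧ ∀ y : F.M J, SameOrbit F x y → ∃ s, y = F.act s b

theorem HasLeast.of_iso {F G : TSheaf} (e : F ≅ G) (h : HasLeast F) : HasLeast G := by
  intro J x hx
  obtain ⟨b, hb, hl⟩ := h J (Hom.app e.inv J x) ((Hom.inj_iso e.symm).app_ne hx)
  refine ⟨Hom.app e.hom J b, (Hom.inj_iso e).app_ne hb, fun y hy => ?_⟩
  obtain ⟨s, hs⟩ := hl (Hom.app e.inv J y) (hy.map _)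
  exact ⟨s, by rw [← Hom.map_act, ← hs, Hom.iso_inv_hom]⟩

/-- Multiples of different basis elements lie in different generic orbits, so each orbit is
generated by one basis element. -/
theorem IsLocallyFree.hasLeast {F : TSheaf} (h : IsLocallyFree F) : HasLeast F := by
  intro J x hx
  obtain ⟨n, b, hb, hu⟩ := h J
  obtain ⟨⟨r, s⟩, hrs, -⟩ := hu x hx
  have hb0 : ∀ r, b r ≠ 0 := fun r => TSheaf.ne_of_act_ne (hb r 0)
  have res_ne : ∀ (r : Fin n) (s : S J), F.res (torus_le J) (F.act s (b r)) ≠ 0 := fun r s h0 => by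
    obtain ⟨u, -, hu⟩ := (TSheaf.res_eq_zero_iff _ _).1 h0
    rw [← F.add_act] at hu
    exact hb r _ hu
  refine ⟨b r, hb0 r, fun y hy => ?_⟩
  obtain ⟨t, ht⟩ := hy
  have hy0 : y ≠ 0 := by
    refine TSheaf.ne_of_res_ne (h := torus_le J) ?_
    rw [← ht, ← hrs]
    exact TSheaf.act_unit_ne (mem_S_torus _) (res_ne r s)
  obtain ⟨⟨r', s'⟩, hrs', -⟩ := hu y hy0
  -- The character `t` lives only on the torus. After adding `u`, the relation between the two
  -- sections takes place in the stalk, where uniqueness of the expansion gives `r = r'`.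
  obtain ⟨u, hu', hut⟩ := exists_unit_add (torus_le J) t.2
  have e : F.act (⟨_, hut⟩ + s) (b r) = F.act (u + s') (b r') := by
    refine TSheaf.res_cancel (torus_le J) ?_ (res_ne _ _)
    rw [F.add_act, F.add_act, hrs, hrs', F.res_act, F.res_act, ← ht, ← F.add_act]
    rfl
  have e' := (hu _ (hb r (⟨_, hut⟩ + s))).unique (y₁ := (r, _)) (y₂ := (r', _)) rfl e.symm
  have e'' : r = r' := congrArg Prod.fst e'
  subst e''
  exact ⟨s', hrs'.symm⟩

/-- One generator per orbit gives a basis: there are finitely many orbits by finite generation, and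
the expansions are unique by `TSheaf.act_free`. -/
theorem HasLeast.isLocallyFree {F : TSheaf} (hF : IsTorsionFree F) (h : HasLeast F) :
    IsLocallyFree F := by
  classical
  intro J
  obtain ⟨G, hG⟩ := F.exists_gens J
  let orb : F.M J → Set (F.M J) := fun x => {y | SameOrbit F x y}
  have orb_eq : ∀ {x y}, SameOrbit F x y → orb x = orb y := fun hxy =>
    Set.ext fun z => ⟨fun hz => hxy.symm.trans hz, fun hz => hxy.trans hz⟩
  have hfin : (orb '' {x | x ≠ 0}).Finite := by
    refine (G.finite_toSet.image orb).subset ?_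
    rintro _ ⟨x, hx, rfl⟩
    obtain ⟨g, hg, s, rfl⟩ := hG x hx
    exact ⟨g, hg, orb_eq (SameOrbit.act_right g s)⟩
  have : Finite (orb '' {x | x ≠ 0}) := hfin
  obtain ⟨n, ⟨e⟩⟩ := Finite.exists_equiv_fin (orb '' {x | x ≠ 0})
  choose x hx hxo using fun r : Fin n => (e.symm r).2
  choose b hb hl using fun r => h J (x r) (hx r)
  have hbo : ∀ r, orb (b r) = (e.symm r).1 := fun r => by
    rw [← hxo r]
    obtain ⟨s, hs⟩ := hl r (x r) (SameOrbit.refl _)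
    refine orb_eq ?_
    conv_rhs => rw [hs]
    exact SameOrbit.act_right _ s
  refine ⟨n, b, fun r s => hF J _ (hb r) s, fun y hy => ?_⟩
  have hr : ∀ r s, F.act s (b r) = y → r = e ⟨orb y, y, hy, rfl⟩ := by
    rintro r s rfl
    rw [← Equiv.symm_apply_eq]
    refine Subtype.ext ?_
    rw [← hbo r]
    exact orb_eq (SameOrbit.act_right _ s)
  have hy' : SameOrbit F (x (e ⟨orb y, y, hy, rfl⟩)) y := by
    have h1 := hxo (e ⟨orb y, y, hy, rfl⟩)
    rw [Equiv.symm_apply_apply] at h1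
    have h2 : y ∈ orb y := SameOrbit.refl y
    have h3 : orb (x (e ⟨orb y, y, hy, rfl⟩)) = orb y := h1
    rw [← h3] at h2
    exact h2
  obtain ⟨s, hs⟩ := hl _ y hy'
  refine ⟨(_, s), hs.symm, ?_⟩
  rintro ⟨r', s'⟩ h'
  have := hr _ _ h'
  subst this
  refine Prod.ext rfl (TSheaf.act_free (h'.trans hs) ?_)
  exact hF J _ (hb _) _

theorem isLocallyFree_iff {F : TSheaf} (hF : IsTorsionFree F) : IsLocallyFree F ↔ HasLeast F :=
  ⟨IsLocallyFree.hasLeast, HasLeast.isLocallyFree hF⟩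

/- ## Direct sums -/

/-- The direct sum of two `T`-sheaves. -/
def wedge (X Y : TSheaf) : TSheaf where
  M J := {p : X.M J × Y.M J // p.1 = 0 ∨ p.2 = 0}
  pointed J := ⟨⟨0, Or.inl rfl⟩⟩
  act s p := ⟨(X.act s p.1.1, Y.act s p.1.2), p.2.imp (fun h => by rw [h, X.act_zero])
    (fun h => by rw [h, Y.act_zero])⟩
  zero_act p := Subtype.ext (Prod.ext (X.zero_act _) (Y.zero_act _))
  add_act s t p := Subtype.ext (Prod.ext (X.add_act _ _ _) (Y.add_act _ _ _))
  act_zero s := Subtype.ext (Prod.ext (X.act_zero _) (Y.act_zero _))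
  res h p := ⟨(X.res h p.1.1, Y.res h p.1.2), p.2.imp (fun h => by rw [h, X.res_zero])
    (fun h => by rw [h, Y.res_zero])⟩
  res_self p := Subtype.ext (Prod.ext (X.res_self _) (Y.res_self _))
  res_res h h' p := Subtype.ext (Prod.ext (X.res_res _ _ _) (Y.res_res _ _ _))
  res_zero h := Subtype.ext (Prod.ext (X.res_zero _) (Y.res_zero _))
  res_act h s p := Subtype.ext (Prod.ext (X.res_act _ _ _) (Y.res_act _ _ _))
  res_surj h p := by
    obtain ⟨⟨x, y⟩, h0 | h0⟩ := p
    · obtain rfl : x = 0 := h0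
      obtain ⟨s, hs, z, hz⟩ := Y.res_surj h y
      exact ⟨s, hs, ⟨(0, z), Or.inl rfl⟩,
        Subtype.ext (Prod.ext ((X.act_zero _).trans (X.res_zero h).symm) hz)⟩
    · obtain rfl : y = 0 := h0
      obtain ⟨s, hs, z, hz⟩ := X.res_surj h x
      exact ⟨s, hs, ⟨(z, 0), Or.inr rfl⟩,
        Subtype.ext (Prod.ext hz ((Y.act_zero _).trans (Y.res_zero h).symm))⟩
  res_inj h p q e := by
    have e1 := congrArg (fun r => r.1.1) e
    have e2 := congrArg (fun r => r.1.2) e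
    obtain ⟨s, hs, h1⟩ := X.res_inj h _ _ e1
    obtain ⟨t, ht, h2⟩ := Y.res_inj h _ _ e2
    refine ⟨t + s, ?_, Subtype.ext (Prod.ext ?_ ?_)⟩
    · have := add_mem ht hs
      convert this using 1
      simp; abel
    · change X.act _ _ = X.act _ _
      rw [X.add_act, X.add_act, h1]
    · change Y.act _ _ = Y.act _ _
      rw [add_comm, Y.add_act, Y.add_act, h2]
  fg l := by
    classical
    obtain ⟨A, hA⟩ := X.fg l
    obtain ⟨B, hB⟩ := Y.fg l
    refine ⟨A.image (fun x => ⟨(x, 0), Or.inr rfl⟩) ∪ B.image fun y => ⟨(0, y), Or.inl rfl⟩, ?_⟩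
    rintro ⟨⟨x, y⟩, h0 | h0⟩ hp
    · obtain rfl : x = 0 := h0
      obtain ⟨g, hg, s, rfl⟩ := hB y fun h0 => hp (Subtype.ext (Prod.ext rfl h0))
      exact ⟨_, Finset.mem_union_right _ (Finset.mem_image_of_mem _ hg), s,
        Subtype.ext (Prod.ext (X.act_zero _).symm rfl)⟩
    · obtain rfl : y = 0 := h0
      obtain ⟨g, hg, s, rfl⟩ := hA x fun h0 => hp (Subtype.ext (Prod.ext h0 rfl))
      exact ⟨_, Finset.mem_union_left _ (Finset.mem_image_of_mem _ hg), s,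
        Subtype.ext (Prod.ext rfl (Y.act_zero _).symm)⟩
  alpha s p q e := by
    have e1 : X.act s p.1.1 = X.act s q.1.1 := congrArg (fun r => r.1.1) e
    have e2 : Y.act s p.1.2 = Y.act s q.1.2 := congrArg (fun r => r.1.2) e
    by_cases h1 : X.act s p.1.1 = 0
    · by_cases h2 : Y.act s p.1.2 = 0
      · exact Or.inr (Subtype.ext (Prod.ext h1 h2))
      · have h3 := TSheaf.act_cancel_of_ne e2 h2
        have h4 := p.2.resolve_right (TSheaf.ne_of_act_ne h2)
        have h5 := q.2.resolve_right (TSheaf.ne_of_act_ne (e2 ▸ h2))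
        exact Or.inl (Subtype.ext (Prod.ext (h4.trans h5.symm) h3))
    · have h3 := TSheaf.act_cancel_of_ne e1 h1
      have h4 := p.2.resolve_left (TSheaf.ne_of_act_ne h1)
      have h5 := q.2.resolve_left (TSheaf.ne_of_act_ne (e1 ▸ h1))
      exact Or.inl (Subtype.ext (Prod.ext h3 (h4.trans h5.symm)))
  graded l := by
    classical
    obtain ⟨deg, hd⟩ := X.graded l
    obtain ⟨deg', hd'⟩ := Y.graded l
    refine ⟨fun p => if p.1.1 = 0 then deg' p.1.2 else deg p.1.1, ?_⟩
    rintro s ⟨⟨x, y⟩, h0 | h0⟩ hp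
    · obtain rfl : x = 0 := h0
      have h1 : Y.act s y ≠ 0 := fun h0 => hp (Subtype.ext (Prod.ext (X.act_zero s) h0))
      simp [X.act_zero, hd' s y h1]
    · obtain rfl : y = 0 := h0
      have h1 : X.act s x ≠ 0 := fun h0 => hp (Subtype.ext (Prod.ext h0 (Y.act_zero s)))
      simp [h1, TSheaf.ne_of_act_ne h1, hd s x h1]

section Wedge

variable (X Y : TSheaf)

/-- The inclusion of the first summand. -/
def inl : Hom X (wedge X Y) where
  app _ x := ⟨(x, 0), Or.inr rfl⟩
  map_zero _ := rfl
  map_act s _ := Subtype.ext (Prod.ext rfl (Y.act_zero s).symm)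
  map_res h _ := Subtype.ext (Prod.ext rfl (Y.res_zero h).symm)
  alpha _ _ e := Or.inl (congrArg (fun r => r.1.1) e)

/-- The inclusion of the second summand. -/
def inr : Hom Y (wedge X Y) where
  app _ y := ⟨(0, y), Or.inl rfl⟩
  map_zero _ := rfl
  map_act s _ := Subtype.ext (Prod.ext (X.act_zero s).symm rfl)
  map_res h _ := Subtype.ext (Prod.ext (X.res_zero h).symm rfl)
  alpha _ _ e := Or.inl (congrArg (fun r => r.1.2) e)

/-- The projection to the first summand. -/
def fst : Hom (wedge X Y) X where
  app _ p := p.1.1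
  map_zero _ := rfl
  map_act _ _ := rfl
  map_res _ _ := rfl
  alpha p q e := by
    by_cases h : p.1.1 = 0
    · exact Or.inr h
    · exact Or.inl (Subtype.ext (Prod.ext e ((p.2.resolve_left h).trans
        (q.2.resolve_left (e ▸ h)).symm)))

variable {X Y}

theorem inj_inl : (inl X Y).Inj := fun _ _ _ e => congrArg (fun r => r.1.1) e

theorem inj_inr : (inr X Y).Inj := fun _ _ _ e => congrArg (fun r => r.1.2) e

theorem isExact_wedge : IsExact (inr X Y) (fst X Y) where
  inj := inj_inr
  surj _ x := ⟨(inl X Y).app _ x, rfl⟩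
  ker {_ z} hz := ⟨z.1.2, Subtype.ext (Prod.ext hz.symm rfl)⟩
  comp _ := rfl

theorem wedge_cases {J : Cone} (p : (wedge X Y).M J) :
    (∃ x, p = (inl X Y).app J x) ∨ ∃ y, p = (inr X Y).app J y :=
  p.2.symm.imp (fun h => ⟨p.1.1, Subtype.ext (Prod.ext rfl h)⟩)
    fun h => ⟨p.1.2, Subtype.ext (Prod.ext h rfl)⟩

theorem isDecomp_wedge : IsDecomp (wedge X Y) (fun J => Set.range ((inl X Y).app J))
    (fun J => Set.range ((inr X Y).app J)) where
  left := ⟨fun s x ⟨y, hy⟩ => ⟨_, hy ▸ (inl X Y).map_act s y⟩,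
    fun h x ⟨y, hy⟩ => ⟨_, hy ▸ (inl X Y).map_res h y⟩⟩
  right := ⟨fun s x ⟨y, hy⟩ => ⟨_, hy ▸ (inr X Y).map_act s y⟩,
    fun h x ⟨y, hy⟩ => ⟨_, hy ▸ (inr X Y).map_res h y⟩⟩
  union _ := Set.eq_univ_of_forall fun p =>
    (wedge_cases p).imp (fun ⟨x, hx⟩ => ⟨x, hx.symm⟩) fun ⟨x, hx⟩ => ⟨x, hx.symm⟩
  inter J := by
    refine Set.eq_singleton_iff_unique_mem.2 ⟨⟨⟨0, rfl⟩, ⟨0, rfl⟩⟩, ?_⟩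
    rintro _ ⟨⟨x, rfl⟩, ⟨y, hy⟩⟩
    have : (0 : X.M J) = x := congrArg (fun r => r.1.1) hy
    rw [← this]; rfl

/-- A split extension is isomorphic to the direct sum. -/
theorem nonempty_iso_wedge {Z : TSheaf} {N : ∀ J, Set (Z.M J)} (h : N ∈ subobjects X Y Z)
    (hN : IsClosedFamily Z (compl N)) : Nonempty (Z ≅ wedge X Y) := by
  obtain ⟨i, p, hip, hi⟩ := mem_subobjects.1 h
  obtain ⟨i', p', hip', hi'⟩ := mem_subobjects.1 (compl_mem_subobjects h hN)
  have hmem : ∀ {J} {z : Z.M J}, z ∈ N J ↔ p.app J z = 0 := mem_iff_of_isExact hip hi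
  have hmem' : ∀ {J} {z : Z.M J}, z ∈ compl N J ↔ p'.app J z = 0 := mem_iff_of_isExact hip' hi'
  have hcase : ∀ {J} (z : Z.M J), p.app J z = 0 ∨ p'.app J z = 0 := by
    intro J z
    by_cases hz : z ∈ N J
    · exact Or.inl (hmem.1 hz)
    · exact Or.inr (hmem'.1 fun h => absurd h hz)
  have hzero : ∀ {J} {z : Z.M J}, p.app J z = 0 → p'.app J z = 0 → z = 0 :=
    fun h1 h2 => hmem'.2 h2 (hmem.2 h1)
  have key : ∀ {J} (z w : Z.M J), p.app J z = p.app J w → p'.app J z = p'.app J w → z = w := by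
    intro J z w h1 h2
    rcases p.alpha _ _ h1 with h3 | h3
    · exact h3
    rcases p'.alpha _ _ h2 with h4 | h4
    · exact h4
    · rw [hzero h3 h4, hzero (h1.symm.trans h3) (h2.symm.trans h4)]
  let f : Hom Z (wedge X Y) :=
    { app := fun J z => ⟨(p.app J z, p'.app J z), hcase z⟩
      map_zero := fun J => Subtype.ext (Prod.ext (p.map_zero J) (p'.map_zero J))
      map_act := fun s z => Subtype.ext (Prod.ext (p.map_act s z) (p'.map_act s z))
      map_res := fun h z => Subtype.ext (Prod.ext (p.map_res h z) (p'.map_res h z))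
      alpha := fun z w e => Or.inl (key z w (congrArg (fun r => r.1.1) e)
        (congrArg (fun r => r.1.2) e)) }
  refine Hom.nonempty_iso_of_bijective f (fun J z w e => key z w (congrArg (fun r => r.1.1) e)
        (congrArg (fun r => r.1.2) e)) fun J q => ?_
  rcases wedge_cases q with ⟨x, rfl⟩ | ⟨y, rfl⟩
  · obtain ⟨z, rfl⟩ := hip.surj J x
    rcases hcase z with h1 | h1
    · exact ⟨0, Subtype.ext (Prod.ext ((p.map_zero J).trans h1.symm) (p'.map_zero J))⟩
    · exact ⟨z, Subtype.ext (Prod.ext rfl h1)⟩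
  · obtain ⟨z, rfl⟩ := hip'.surj J y
    rcases hcase z with h1 | h1
    · exact ⟨z, Subtype.ext (Prod.ext h1 rfl)⟩
    · exact ⟨0, Subtype.ext (Prod.ext (p.map_zero J) ((p'.map_zero J).trans h1.symm))⟩

theorem isTorsionFree_wedge (hX : IsTorsionFree X) (hY : IsTorsionFree Y) :
    IsTorsionFree (wedge X Y) := isExact_wedge.isTorsionFree hX hY

theorem IsTorsionFree.wedge_left (h : IsTorsionFree (wedge X Y)) : IsTorsionFree X :=
  h.of_inj inj_inl

theorem IsTorsionFree.wedge_right (h : IsTorsionFree (wedge X Y)) : IsTorsionFree Y :=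
  h.of_inj inj_inr

/-- The generator of an orbit meeting the summand has a non-zero multiple in the summand, so by `hc`
it lies there itself. -/
theorem hasLeast_of_summand {F Z : TSheaf} {f : Hom F Z} (hf : f.Inj)
    (hc : ∀ J (s : S J) z, F.M J → Z.act s z ≠ 0 → Z.act s z ∈ Set.range (f.app J) →
      z ∈ Set.range (f.app J)) (h : HasLeast Z) : HasLeast F := by
  intro J x hx
  obtain ⟨b, hb, hl⟩ := h J _ (hf.app_ne hx)
  obtain ⟨s, hs⟩ := hl _ (SameOrbit.refl _)
  obtain ⟨b', rfl⟩ := hc J s b x (hs ▸ hf.app_ne hx) (hs ▸ ⟨x, rfl⟩)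
  refine ⟨b', f.ne_of_app_ne hb, fun y hy => ?_⟩
  obtain ⟨t, ht⟩ := hl _ (hy.map f)
  exact ⟨t, hf J (by rw [ht, f.map_act])⟩

/-- In a torsion-free direct sum no generic orbit meets both summands, so generators can be sought
in each summand separately. -/
theorem hasLeast_wedge_iff (hX : IsTorsionFree X) (hY : IsTorsionFree Y) :
    HasLeast (wedge X Y) ↔ HasLeast X ∧ HasLeast Y := by
  refine ⟨fun h => ⟨hasLeast_of_summand inj_inl ?_ h, hasLeast_of_summand inj_inr ?_ h⟩, ?_⟩
  · rintro J s z - h0 ⟨x, hx⟩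
    rcases wedge_cases z with ⟨y, rfl⟩ | ⟨y, rfl⟩
    · exact ⟨y, rfl⟩
    · exact absurd (isDecomp_wedge.eq_zero ⟨x, hx⟩ ⟨_, (inr X Y).map_act s y⟩) h0
  · rintro J s z - h0 ⟨x, hx⟩
    rcases wedge_cases z with ⟨y, rfl⟩ | ⟨y, rfl⟩
    · exact absurd (isDecomp_wedge.eq_zero ⟨_, (inl X Y).map_act s y⟩ ⟨x, hx⟩) h0
    · exact ⟨y, rfl⟩
  · rintro ⟨h1, h2⟩ J z hz
    have disj : ∀ {x y}, SameOrbit (wedge X Y) ((inl X Y).app J x) ((inr X Y).app J y) →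
        (inl X Y).app J x = 0 := by
      rintro x y ⟨t, ht⟩
      by_contra hx
      refine isTorsionFree_wedge hX hY torus _
        (res_ne_zero_of_torsionFree (isTorsionFree_wedge hX hY) (torus_le J) hx) t ?_
      refine isDecomp_wedge.eq_zero ⟨X.act t (X.res (torus_le J) x), ?_⟩
        ⟨Y.res (torus_le J) y, ?_⟩
      · rw [(inl X Y).map_act, (inl X Y).map_res]
      · rw [ht, (inr X Y).map_res]
    rcases wedge_cases z with ⟨x, rfl⟩ | ⟨x, rfl⟩
    · obtain ⟨b, hb, hl⟩ := h1 J x ((inl X Y).ne_of_app_ne hz)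
      refine ⟨_, inj_inl.app_ne hb, fun w hw => ?_⟩
      rcases wedge_cases w with ⟨y, rfl⟩ | ⟨y, rfl⟩
      · obtain ⟨s, rfl⟩ := hl y (hw.of_map inj_inl)
        exact ⟨s, (inl X Y).map_act s b⟩
      · exact absurd (disj hw) hz
    · obtain ⟨b, hb, hl⟩ := h2 J x ((inr X Y).ne_of_app_ne hz)
      refine ⟨_, inj_inr.app_ne hb, fun w hw => ?_⟩
      rcases wedge_cases w with ⟨y, rfl⟩ | ⟨y, rfl⟩
      · exact absurd (disj hw.symm) (hw.ne_zero (isTorsionFree_wedge hX hY) hz)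
      · obtain ⟨s, rfl⟩ := hl y (hw.of_map inj_inr)
        exact ⟨s, (inr X Y).map_act s b⟩

theorem ncard_subobjects_wedge_ne_zero : (subobjects X Y (wedge X Y)).ncard ≠ 0 :=
  Set.ncard_ne_zero_of_mem (mem_subobjects.2 ⟨_, _, isExact_wedge, fun _ => rfl⟩)
    (finite_subobjects _ _ _)

/-- Every extension with torsion-free quotient `X` splits, so the direct sum is the only class that
occurs. -/
theorem δ_mul_δ {k : Type*} [CommRing k] {h : HallWellDefined} (hX : IsTorsionFree X) :
    δ k h X * δ k h Y = ((subobjects X Y (wedge X Y)).ncard : k) • δ k h (wedge X Y) := by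
  refine hallAlg_ext fun c => ?_
  rw [coeff_mul, map_smul, coeff_δ, ← cls_out c]
  by_cases hc : cls c.out = cls (wedge X Y)
  · rw [hc, hallNumber_cls, Set.indicator_of_mem (Set.mem_singleton _), Pi.one_apply, smul_eq_mul,
      mul_one]
  · rw [Set.indicator_of_notMem (mt Set.mem_singleton_iff.1 hc), smul_zero, hallNumber_cls]
    rw [Set.eq_empty_of_forall_notMem (s := subobjects X Y c.out), Set.ncard_empty, Nat.cast_zero]
    intro N hN
    exact hc (cls_eq_iff.2 (nonempty_iso_wedge hN (isClosedFamily_compl_of_torsionFree hX hN)))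

end Wedge

/- ## Locally free sheaves are direct sums of line bundles -/

theorem O_act_mono {n : ℤ} {J : Cone} {a : Fin 3 → ℤ} (ha : Shape ∅ n J a) (s : S J) :
    (O n).act s (mono ∅ n J a) = mono ∅ n J (a + pairing s) := by
  rw [mono_pos ha]; rfl

theorem O_res_mono {n : ℤ} {J K : Cone} (h : K ≤ J) {a : Fin 3 → ℤ} (ha : Shape ∅ n J a) :
    (O n).res h (mono ∅ n J a) = mono ∅ n K a := by
  rw [mono_pos ha]; rfl

theorem shape_empty_iff {n : ℤ} {J : Cone} {a : Fin 3 → ℤ} :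
    Shape ∅ n J a ↔ a 0 + a 1 + a 2 = n ∧ ∀ j ∈ J.1, 0 ≤ a j := by
  simp [Shape]

theorem sum_add_pairing (a : Fin 3 → ℤ) (e : ℤ × ℤ) :
    (a + pairing e) 0 + (a + pairing e) 1 + (a + pairing e) 2 = a 0 + a 1 + a 2 := by
  have := pairing_sum e
  simp only [Pi.add_apply]
  omega

/-- Rank one: after the choice of `z` every non-zero section has a position in ℤ². By `HasLeast` the
positions over `J` are those with exponent at least `c j` at each `j` in `J`, and translating by `c`
turns them into the monomials of degree `-(c 0 + c 1 + c 2)`. -/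
theorem nonempty_iso_O {F : TSheaf} (hF : IsTorsionFree F) (hL : HasLeast F) {z : F.M torus}
    (hz : z ≠ 0) (hone : ∀ y : F.M torus, y ≠ 0 → ∃ t, F.act t z = y) :
    ∃ n, Nonempty (F ≅ O n) := by
  let T : ℤ × ℤ → S torus := fun t => ⟨t, mem_S_torus t⟩
  have hT : ∀ s t, T (s + t) = T s + T t := fun s t => rfl
  have pos_unique : ∀ {t t' : ℤ × ℤ}, F.act (T t) z = F.act (T t') z → t = t' := fun h =>
    congrArg Subtype.val (TSheaf.act_free h (hF _ _ hz _))
  have least : ∀ J, ∃ (b : F.M J) (τ : ℤ × ℤ), F.act (T τ) z = F.res (torus_le J) b ∧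
      ∀ y : F.M J, y ≠ 0 → ∃ s, y = F.act s b := by
    intro J
    obtain ⟨u, -, x, hx⟩ := F.res_surj (torus_le J) z
    have hx0 : x ≠ 0 := TSheaf.ne_of_res_ne (h := torus_le J) (by rw [← hx]; exact hF _ _ hz _)
    obtain ⟨b, hb, hl⟩ := hL J x hx0
    obtain ⟨τ, hτ⟩ := hone _ (res_ne_zero_of_torsionFree hF (torus_le J) hb)
    refine ⟨b, τ, hτ, fun y hy => hl y ?_⟩
    obtain ⟨t, ht⟩ := hone _ (res_ne_zero_of_torsionFree hF (torus_le J) hy)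
    have h1 : SameOrbit F z x := ⟨faceIncl (torus_le J) u, by rw [F.res_self, hx]⟩
    have h2 : SameOrbit F z y := ⟨t, by rw [F.res_self, ht]⟩
    exact h1.symm.trans h2
  choose b τ hτ hb using least
  have pos_act : ∀ {J} (s : S J) {x : F.M J} {t}, F.act (T t) z = F.res (torus_le J) x →
      F.act (T (s + t)) z = F.res (torus_le J) (F.act s x) := by
    intro J s x t h
    rw [hT, F.add_act, h, F.res_act]
    rfl
  have pos_res : ∀ {J K} (h : K ≤ J) {x : F.M J} {t}, F.act (T t) z = F.res (torus_le J) x →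
      F.act (T t) z = F.res (torus_le K) (F.res h x) := by
    intro J K h x t e
    rw [e, F.res_res]
  have pos_ne : ∀ {J} {x : F.M J} {t}, F.act (T t) z = F.res (torus_le J) x → x ≠ 0 :=
    fun e => TSheaf.ne_of_res_ne (by rw [← e]; exact hF _ _ hz _)
  have pos_ge : ∀ {J} {x : F.M J} {t}, F.act (T t) z = F.res (torus_le J) x → ∀ j ∈ J.1,
      pairing (τ J) j ≤ pairing t j := by
    intro J x t e j hj
    obtain ⟨s, rfl⟩ := hb J x (pos_ne e)
    rw [pos_unique (e.trans (pos_act s (hτ J)).symm), pairing_add, Pi.add_apply]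
    have := s.2 j hj
    omega
  let c : Fin 3 → ℤ := fun j => pairing (τ (ray j)) j
  -- Localizing at the ray `j` does not change the minimal exponent there: the generator over the
  -- ray extends to `J` after multiplication by a unit, which has exponent zero at `j`.
  have hc : ∀ J, ∀ j ∈ J.1, pairing (τ J) j = c j := by
    intro J j hj
    refine le_antisymm ?_ (pos_ge (pos_res (ray_le hj) (hτ J)) j (Finset.mem_singleton_self j))
    obtain ⟨u, hu, x, hx⟩ := F.res_surj (ray_le hj) (b (ray j))
    have e1 := pos_act (faceIncl (ray_le hj) u) (hτ (ray j))
    rw [hx, F.res_res] at e1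
    have h1 := pos_ge e1 j hj
    have h2 := pairing_eq_zero_of_unit (J := ray j) (S_anti (ray_le hj) u.2) hu
      (Finset.mem_singleton_self j)
    rw [pairing_add, Pi.add_apply] at h1
    change _ ≤ pairing (u : ℤ × ℤ) j + c j at h1
    omega
  set n : ℤ := -(c 0 + c 1 + c 2) with hn
  have shape : ∀ {J} {x : F.M J} {t}, F.act (T t) z = F.res (torus_le J) x →
      Shape ∅ n J (pairing t - c) := by
    intro J x t e
    refine shape_empty_iff.2 ⟨?_, fun j hj => ?_⟩
    · have := pairing_sum t
      simp only [Pi.sub_apply]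
      omega
    · have := pos_ge e j hj
      rw [hc J j hj] at this
      simp only [Pi.sub_apply]
      omega
  obtain ⟨f, hf⟩ := Hom.exists_of_rel (F := F) (G := O n)
    (fun J x y => (x = 0 ∧ y = 0) ∨ ∃ t, F.act (T t) z = F.res (torus_le J) x ∧
      y = mono ∅ n J (pairing t - c))
    (fun J x => by
      by_cases hx : x = 0
      · exact ⟨0, Or.inl ⟨hx, rfl⟩⟩
      · obtain ⟨t, ht⟩ := hone _ (res_ne_zero_of_torsionFree hF (torus_le J) hx)
        exact ⟨_, Or.inr ⟨t, ht, rfl⟩⟩)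
    (by
      rintro J x y y' (⟨rfl, rfl⟩ | ⟨t, ht, rfl⟩) (⟨h, rfl⟩ | ⟨t', ht', rfl⟩)
      · rfl
      · exact absurd rfl (pos_ne ht')
      · exact absurd h (pos_ne ht)
      · rw [pos_unique (ht.trans ht'.symm)])
    (fun J => Or.inl ⟨rfl, rfl⟩)
    (by
      rintro J s x y (⟨rfl, rfl⟩ | ⟨t, ht, rfl⟩)
      · exact Or.inl ⟨F.act_zero s, (O n).act_zero s⟩
      · refine Or.inr ⟨s + t, pos_act s ht, ?_⟩
        rw [O_act_mono (shape ht), pairing_add]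
        congr 1
        abel)
    (by
      rintro J K h x y (⟨rfl, rfl⟩ | ⟨t, ht, rfl⟩)
      · exact Or.inl ⟨F.res_zero h, (O n).res_zero h⟩
      · exact Or.inr ⟨t, pos_res h ht, O_res_mono h (shape ht)⟩)
    (by
      rintro J x x' y (⟨rfl, rfl⟩ | ⟨t, ht, rfl⟩) h
      · exact Or.inr rfl
      rcases h with ⟨-, h⟩ | ⟨t', ht', e⟩
      · exact Or.inr h
      · refine Or.inl (TSheaf.res_cancel (torus_le J) ?_ ?_)
        · have := sub_left_injective (mono_inj e (shape ht))
          rw [← ht, ← ht', pairing_injective this]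
        · rw [← ht]; exact hF _ _ hz _)
  refine ⟨n, Hom.nonempty_iso_of_bijective f (fun J x x' e => ?_) fun J y => ?_⟩
  · have h1 := (hf J x _).2 rfl
    have h2 := (hf J x' _).2 e.symm
    have some_ne : ∀ {x : F.M J} {t}, F.act (T t) z = F.res (torus_le J) x →
        mono ∅ n J (pairing t - c) ≠ none := fun ht => by
      rw [mono_pos (shape ht)]; exact Option.some_ne_none _
    rcases h1 with ⟨rfl, h1⟩ | ⟨t, ht, h1⟩ <;> rcases h2 with ⟨rfl, h2⟩ | ⟨t', ht', h2⟩
    · rfl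
    · exact absurd (h2.symm.trans h1) (some_ne ht')
    · exact absurd (h1.symm.trans h2) (some_ne ht)
    · refine TSheaf.res_cancel (torus_le J) ?_ (by rw [← ht]; exact hF _ _ hz _)
      have := sub_left_injective (mono_inj (h1.symm.trans h2) (shape ht))
      rw [← ht, ← ht', pairing_injective this]
  · rcases y with _ | ⟨a, ha⟩
    · exact ⟨0, f.map_zero J⟩
    obtain ⟨ha1, ha2⟩ := shape_empty_iff.1 ha
    obtain ⟨t, ht⟩ := exists_pairing (v := a + c) (by simp only [Pi.add_apply]; omega)
    have hs : t - τ J ∈ S J := fun j hj => by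
      have := ha2 j hj
      rw [pairing_sub, Pi.sub_apply, hc J j hj, ht, Pi.add_apply]
      omega
    refine ⟨F.act ⟨_, hs⟩ (b J), (hf J _ _).1 (Or.inr ⟨t, ?_, ?_⟩)⟩
    · rw [← pos_act ⟨_, hs⟩ (hτ J)]
      congr 2
      simp
    · rw [ht, add_sub_cancel_right, mono_pos ha]

/-- The direct sum of the line bundles with the given degrees. -/
noncomputable def sumO : List ℤ → TSheaf
  | [] => zeroSheaf
  | n :: s => wedge (O n) (sumO s)

theorem isTorsionFree_sumO : ∀ s, IsTorsionFree (sumO s)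
  | [] => isTorsionFree_zeroSheaf
  | n :: s => isTorsionFree_wedge (isTorsionFree_O n) (isTorsionFree_sumO s)

/-- A generic orbit is a coherent subsheaf, because lifting a section over a face up to a unit does
not leave its orbit. -/
theorem isSub_orbit {F : TSheaf} {K : Cone} (z : F.M K) :
    IsSub F fun J => {x : F.M J | x = 0 ∨ SameOrbit F z x} := by
  refine ⟨fun J => Or.inl rfl, fun {J} s x hx => ?_, fun {J L} h x hx => ?_,
    fun {J L} h y hy => ?_⟩
  · exact hx.imp (fun h => by rw [h, F.act_zero]) fun h => h.trans (SameOrbit.act_right x s)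
  · exact hx.imp (fun e => by rw [e, F.res_zero]) fun h' => h'.trans (SameOrbit.res_right x h)
  · rcases hy with rfl | hy
    · exact ⟨0, by simp, 0, Or.inl rfl, by rw [F.act_zero, F.res_zero]⟩
    · obtain ⟨u, hu, x, hx⟩ := F.res_surj h y
      refine ⟨u, hu, x, Or.inr ?_, hx⟩
      have h1 := SameOrbit.act_right y (faceIncl h u)
      rw [hx] at h1
      exact hy.trans (h1.trans (SameOrbit.res_right x h).symm)

theorem IsSub.isClosedFamily {F : TSheaf} {N : ∀ J, Set (F.M J)} (h : IsSub F N) :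
    IsClosedFamily F N := ⟨h.act, h.res⟩

/-- Induction on the number of generators of the generic stalk. The orbit of a generator and its
complement are both closed, so the orbit splits off, and it is a line bundle by `nonempty_iso_O`. -/
theorem nonempty_iso_sumO {F : TSheaf} (hF : IsTorsionFree F) (hL : HasLeast F) :
    ∃ s, Nonempty (F ≅ sumO s) := by
  classical
  have main : ∀ (m : ℕ) (F : TSheaf), IsTorsionFree F → HasLeast F → ∀ G : Finset (F.M torus),
      (∀ x, x ≠ 0 → ∃ g ∈ G, ∃ s, x = F.act s g) → G.card ≤ m → ∃ s, Nonempty (F ≅ sumO s) := by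
    intro m
    induction m with
    | zero =>
      intro F hF _ G hG hm
      have hzero : ∀ J (x : F.M J), x = 0 := by
        intro J x
        by_contra hx
        obtain ⟨g, hg, -⟩ := hG _ (res_ne_zero_of_torsionFree hF (torus_le J) hx)
        rw [Finset.card_eq_zero.1 (Nat.le_zero.1 hm)] at hg
        simp at hg
      exact ⟨[], Hom.nonempty_iso_of_bijective (toZero F)
        (fun J x y _ => (hzero J x).trans (hzero J y).symm) fun J x => ⟨0, rfl⟩⟩
    | succ m ih =>
      intro F hF hL G hG hm
      by_cases hne : ∃ g ∈ G, g ≠ 0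
      swap
      · push Not at hne
        refine ih F hF hL ∅ (fun x hx => ?_) (by simp)
        obtain ⟨g, hg, s, rfl⟩ := hG x hx
        exact absurd (hne g hg) (TSheaf.ne_of_act_ne hx)
      obtain ⟨z, hzG, hz⟩ := hne
      have hN := isSub_orbit z
      have hex := hN.isExact
      have hNsub := mem_subobjects.2 ⟨_, _, hex, fun _ => rfl⟩
      have hrange : (fun J => Set.range (hN.incl.app J)) =
          fun J => {x : F.M J | x = 0 ∨ SameOrbit F z x} :=
        funext fun J => Subtype.range_coe
      rw [hrange] at hNsub
      have hclosed : IsClosedFamily F (compl fun J => {x : F.M J | x = 0 ∨ SameOrbit F z x}) := by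
        constructor
        · rintro J s x hx (h | h)
          · exact h
          · rw [hx (Or.inr (h.trans (SameOrbit.act_right x s).symm)), F.act_zero]
        · rintro J K hK x hx (h | h)
          · exact h
          · rw [hx (Or.inr (h.trans (SameOrbit.res_right x hK).symm)), F.res_zero]
      have hcompl := compl_mem_subobjects hNsub hclosed
      have hclosed' : IsClosedFamily F
          (compl (compl fun J => {x : F.M J | x = 0 ∨ SameOrbit F z x})) := by
        rw [compl_compl fun J => Or.inl rfl]
        exact hN.isClosedFamily
      obtain ⟨e⟩ := nonempty_iso_wedge hcompl hclosed'
      have hW := hF.of_iso e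
      obtain ⟨hL0, hL'⟩ := (hasLeast_wedge_iff hW.wedge_left hW.wedge_right).1 (hL.of_iso e)
      obtain ⟨n, ⟨e0⟩⟩ := nonempty_iso_O hW.wedge_left hL0 (z := ⟨z, Or.inr (SameOrbit.refl z)⟩)
        (fun h => hz (congrArg Subtype.val h)) (by
          rintro ⟨y, hy⟩ hy0
          obtain ⟨t, ht⟩ := hy.resolve_left fun h => hy0 (Subtype.ext h)
          rw [F.res_self, F.res_self] at ht
          exact ⟨t, Subtype.ext ht⟩)
      -- A generator in the orbit of `z` becomes zero in the quotient, so the images of the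
      -- generators other than `z` suffice.
      obtain ⟨s, ⟨e'⟩⟩ := ih hN.quo hW.wedge_right hL' ((G.erase z).image (hN.proj.app torus)) (by
        intro x hx
        obtain ⟨x, rfl⟩ := hex.surj _ x
        obtain ⟨g, hg, s, rfl⟩ := hG x (hN.proj.ne_of_app_ne hx)
        refine ⟨_, Finset.mem_image_of_mem _ (Finset.mem_erase.2 ⟨?_, hg⟩), s,
          hN.proj.map_act _ _⟩
        rintro rfl
        exact hx (hN.mk_eq_zero_iff.2 (Or.inr (SameOrbit.act_right g s)))) (by
        refine Finset.card_image_le.trans ?_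
        rw [Finset.card_erase_of_mem hzG]
        omega)
      exact ⟨n :: s, nonempty_iso_wedge (subobjects_subset e0 e' hcompl) hclosed'⟩
  obtain ⟨G, hG⟩ := F.exists_gens torus
  exact main _ F hF hL G hG le_rfl

/- ## Multiplicities of line bundles -/

theorem shape_monoGen_torus (m : ℤ) (l : Fin 3) : Shape ∅ m torus (monoGen m l) :=
  shape_empty_iff.2 ⟨by fin_cases l <;> simp [monoGen], by simp [torus]⟩

/-- A morphism of line bundles is the multiplication by a monomial. -/
theorem exists_translation {m n : ℤ} {f : Hom (O m) (O n)} (hf : f.Inj) : ∃ v : Fin 3 → ℤ,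
    ∀ J a, Shape ∅ m J a → Shape ∅ n J (a + v) ∧
      f.app J (mono ∅ m J a) = mono ∅ n J (a + v) := by
  have h0 := shape_monoGen_torus m 0
  have hne : f.app torus (mono ∅ m torus (monoGen m 0)) ≠ 0 :=
    hf.app_ne (by rw [mono_pos h0]; exact Option.some_ne_none _)
  obtain ⟨⟨b, hb⟩, hfb⟩ := Option.ne_none_iff_exists'.1 hne
  -- The generic stalk of `O m` is one orbit, so the image of `X_0^m` fixes the translation vector;
  -- restriction to the torus carries it to all stalks.
  have htorus : ∀ a, Shape ∅ m torus a → f.app torus (mono ∅ m torus a) =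
      mono ∅ n torus (a + (b - monoGen m 0)) := by
    intro a ha
    obtain ⟨e, he⟩ := exists_pairing (v := a - monoGen m 0) (by
      have h1 := ha.1
      have h2 := h0.1
      simp only [Pi.sub_apply]
      omega)
    have h1 := O_act_mono h0 ⟨e, mem_S_torus e⟩
    rw [he, add_sub_cancel] at h1
    refine (congrArg (f.app torus) h1).symm.trans ((f.map_act _ _).trans ?_)
    refine (congrArg _ (hfb.trans (mono_pos hb).symm)).trans ((O_act_mono hb _).trans ?_)
    rw [he]
    congr 1
    abel
  refine ⟨b - monoGen m 0, fun J a ha => ?_⟩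
  have hne' : f.app J (mono ∅ m J a) ≠ 0 :=
    hf.app_ne (by rw [mono_pos ha]; exact Option.some_ne_none _)
  obtain ⟨⟨c, hc⟩, hfc⟩ := Option.ne_none_iff_exists'.1 hne'
  have ha' : Shape ∅ m torus a := shape_empty_iff.2 ⟨ha.1, by simp [torus]⟩
  have h1 := f.map_res (torus_le J) (mono ∅ m J a)
  rw [O_res_mono _ ha, htorus a ha', hfc] at h1
  have h2 : mono ∅ n torus (a + (b - monoGen m 0)) = mono ∅ n torus c :=
    h1.trans ((congrArg _ (mono_pos hc).symm).trans (O_res_mono _ hc))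
  have h3 : c = a + (b - monoGen m 0) :=
    mono_inj h2.symm (shape_empty_iff.2 ⟨hc.1, by simp [torus]⟩)
  subst h3
  exact ⟨hc, hfc.trans (mono_pos hc).symm⟩

theorem shape_monoGen_chart (m : ℤ) (l : Fin 3) : Shape ∅ m (chart l) (monoGen m l) := by
  refine shape_empty_iff.2 ⟨by fin_cases l <;> simp [monoGen], fun j hj => ?_⟩
  rw [monoGen, if_neg (mem_chart.1 hj).symm]

theorem translation_nonneg {m n : ℤ} {v : Fin 3 → ℤ}
    (h : ∀ J a, Shape ∅ m J a → Shape ∅ n J (a + v)) (j : Fin 3) : 0 ≤ v j := by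
  obtain ⟨l, hl⟩ := exists_ne j
  have h1 := (shape_empty_iff.1 (h _ _ (shape_monoGen_chart m l))).2 j (mem_chart.2 hl.symm)
  simpa [monoGen, hl] using h1

theorem translation_sum {m n : ℤ} {v : Fin 3 → ℤ}
    (h : ∀ J a, Shape ∅ m J a → Shape ∅ n J (a + v)) : v 0 + v 1 + v 2 = n - m := by
  have h1 := (h _ _ (shape_monoGen_torus m 0)).1
  have h2 := (shape_monoGen_torus m 0).1
  simp only [Pi.add_apply] at h1
  omega

/-- The translation vector is non-negative, as seen on the charts, and its entries sum to `n - m`.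
-/
theorem le_of_inj {m n : ℤ} {f : Hom (O m) (O n)} (hf : f.Inj) : m ≤ n := by
  obtain ⟨v, hv⟩ := exists_translation hf
  have h0 := translation_nonneg (fun J a ha => (hv J a ha).1)
  have h1 := translation_sum (fun J a ha => (hv J a ha).1)
  have := h0 0
  have := h0 1
  have := h0 2
  omega

theorem eq_of_iso_O {m n : ℤ} (e : O m ≅ O n) : m = n :=
  le_antisymm (le_of_inj (Hom.inj_iso e)) (le_of_inj (Hom.inj_iso e.symm))

theorem O_transitive {n : ℤ} {x y : (O n).M torus} (hx : x ≠ 0) (hy : y ≠ 0) :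
    ∃ s, (O n).act s x = y := by
  obtain ⟨⟨a, ha⟩, rfl⟩ := Option.ne_none_iff_exists'.1 hx
  obtain ⟨⟨b, hb⟩, rfl⟩ := Option.ne_none_iff_exists'.1 hy
  obtain ⟨e, he⟩ := exists_pairing (v := b - a) (by
    have := ha.1
    have := hb.1
    simp only [Pi.sub_apply]
    omega)
  refine ⟨⟨e, mem_S_torus e⟩, ?_⟩
  refine (congrArg _ (mono_pos ha).symm).trans ((O_act_mono ha _).trans ?_)
  rw [he, add_sub_cancel, mono_pos hb]

theorem exists_O_torus_ne (n : ℤ) : ∃ x : (O n).M torus, x ≠ 0 :=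
  ⟨mono ∅ n torus (monoGen n 0), by
    rw [mono_pos (shape_monoGen_torus n 0)]; exact Option.some_ne_none _⟩

theorem isIndecomposable_O (n : ℤ) : IsIndecomposable (O n) := by
  obtain ⟨x, hx⟩ := exists_O_torus_ne n
  exact isIndecomposable_of_transitive hx (fun y hy => O_transitive hx hy) fun J y hy =>
    ⟨torus_le J, res_ne_zero_of_torsionFree (isTorsionFree_O n) _ hy⟩

/-- The direct summands isomorphic to `𝒪(n)`. -/
def lineSummands (F : TSheaf) (n : ℤ) : Set (∀ J, Set (F.M J)) :=
  {N | IsClosedFamily F (compl N) ∧ ∃ f : Hom (O n) F, f.Inj ∧ ∀ J, Set.range (f.app J) = N J}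

theorem finite_lineSummands (F : TSheaf) (n : ℤ) : (lineSummands F n).Finite := by
  refine (Set.finite_range fun f : Hom (O n) F => fun J => Set.range (f.app J)).subset ?_
  rintro N ⟨-, f, -, h⟩
  exact ⟨f, funext h⟩

theorem ncard_lineSummands_le {F G : TSheaf} (e : F ≅ G) (n : ℤ) :
    (lineSummands F n).ncard ≤ (lineSummands G n).ncard := by
  refine Set.ncard_le_ncard_of_injOn (fun N J => Hom.app e.hom J '' N J) ?_ ?_
    (finite_lineSummands _ _)
  · rintro N ⟨hN, f, hf, hr⟩
    refine ⟨?_, Hom.comp (e.hom : Hom F G) f, (Hom.inj_iso e).comp hf, fun J => ?_⟩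
    · have key : ∀ {J} {x : F.M J}, Hom.app e.hom J x ∈ compl (fun J => Hom.app e.hom J '' N J) J ↔
          x ∈ compl N J := by
        intro J x
        rw [mem_compl, mem_compl, (Hom.inj_iso e J).mem_set_image]
        refine imp_congr_right fun _ => ⟨fun h => ?_, fun h => by rw [h]; exact Hom.map_zero _ J⟩
        exact Hom.inj_iso e J (h.trans (Hom.map_zero _ J).symm)
      constructor
      · intro J s x hx
        obtain ⟨x, rfl⟩ := Hom.surj_iso e J x
        rw [← Hom.map_act]
        exact key.2 (hN.act s (key.1 hx))
      · intro J K hK x hx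
        obtain ⟨x, rfl⟩ := Hom.surj_iso e J x
        rw [← Hom.map_res]
        exact key.2 (hN.res hK (key.1 hx))
    · change _ = Hom.app e.hom J '' N J
      rw [← hr J, ← Set.range_comp]
      rfl
  · intro N _ N' _ h
    funext J
    exact Set.image_injective.2 (Hom.inj_iso e J) (congrFun h J)

theorem ncard_lineSummands_congr {F G : TSheaf} (e : F ≅ G) (n : ℤ) :
    (lineSummands F n).ncard = (lineSummands G n).ncard :=
  (ncard_lineSummands_le e n).antisymm (ncard_lineSummands_le e.symm n)

theorem IsDecomp.compl_left {F : TSheaf} {A B : ∀ J, Set (F.M J)} (h : IsDecomp F A B) :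
    compl A = B := by
  funext J
  ext x
  refine ⟨fun hx => (h.mem_or x).elim (fun hA => ?_) id, fun hB hA => h.eq_zero hA hB⟩
  rw [hx hA]
  exact (h.zero_mem J).2

theorem isDecomp_compl {F : TSheaf} {N : ∀ J, Set (F.M J)} (h : IsClosedFamily F N)
    (h' : IsClosedFamily F (compl N)) (h0 : ∀ J, 0 ∈ N J) : IsDecomp F N (compl N) where
  left := h
  right := h'
  union J := Set.eq_univ_of_forall fun x => by
    by_cases hx : x ∈ N J
    · exact Or.inl hx
    · exact Or.inr fun h => absurd h hx
  inter J := Set.eq_singleton_iff_unique_mem.2 ⟨⟨h0 J, fun _ => rfl⟩, fun _ hx => hx.2 hx.1⟩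

theorem isClosedFamily_compl_image_inr {X F : TSheaf} {N : ∀ J, Set (F.M J)} :
    IsClosedFamily (wedge X F) (compl fun J => (inr X F).app J '' N J) ↔
      IsClosedFamily F (compl N) := by
  have key : ∀ {J} {y : F.M J}, (inr X F).app J y ∈ compl (fun J => (inr X F).app J '' N J) J ↔
      y ∈ compl N J := by
    intro J y
    rw [mem_compl, mem_compl, (inj_inr J).mem_set_image]
    exact imp_congr_right fun _ =>
      ⟨fun h => inj_inr J (h.trans ((inr X F).map_zero J).symm), fun h => by rw [h]; rfl⟩
  have key' : ∀ {J} (x : X.M J),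
      (inl X F).app J x ∈ compl (fun J => (inr X F).app J '' N J) J := by
    rintro J x ⟨y, -, hy⟩
    exact isDecomp_wedge.eq_zero ⟨x, rfl⟩ ⟨y, hy⟩
  constructor
  · intro h
    constructor
    · intro J s y hy
      exact key.1 (by rw [Hom.map_act]; exact h.act s (key.2 hy))
    · intro J K hK y hy
      exact key.1 (by rw [Hom.map_res]; exact h.res hK (key.2 hy))
  · intro h
    constructor
    · intro J s w hw
      rcases wedge_cases w with ⟨x, rfl⟩ | ⟨y, rfl⟩
      · rw [← Hom.map_act]; exact key' _
      · rw [← Hom.map_act]; exact key.2 (h.act s (key.1 hw))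
    · intro J K hK w hw
      rcases wedge_cases w with ⟨x, rfl⟩ | ⟨y, rfl⟩
      · rw [← Hom.map_res]; exact key' _
      · rw [← Hom.map_res]; exact key.2 (h.res hK (key.1 hw))

/-- A summand isomorphic to `O n` is indecomposable, hence lies in `O m` or in `F`. In the first
case it is all of `O m`, which is indecomposable too. -/
theorem lineSummands_wedge (F : TSheaf) (m n : ℤ) : lineSummands (wedge (O m) F) n =
    {N | n = m ∧ N = fun J => Set.range ((inl (O m) F).app J)} ∪
      (fun N J => (inr (O m) F).app J '' N J) '' lineSummands F n := by
  ext N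
  constructor
  · rintro ⟨hN, g, hg, hr⟩
    obtain rfl : (fun J => Set.range (g.app J)) = N := funext hr
    rcases (isIndecomposable_iff.1 (isIndecomposable_O n)).2 _ _
      (isDecomp_wedge.comap hg) with h | h
    · obtain ⟨g', hg'⟩ := inj_inr.lift g fun J x => by
        rcases isDecomp_wedge.mem_or (g.app J x) with h1 | h1
        · have h2 : x ∈ g.app J ⁻¹' Set.range ((inl (O m) F).app J) := h1
          rw [h J] at h2
          rw [show x = 0 from h2, g.map_zero]
          exact ⟨0, rfl⟩
        · exact h1
      have he : (fun J => (inr (O m) F).app J '' Set.range (g'.app J)) =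
          fun J => Set.range (g.app J) := by
        funext J
        rw [← Set.range_comp]
        exact congrArg Set.range (funext (hg' J))
      refine Or.inr ⟨fun J => Set.range (g'.app J), ⟨?_, g', fun J x y e => ?_, fun J => rfl⟩, he⟩
      · rw [← he] at hN
        exact isClosedFamily_compl_image_inr.1 hN
      · exact hg J (by rw [← hg', ← hg', e])
    · have hsub : ∀ {J} x, g.app J x ∈ Set.range ((inl (O m) F).app J) := fun {J} x => by
        rcases isDecomp_wedge.mem_or (g.app J x) with h1 | h1
        · exact h1
        · have h2 : x ∈ g.app J ⁻¹' Set.range ((inr (O m) F).app J) := h1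
          rw [h J] at h2
          rw [show x = 0 from h2, g.map_zero]
          exact ⟨0, rfl⟩
      obtain ⟨g', hg'⟩ := inj_inl.lift g fun J x => hsub x
      have hd := (isDecomp_compl hg.isSub_range.isClosedFamily hN hg.isSub_range.zero).comap
        (inj_inl (X := O m) (Y := F))
      rcases (isIndecomposable_iff.1 (isIndecomposable_O m)).2 _ _ hd with h1 | h1
      · obtain ⟨x, hx⟩ := exists_O_torus_ne n
        have h2 : g'.app torus x ∈ (inl (O m) F).app torus ⁻¹' Set.range (g.app torus) :=
          ⟨x, (hg' _ x).symm⟩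
        rw [h1 torus] at h2
        refine absurd ?_ (hg.app_ne hx)
        rw [← hg', show g'.app torus x = 0 from h2, Hom.map_zero]
      · have hall : ∀ {J} (x : (O m).M J), (inl (O m) F).app J x ∈ Set.range (g.app J) := by
          intro J x
          by_contra hx
          have h2 : x ∈ (inl (O m) F).app J ⁻¹' compl (fun J => Set.range (g.app J)) J :=
            fun h => absurd h hx
          rw [h1 J] at h2
          refine hx ?_
          rw [show x = 0 from h2, Hom.map_zero]
          exact ⟨0, g.map_zero J⟩
        refine Or.inl ⟨?_, funext fun J => Set.Subset.antisymm ?_ ?_⟩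
        · obtain ⟨e⟩ := Hom.nonempty_iso_of_bijective g' (fun J x y e => hg J (by
            rw [← hg', ← hg', e])) fun J x => by
              obtain ⟨y, hy⟩ := hall x
              exact ⟨y, inj_inl J (by rw [hg', hy])⟩
          exact eq_of_iso_O e
        · rintro _ ⟨x, rfl⟩; exact hsub x
        · rintro _ ⟨x, rfl⟩; exact hall x
  · rintro (⟨rfl, rfl⟩ | ⟨N, ⟨hN, f, hf, hr⟩, rfl⟩)
    · refine ⟨?_, inl _ _, inj_inl, fun J => rfl⟩
      rw [isDecomp_wedge.compl_left]
      exact isDecomp_wedge.right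
    · refine ⟨isClosedFamily_compl_image_inr.2 hN, (inr _ _).comp f, inj_inr.comp hf,
        fun J => ?_⟩
      change _ = (inr _ _).app J '' N J
      rw [← hr J, ← Set.range_comp]
      rfl

theorem ncard_lineSummands_sumO (s : List ℤ) (n : ℤ) :
    (lineSummands (sumO s) n).ncard = s.count n := by
  induction s with
  | nil =>
    rw [List.count_nil, Set.ncard_eq_zero (finite_lineSummands _ _)]
    refine Set.eq_empty_of_forall_notMem ?_
    rintro N ⟨-, f, hf, -⟩
    obtain ⟨x, hx⟩ := exists_O_torus_ne n
    exact hf.app_ne hx rfl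
  | cons m s ih =>
    have hinj : Function.Injective fun (N : ∀ J, Set ((sumO s).M J)) J =>
        (inr (O m) (sumO s)).app J '' N J :=
      fun N N' h => funext fun J => Set.image_injective.2 (inj_inr J) (congrFun h J)
    change (lineSummands (wedge (O m) (sumO s)) n).ncard = _
    rw [lineSummands_wedge, List.count_cons]
    by_cases hnm : n = m
    · subst hnm
      have e : {N | n = n ∧ N = fun J => Set.range ((inl (O n) (sumO s)).app J)} =
          {fun J => Set.range ((inl (O n) (sumO s)).app J)} := by
        ext N; simp
      rw [e, Set.singleton_union, Set.ncard_insert_of_notMem ?_ ((finite_lineSummands _ _).image _),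
        Set.ncard_image_of_injective _ hinj, ih]
      · simp
      · rintro ⟨N, -, hN⟩
        obtain ⟨x, hx⟩ := exists_O_torus_ne n
        have h1 : (inl (O n) (sumO s)).app torus x ∈ (inr (O n) (sumO s)).app torus '' N torus := by
          exact (congrFun hN torus).symm.subset ⟨x, rfl⟩
        obtain ⟨y, -, hy⟩ := h1
        exact inj_inl.app_ne hx (isDecomp_wedge.eq_zero ⟨x, rfl⟩ ⟨y, hy⟩)
    · have e : {N | n = m ∧ N = fun J => Set.range ((inl (O m) (sumO s)).app J)} = ∅ := by
        ext N; simp [hnm]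
      rw [e, Set.empty_union, Set.ncard_image_of_injective _ hinj, ih]
      simp [Ne.symm hnm]

/-- The number of summands isomorphic to a given line bundle is an isomorphism invariant, as in the
Krull–Schmidt theorem. -/
theorem perm_of_iso_sumO {s t : List ℤ} (e : sumO s ≅ sumO t) : s.Perm t :=
  List.perm_iff_count.2 fun n => by
    rw [← ncard_lineSummands_sumO, ← ncard_lineSummands_sumO, ncard_lineSummands_congr e]

theorem hasLeast_O (n : ℤ) : HasLeast (O n) := by
  intro J x hx
  obtain ⟨l, hl⟩ := exists_le_chart J
  have hg : Shape ∅ n J (monoGen n l) := shape_empty_iff.2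
    ⟨(shape_monoGen_torus n l).1, fun j hj => (shape_empty_iff.1 (shape_monoGen_chart n l)).2 j (hl hj)⟩
  refine ⟨mono ∅ n J (monoGen n l), by rw [mono_pos hg]; exact Option.some_ne_none _,
    fun y hy => ?_⟩
  obtain ⟨⟨a, ha⟩, rfl⟩ := Option.ne_none_iff_exists'.1 (hy.ne_zero (isTorsionFree_O n) hx)
  refine ⟨⟨monoDeg n l a, fun j hj => ?_⟩, ?_⟩
  · rw [pairing_monoDeg ha.1, if_neg (mem_chart.1 (hl hj)).symm, sub_zero]
    exact ha.2.1 j hj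
  · rw [O_act_mono hg, monoGen_add ha.1, mono_pos ha]

theorem hasLeast_sumO : ∀ s, HasLeast (sumO s)
  | [] => fun _ _ hx => absurd rfl hx
  | n :: s => (hasLeast_wedge_iff (isTorsionFree_O n) (isTorsionFree_sumO s)).2
      ⟨hasLeast_O n, hasLeast_sumO s⟩

/- ## The quotient of the torsion-free subalgebra -/

section Quotient

variable {k : Type*} [Field k] {h : HallWellDefined}

/-- The subalgebra of torsion-free sheaves, as a commutative ring. -/
noncomputable abbrev commRingTF (k : Type*) [CommRing k] (h : HallWellDefined) : CommRing (TF k h) :=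
  { (inferInstance : Ring (TF k h)) with mul_comm := TF_mul_comm }

attribute [local instance] commRingTF

/-- `F` is torsion-free, but not locally free. -/
def IsSingular (F : TSheaf) : Prop := IsTorsionFree F ∧ ¬ IsLocallyFree F

theorem IsSingular.of_iso {F G : TSheaf} (e : F ≅ G) (hF : IsSingular F) : IsSingular G := by
  have hG := hF.1.of_iso e
  refine ⟨hG, fun hL => hF.2 ?_⟩
  rw [isLocallyFree_iff hG] at hL
  rw [isLocallyFree_iff hF.1]
  exact hL.of_iso e.symm

theorem IsSingular.wedge {F G : TSheaf} (hF : IsTorsionFree F) (hG : IsSingular G) :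
    IsSingular (wedge F G) := by
  refine ⟨isTorsionFree_wedge hF hG.1, fun hL => hG.2 ?_⟩
  rw [isLocallyFree_iff (isTorsionFree_wedge hF hG.1), hasLeast_wedge_iff hF hG.1] at hL
  exact (isLocallyFree_iff hG.1).2 hL.2

theorem coe_mem_span_of_mem_nonLocFree {t : TF k h} (ht : t ∈ nonLocFree k h) :
    (t : HallAlg k h) ∈ Submodule.span k {g | ∃ F, IsSingular F ∧ g = δ k h F} := by
  unfold nonLocFree Ideal.span at ht
  induction ht using Submodule.span_induction with
  | mem t ht =>
    obtain ⟨F, h1, h2, h3⟩ := ht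
    exact Submodule.subset_span ⟨F, ⟨h1, h2⟩, h3⟩
  | zero => exact Submodule.zero_mem _
  | add x y _ _ hx hy => exact Submodule.add_mem _ hx hy
  | smul a x _ hx =>
    have h1 := Submodule.mul_mem_mul (mem_TF_iff_mem_span.1 a.2) hx
    rw [Submodule.span_mul_span] at h1
    refine Submodule.span_le.2 ?_ h1
    rintro _ ⟨_, ⟨F, hF, rfl⟩, _, ⟨G, hG, rfl⟩, rfl⟩
    change δ k h F * δ k h G ∈ _
    rw [δ_mul_δ hF]
    exact Submodule.smul_mem _ _ (Submodule.subset_span ⟨_, hG.wedge hF, rfl⟩)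

/-- The classes of singular sheaves already span an ideal: a torsion-free class times such a class
is a multiple of the class of the direct sum, which is singular again. -/
theorem mem_nonLocFree_iff {t : TF k h} :
    t ∈ nonLocFree k h ↔ ∀ c, coeff k h c t ≠ 0 → IsSingular c.out := by
  refine ⟨fun ht c => coeff_of_mem_span IsSingular.of_iso (coe_mem_span_of_mem_nonLocFree ht) c,
    fun ht => ?_⟩
  have key : ∀ f ∈ Submodule.span k {g | ∃ F, IsSingular F ∧ g = δ k h F},
      ∃ u ∈ nonLocFree k h, (u : HallAlg k h) = f := by
    intro f hf
    refine Submodule.span_induction (p := fun f _ => ∃ u ∈ nonLocFree k h, (u : HallAlg k h) = f)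
      ?_ ?_ ?_ ?_ hf
    · rintro _ ⟨F, hF, rfl⟩
      exact ⟨⟨δ k h F, δ_mem_TF hF.1⟩, Ideal.subset_span ⟨F, hF.1, hF.2, rfl⟩, rfl⟩
    · exact ⟨0, Submodule.zero_mem _, rfl⟩
    · rintro _ _ - - ⟨u, hu, rfl⟩ ⟨v, hv, rfl⟩
      exact ⟨u + v, Submodule.add_mem _ hu hv, rfl⟩
    · rintro r _ - ⟨u, hu, rfl⟩
      exact ⟨r • u, Submodule.smul_of_tower_mem _ r hu, rfl⟩
  obtain ⟨u, hu, e⟩ := key t (mem_span_δ ht)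
  rwa [← Subtype.ext e]

/-- The homomorphism sending the variable `x_n` to the class of `𝒪(n)`. -/
noncomputable def evalO (k : Type*) [CommRing k] (h : HallWellDefined) :
    MvPolynomial ℤ k →ₐ[k] TF k h :=
  MvPolynomial.aeval (xO k h)

theorem evalO_X (n : ℤ) : evalO k h (MvPolynomial.X n) = xO k h n := MvPolynomial.aeval_X _ _

theorem prod_map_toList {M : Type*} [CommMonoid M] (f : ℤ → M) (β : ℤ →₀ ℕ) :
    ((Finsupp.toMultiset β).toList.map f).prod = β.prod fun i m => f i ^ m := by
  rw [← Multiset.prod_coe, ← Multiset.map_coe, Multiset.coe_toList, Finsupp.toMultiset_map,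
    Finsupp.prod_toMultiset, Finsupp.prod_mapDomain_index (fun _ => pow_zero _)
      (fun _ _ _ => pow_add _ _ _)]

variable [CharZero k]

/-- Each factor splits off as a summand with a positive integer multiplicity, which is invertible in
characteristic zero. -/
theorem exists_prod_xO (s : List ℤ) : ∃ c : k, c ≠ 0 ∧
    (((s.map (xO k h)).prod : TF k h) : HallAlg k h) = c • δ k h (sumO s) := by
  induction s with
  | nil => exact ⟨1, one_ne_zero, by rw [one_smul]; rfl⟩
  | cons n s ih =>
    obtain ⟨c, hc, e⟩ := ih
    refine ⟨c * (subobjects (O n) (sumO s) (wedge (O n) (sumO s))).ncard,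
      mul_ne_zero hc (Nat.cast_ne_zero.2 ncard_subobjects_wedge_ne_zero), ?_⟩
    rw [List.map_cons, List.prod_cons]
    change δ k h (O n) * (((s.map (xO k h)).prod : TF k h) : HallAlg k h) = _
    rw [e, mul_smul_comm, δ_mul_δ (isTorsionFree_O n), smul_smul]
    rfl

/-- Different monomials evaluate to multiples of the classes of non-isomorphic sheaves, so the
coefficients of a polynomial can be read off from its evaluation. -/
theorem exists_coeff_evalO (β : ℤ →₀ ℕ) : ∃ c : k, c ≠ 0 ∧ ∀ p : MvPolynomial ℤ k,
    coeff k h (cls (sumO (Finsupp.toMultiset β).toList)) (evalO k h p) =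
      MvPolynomial.coeff β p * c := by
  obtain ⟨c, hc, hβ⟩ := exists_prod_xO (k := k) (h := h) (Finsupp.toMultiset β).toList
  refine ⟨c, hc, fun p => ?_⟩
  induction p using MvPolynomial.induction_on' with
  | add p q hp hq =>
    rw [map_add, Subalgebra.coe_add, map_add, hp, hq, MvPolynomial.coeff_add, add_mul]
  | monomial γ a =>
    have e : evalO k h (MvPolynomial.monomial γ a) =
        a • ((Finsupp.toMultiset γ).toList.map (xO k h)).prod := by
      rw [prod_map_toList, evalO, MvPolynomial.aeval_monomial, Algebra.smul_def]
    rw [e, Subalgebra.coe_smul, map_smul]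
    by_cases hγ : γ = β
    · subst hγ
      rw [hβ, map_smul, coeff_δ, MvPolynomial.coeff_monomial, if_pos rfl]
      simp
    · obtain ⟨c', -, hc'⟩ := exists_prod_xO (k := k) (h := h) (Finsupp.toMultiset γ).toList
      rw [hc', map_smul, coeff_δ, MvPolynomial.coeff_monomial, if_neg hγ,
        Set.indicator_of_notMem, smul_zero, smul_zero, zero_mul]
      intro h'
      obtain ⟨e'⟩ := cls_eq_iff.1 (Set.mem_singleton_iff.1 h')
      have h1 := Multiset.coe_eq_coe.2 (perm_of_iso_sumO e')
      rw [Multiset.coe_toList, Multiset.coe_toList] at h1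
      refine hγ ?_
      rw [← Finsupp.toMultiset_toFinsupp γ, ← Finsupp.toMultiset_toFinsupp β, h1]

theorem eq_zero_of_evalO_mem {p : MvPolynomial ℤ k} (hp : evalO k h p ∈ nonLocFree k h) :
    p = 0 := by
  ext β
  obtain ⟨c, hc, e⟩ := exists_coeff_evalO (k := k) (h := h) β
  rw [MvPolynomial.coeff_zero]
  by_contra hβ
  have h1 := mem_nonLocFree_iff.1 hp _ (by rw [e p]; exact mul_ne_zero hβ hc)
  obtain ⟨e'⟩ := nonempty_iso_out (sumO (Finsupp.toMultiset β).toList)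
  exact (h1.of_iso e').2 ((isLocallyFree_iff (isTorsionFree_sumO _)).2 (hasLeast_sumO _))

/-- A torsion-free class is either singular or, up to an invertible scalar, a monomial in the
classes of line bundles. -/
theorem exists_sub_evalO_mem (t : TF k h) : ∃ p, t - evalO k h p ∈ nonLocFree k h := by
  obtain ⟨f, hf⟩ := t
  have key : ∀ f ∈ Submodule.span k {g | ∃ F, IsTorsionFree F ∧ g = δ k h F}, ∃ (p : _) (u : TF k h),
      u ∈ nonLocFree k h ∧ (u : HallAlg k h) = f - evalO k h p := by
    intro f hf
    refine Submodule.span_induction (p := fun f _ => ∃ (p : _) (u : TF k h),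
      u ∈ nonLocFree k h ∧ (u : HallAlg k h) = f - evalO k h p) ?_ ?_ ?_ ?_ hf
    · rintro _ ⟨F, hF, rfl⟩
      by_cases hL : IsLocallyFree F
      · obtain ⟨s, ⟨e⟩⟩ := nonempty_iso_sumO hF ((isLocallyFree_iff hF).1 hL)
        obtain ⟨c, hc, e'⟩ := exists_prod_xO (k := k) (h := h) s
        refine ⟨c⁻¹ • (s.map MvPolynomial.X).prod, 0, Submodule.zero_mem _, ?_⟩
        rw [map_smul, map_list_prod, List.map_map]
        have h1 : (evalO k h : MvPolynomial ℤ k → TF k h) ∘ MvPolynomial.X = xO k h :=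
          funext evalO_X
        rw [h1, Subalgebra.coe_smul, e', smul_smul, inv_mul_cancel₀ hc, one_smul]
        rw [show δ k h F = δ k h (sumO s) by rw [δ, cls_eq_iff.2 ⟨e⟩]; rfl, sub_self]
        rfl
      · refine ⟨0, ⟨δ k h F, δ_mem_TF hF⟩, Ideal.subset_span ⟨F, hF, hL, rfl⟩, ?_⟩
        rw [map_zero]
        exact (sub_zero _).symm
    · exact ⟨0, 0, Submodule.zero_mem _, by rw [map_zero]; exact (sub_zero _).symm⟩
    · rintro f g - - ⟨p, u, hu, e⟩ ⟨q, v, hv, e'⟩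
      refine ⟨p + q, u + v, Submodule.add_mem _ hu hv, ?_⟩
      rw [Subalgebra.coe_add, e, e', map_add, Subalgebra.coe_add, add_sub_add_comm]
    · rintro r f - ⟨p, u, hu, e⟩
      refine ⟨r • p, r • u, Submodule.smul_of_tower_mem _ r hu, ?_⟩
      rw [Subalgebra.coe_smul, e, map_smul, Subalgebra.coe_smul, smul_sub]
  obtain ⟨p, u, hu, e⟩ := key f (mem_TF_iff_mem_span.1 hf)
  refine ⟨p, ?_⟩
  rwa [← Subtype.ext (a1 := u) (a2 := ⟨f, hf⟩ - evalO k h p) e]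

theorem bijective_mk_evalO : Function.Bijective
    ((Ideal.Quotient.mkₐ k (nonLocFree k h)).comp (evalO k h)) := by
  constructor
  · rw [injective_iff_map_eq_zero]
    intro p hp
    exact eq_zero_of_evalO_mem (Ideal.Quotient.eq_zero_iff_mem.1 hp)
  · intro q
    obtain ⟨t, rfl⟩ := Ideal.Quotient.mk_surjective q
    obtain ⟨p, hp⟩ := exists_sub_evalO_mem t
    exact ⟨p, (Ideal.Quotient.eq.2 hp).symm⟩

/-- The projection of `𝕋𝔽` onto its quotient `𝕋𝔽/𝕁 = k[x_n : n ∈ ℤ]`. -/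
noncomputable def projTF (k : Type*) [Field k] [CharZero k] (h : HallWellDefined) :
    TF k h →ₐ[k] MvPolynomial ℤ k :=
  (AlgEquiv.ofBijective _ (bijective_mk_evalO (k := k) (h := h))).symm.toAlgHom.comp
    (Ideal.Quotient.mkₐ k (nonLocFree k h))

theorem projTF_evalO (p : MvPolynomial ℤ k) : projTF k h (evalO k h p) = p :=
  (AlgEquiv.ofBijective _ (bijective_mk_evalO (k := k) (h := h))).symm_apply_apply p

theorem surjective_projTF : Function.Surjective (projTF k h) := fun p => ⟨_, projTF_evalO p⟩

theorem projTF_eq_zero_iff {t : TF k h} : projTF k h t = 0 ↔ t ∈ nonLocFree k h := by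
  rw [← Ideal.Quotient.eq_zero_iff_mem]
  exact (AlgEquiv.ofBijective _ (bijective_mk_evalO (k := k) (h := h))).symm.map_eq_zero_iff

theorem ker_projTF : RingHom.ker (projTF k h) = nonLocFree k h :=
  Ideal.ext fun _ => projTF_eq_zero_iff

theorem projTF_xO (n : ℤ) : projTF k h (xO k h n) = MvPolynomial.X n := by
  rw [← evalO_X, projTF_evalO]

end Quotient

/- ## Extensions of a line bundle on a boundary line by a torsion-free sheaf -/

theorem lineO_eq_zero {i : Fin 3} {n : ℤ} {J : Cone} (hi : i ∉ J.1) (x : (lineO i n).M J) :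
    x = 0 := by
  by_contra hx
  exact hi (lineO_res_ne hx).1

theorem lineO_act_eq_zero_iff {i : Fin 3} {n : ℤ} {J : Cone} {x : (lineO i n).M J} (hx : x ≠ 0)
    (s : S J) : (lineO i n).act s x = 0 ↔ pairing s i ≠ 0 := by
  rcases x with _ | a
  · exact absurd rfl hx
  obtain ⟨hi, h0⟩ := a.2.2.2 i (Finset.mem_singleton_self i)
  constructor
  · intro h1 h2
    have h3 : Shape {i} n J (a.1 + pairing s) := by
      refine ⟨(sum_add_pairing _ _).trans a.2.1, fun j hj => add_nonneg (a.2.2.1 j hj) (s.2 j hj),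
        fun j hj => ?_⟩
      obtain rfl := Finset.mem_singleton.1 hj
      exact ⟨hi, by rw [Pi.add_apply, h0, h2, add_zero]⟩
    exact Option.some_ne_none _ ((mono_pos h3).symm.trans h1)
  · intro h1
    refine mono_neg fun h2 => h1 ?_
    have h3 := (h2.2.2 i (Finset.mem_singleton_self i)).2
    rwa [Pi.add_apply, h0, zero_add] at h3

theorem not_isTorsionFree_lineO (i : Fin 3) (n : ℤ) : ¬ IsTorsionFree (lineO i n) := fun h => by
  obtain ⟨x, hx⟩ := lineO_ray_nonempty i n
  exact res_ne_zero_of_torsionFree h (torus_le _) hx (lineO_eq_zero (by simp [torus]) _)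

section Extension

variable {F Z : TSheaf} {i : Fin 3} {n : ℤ}

/-- A torsion-free sheaf has no torsion subsheaf, so in torsion-free degrees only one of the two
terms of the commutator remains. -/
theorem subobjects_eq_empty (hZ : IsTorsionFree Z) : subobjects F (lineO i n) Z = ∅ := by
  refine Set.eq_empty_of_forall_notMem fun N hN => ?_
  obtain ⟨j, p, h, -⟩ := mem_subobjects.1 hN
  exact not_isTorsionFree_lineO i n (hZ.of_inj h.inj)

/-- On the ray `i` any two non-zero sections of `lineO i n` differ by a unit, hence so do their
lifts. If one lift survives on the torus, all of them do. -/
theorem IsExact.isTorsionFree_of_res_ne {j : Hom F Z} {p : Hom Z (lineO i n)} (h : IsExact j p)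
    (hF : IsTorsionFree F) {K : Cone} {w : Z.M K} (hw : p.app K w ≠ 0)
    (hw' : Z.res (torus_le K) w ≠ 0) : IsTorsionFree Z := by
  intro J z hz s hs
  by_cases hpz : p.app J z = 0
  · obtain ⟨y, rfl⟩ := h.ker hpz
    refine hF J y (fun hy => hz (by rw [hy, j.map_zero])) s (h.inj J ?_)
    rw [j.map_act, hs, j.map_zero]
  · obtain ⟨hiJ, h1⟩ := lineO_res_ne hpz
    obtain ⟨hiK, h2⟩ := lineO_res_ne hw
    rw [← p.map_res] at h1 h2
    obtain ⟨t, ht⟩ := lineO_transitive h1 h2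
    rw [← p.map_act] at ht
    have h3 := p.cancel ht (by rw [ht]; exact h2)
    have h4 : Z.res (torus_le _) (Z.act t (Z.res (ray_le hiJ) z)) ≠ 0 := by
      rw [h3, Z.res_res]; exact hw'
    rw [Z.res_act, Z.res_res] at h4
    refine TSheaf.act_unit_ne (s := faceIncl (torus_le J) s) (mem_S_torus _)
      (TSheaf.ne_of_act_ne h4) ?_
    rw [← Z.res_act, hs, Z.res_zero]

/-- All sections outside `N` now vanish on the torus, while non-zero sections of `N` do not; hence
multiples and restrictions of the former can meet `N` only in zero. -/
theorem isClosedFamily_compl_of_not_isTorsionFree (hF : IsTorsionFree F) (hZ : ¬ IsTorsionFree Z)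
    {N : ∀ J, Set (Z.M J)} (hN : N ∈ subobjects (lineO i n) F Z) : IsClosedFamily Z (compl N) := by
  obtain ⟨j, p, h, hj⟩ := mem_subobjects.1 hN
  have hmem : ∀ {J} {z : Z.M J}, z ∈ N J ↔ p.app J z = 0 := mem_iff_of_isExact h hj
  have key : ∀ {J} {z : Z.M J}, p.app J z ≠ 0 → Z.res (torus_le J) z = 0 := fun hz => by
    by_contra h0
    exact hZ (h.isTorsionFree_of_res_ne hF hz h0)
  have key' : ∀ {J} {z : Z.M J}, z ∈ N J → Z.res (torus_le J) z = 0 → z = 0 := by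
    intro J z hz h0
    rw [← hj J] at hz
    obtain ⟨y, rfl⟩ := hz
    by_contra hy
    refine res_ne_zero_of_torsionFree hF (torus_le J) (j.ne_of_app_ne hy) (h.inj _ ?_)
    rw [j.map_res, h0, j.map_zero]
  constructor
  · intro J s z hz hs
    by_cases h0 : p.app J z = 0
    · rw [hz (hmem.2 h0), Z.act_zero]
    · exact key' hs (by rw [Z.res_act, key h0, Z.act_zero])
  · intro J K hK z hz hs
    by_cases h0 : p.app J z = 0
    · rw [hz (hmem.2 h0), Z.res_zero]
    · exact key' hs (by rw [Z.res_res, key h0])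

theorem ncard_subobjects_lineO_comm (hF : IsTorsionFree F) (hZ : ¬ IsTorsionFree Z) :
    (subobjects (lineO i n) F Z).ncard = (subobjects F (lineO i n) Z).ncard :=
  ncard_subobjects_comm (fun _ hN => isClosedFamily_compl_of_not_isTorsionFree hF hZ hN)
    fun _ hN => isClosedFamily_compl_of_torsionFree hF hN

/-- Provides a local equation of the line X_i = 0 on X_J. -/
theorem exists_coordinate {J : Cone} {i : Fin 3} (hi : i ∈ J.1) : ∃ e : S J, pairing e i = 1 ∧
    ∀ j ∈ J.1, j ≠ i → pairing e j = 0 := by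
  let K : Cone := ⟨J.1.erase i, fun h => by
    have := Finset.mem_univ i
    rw [← h] at this
    simp at this⟩
  obtain ⟨e, he, h0, h1⟩ := exists_unit (J := J) (K := K) 1 zero_le_one
  exact ⟨⟨e, he⟩, h1 i hi (Finset.notMem_erase _ _),
    fun j hj hji => h0 j (Finset.mem_erase.2 ⟨hji, hj⟩) hj⟩

/-- The generator `b` of an orbit of `Z` either lies in `F` or maps to a non-zero section. In the
second case `act s b` lies in `F` exactly when `s` is divisible by the equation `e` of the line, so
`act e b` is the generator for `F`. -/
theorem IsExact.hasLeast {j : Hom F Z} {p : Hom Z (lineO i n)} (h : IsExact j p)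
    (hZ : HasLeast Z) : HasLeast F := by
  intro J x hx
  obtain ⟨b, hb, hl⟩ := hZ J _ (h.inj.app_ne hx)
  by_cases hpb : p.app J b = 0
  · obtain ⟨y, rfl⟩ := h.ker hpb
    refine ⟨y, j.ne_of_app_ne hb, fun x' hx' => ?_⟩
    obtain ⟨s, hs⟩ := hl _ (hx'.map j)
    exact ⟨s, h.inj J (by rw [hs, j.map_act])⟩
  · obtain ⟨hi, -⟩ := lineO_res_ne hpb
    obtain ⟨e, hei, he⟩ := exists_coordinate hi
    obtain ⟨y, hy⟩ := h.ker (z := Z.act e b)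
      (by rw [p.map_act, lineO_act_eq_zero_iff hpb, hei]; exact one_ne_zero)
    have main : ∀ x', SameOrbit F x x' → ∃ s, x' = F.act s y := by
      intro x' hx'
      obtain ⟨s, hs⟩ := hl _ (hx'.map j)
      have h1 : pairing s i ≠ 0 := by
        rw [← lineO_act_eq_zero_iff hpb, ← p.map_act, ← hs, h.comp]
      have h2 : (s : ℤ × ℤ) - e ∈ S J := by
        intro l hl
        rw [pairing_sub, Pi.sub_apply]
        have h3 := s.2 l hl
        by_cases hli : l = i
        · subst hli; omega
        · rw [he l hl hli]; omega
      refine ⟨⟨_, h2⟩, h.inj J ?_⟩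
      rw [hs, j.map_act, hy, ← Z.add_act]
      congr 1
      exact Subtype.ext (sub_add_cancel _ _).symm
    refine ⟨y, fun hy0 => hx ?_, main⟩
    obtain ⟨s, hs⟩ := main x (SameOrbit.refl x)
    rw [hs, hy0, F.act_zero]

end Extension

/-! ### Line bundles and their surjections onto line bundles on a boundary line -/

theorem exists_act_monoGen {I : Finset (Fin 3)} {n : ℤ} {J : Cone} {l : Fin 3} (hl : J ≤ chart l)
    {a : Fin 3 → ℤ} (ha : Shape I n J a) : Shape I n J (monoGen n l) ∧
      ∃ s : S J, (∀ j, j ≠ l → pairing s j = a j) ∧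
        (twist I n).act s (mono I n J (monoGen n l)) = mono I n J a := by
  have hne : ∀ j ∈ J.1, l ≠ j := fun j hj => (mem_chart.1 (hl hj)).symm
  have hg : Shape I n J (monoGen n l) := by
    refine ⟨by fin_cases l <;> simp [monoGen], fun j hj => by simp [monoGen, hne j hj],
      fun j hj => ?_⟩
    have hj' := (ha.2.2 j hj).1
    exact ⟨hj', by simp [monoGen, hne j hj']⟩
  have hs : ∀ j, j ≠ l → pairing (monoDeg n l a) j = a j := fun j hj => by
    rw [pairing_monoDeg ha.1, if_neg hj.symm, sub_zero]
  refine ⟨hg, ⟨monoDeg n l a, fun j hj => ?_⟩, hs, ?_⟩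
  · rw [hs j (hne j hj).symm]
    exact ha.2.1 j hj
  · rw [mono_pos hg]
    change mono I n J (monoGen n l + pairing (monoDeg n l a)) = _
    rw [monoGen_add ha.1]

theorem exists_mono_of_ne {I : Finset (Fin 3)} {n : ℤ} {J : Cone} {x : (twist I n).M J}
    (hx : x ≠ 0) : ∃ a, Shape I n J a ∧ x = mono I n J a := by
  obtain ⟨⟨a, ha⟩, rfl⟩ := Option.ne_none_iff_exists'.1 hx
  exact ⟨a, ha, (mono_pos ha).symm⟩

theorem mono_ne {I : Finset (Fin 3)} {n : ℤ} {J : Cone} {a : Fin 3 → ℤ} (ha : Shape I n J a) :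
    @Ne ((twist I n).M J) (mono I n J a) 0 := by
  rw [mono_pos ha]; exact Option.some_ne_none _

theorem shape_line {i : Fin 3} {n : ℤ} {J : Cone} {a : Fin 3 → ℤ} :
    Shape {i} n J a ↔ Shape ∅ n J a ∧ i ∈ J.1 ∧ a i = 0 := by
  simp [Shape, and_assoc]

/-- The kernel of a surjection of a line bundle onto a line bundle on a boundary line. -/
theorem app_mono_eq_zero_iff {i : Fin 3} {m n : ℤ} {p : Hom (O m) (lineO i n)} (hp : p.Surj)
    {J : Cone} {a : Fin 3 → ℤ} (ha : Shape ∅ m J a) :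
    p.app J (mono ∅ m J a) = 0 ↔ (i ∈ J.1 → a i ≠ 0) := by
  by_cases hi : i ∈ J.1
  · obtain ⟨l, hl⟩ := exists_le_chart J
    have hil := mem_chart.1 (hl hi)
    obtain ⟨hg, s, hs, e⟩ := exists_act_monoGen hl ha
    -- By surjectivity the generator of the stalk cannot map to zero: some multiple of it maps to a
    -- non-zero section. Which multiples vanish is then decided by the exponent at `i`.
    have hpg : p.app J (mono ∅ m J (monoGen m l)) ≠ 0 := by
      have h1 : Shape {i} n J (monoGen n l) := by
        refine shape_line.2 ⟨shape_empty_iff.2 ⟨by fin_cases l <;> simp [monoGen], fun j hj => ?_⟩,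
          hi, ?_⟩
        · simp [monoGen, (mem_chart.1 (hl hj)).symm]
        · simp [monoGen, hil.symm]
      obtain ⟨z, hz⟩ := hp J (mono {i} n J (monoGen n l))
      have hz0 := p.ne_of_app_ne (hz.symm ▸ mono_ne h1)
      obtain ⟨b, hb, rfl⟩ := exists_mono_of_ne hz0
      obtain ⟨-, t, -, ht⟩ := exists_act_monoGen hl hb
      intro h0
      refine mono_ne h1 (hz.symm.trans ((congrArg (p.app J) ht.symm).trans ?_))
      refine (p.map_act _ _).trans ((congrArg _ h0).trans (QCoh.act_zero _ _))
    have h1 : p.app J (mono ∅ m J a) = (lineO i n).act s (p.app J (mono ∅ m J (monoGen m l))) :=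
      (congrArg (p.app J) e.symm).trans (p.map_act _ _)
    rw [h1, lineO_act_eq_zero_iff hpg, hs i hil]
    simp [hi]
  · simp only [hi, false_imp_iff, iff_true]
    exact lineO_eq_zero hi _

/-- In both cases the kernel consists of the monomials divisible by X_i, whatever the twists; this
makes the subobject unique. -/
theorem app_eq_zero_iff_of_surj {i : Fin 3} {m n n' : ℤ} {p : Hom (O m) (lineO i n)}
    (hp : p.Surj) {p' : Hom (O m) (lineO i n')} (hp' : p'.Surj) {J : Cone} (x : (O m).M J) :
    p.app J x = 0 ↔ p'.app J x = 0 := by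
  by_cases hx : x = 0
  · rw [hx, p.map_zero, p'.map_zero]; simp
  · obtain ⟨a, ha, rfl⟩ := exists_mono_of_ne hx
    exact (app_mono_eq_zero_iff hp ha).trans (app_mono_eq_zero_iff hp' ha).symm

theorem eq_of_iso_lineO {i : Fin 3} {n n' : ℤ} (e : lineO i n ≅ lineO i n') : n = n' := by
  let f : Hom (lineO i n) (lineO i n') := e.hom
  have hf : f.Inj := Hom.inj_iso e
  have hs : f.Surj := Hom.surj_iso e
  have hgen : ∀ (n : ℤ) {l}, i ≠ l → ∀ {J : Cone}, J ≤ chart l → i ∈ J.1 →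
      Shape {i} n J (monoGen n l) := by
    intro n l hl J hJ hi
    refine shape_line.2 ⟨shape_empty_iff.2 ⟨by fin_cases l <;> simp [monoGen], fun j hj => ?_⟩,
      hi, by simp [monoGen, hl.symm]⟩
    simp [monoGen, (mem_chart.1 (hJ hj)).symm]
  -- Over `chart l` the generator maps to the generator: its exponents off `l` are non-negative and
  -- remain so after adding those of `s`, yet the sums are zero.
  have main : ∀ l, i ≠ l → f.app (ray i) (mono {i} n (ray i) (monoGen n l)) =
      mono {i} n' (ray i) (monoGen n' l) := by
    intro l hl
    have hi : i ∈ (chart l).1 := mem_chart.2 hl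
    have hg := hgen n hl le_rfl hi
    have hg' := hgen n' hl le_rfl hi
    obtain ⟨c, hc, hfc⟩ := exists_mono_of_ne (hf.app_ne (mono_ne hg))
    obtain ⟨y, hy⟩ := hs (chart l) (mono {i} n' (chart l) (monoGen n' l))
    obtain ⟨a, ha, rfl⟩ := exists_mono_of_ne (f.ne_of_app_ne (hy.symm ▸ mono_ne hg'))
    obtain ⟨-, s, hsa, hs⟩ := exists_act_monoGen le_rfl ha
    have h1 : mono {i} n' (chart l) (monoGen n' l) = mono {i} n' (chart l) (c + pairing s) := by
      refine hy.symm.trans ((congrArg (f.app _) hs.symm).trans ((f.map_act _ _).trans ?_))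
      refine (congrArg _ hfc).trans ?_
      rw [mono_pos hc]
      rfl
    have h2 := mono_inj h1 hg'
    have h3 : ∀ j, j ≠ l → c j = 0 := by
      intro j hj
      have h4 := congrFun h2 j
      have h5 := hc.2.1 j (mem_chart.2 hj)
      have h6 := s.2 j (mem_chart.2 hj)
      simp only [monoGen, if_neg hj.symm, Pi.add_apply] at h4
      omega
    have h4 : c = monoGen n' l := by
      have h5 := hc.1
      funext j
      by_cases hj : l = j
      · subst hj
        have h6 := h3 0
        have h7 := h3 1
        have h8 := h3 2
        simp only [monoGen, if_true]
        fin_cases l <;> simp at h6 h7 h8 ⊢ <;> omega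
      · simp [monoGen, hj, h3 j (Ne.symm hj)]
    subst h4
    have h5 := f.map_res (ray_le hi) (mono {i} n (chart l) (monoGen n l))
    rw [hfc] at h5
    have h6 : ∀ n, (lineO i n).res (ray_le hi) (mono {i} n (chart l) (monoGen n l)) =
        mono {i} n (ray i) (monoGen n l) := fun n => by
      rw [mono_pos (hgen n hl le_rfl hi)]; rfl
    rwa [h6, h6] at h5
  obtain ⟨l, hl⟩ := exists_ne i
  obtain ⟨l', hll', hl'⟩ := exists_third hl
  have hJ : ∀ {l}, l ≠ i → ray i ≤ chart l := fun h j hj => by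
    obtain rfl := Finset.mem_singleton.1 hj
    exact mem_chart.2 h.symm
  have hi : i ∈ (ray i).1 := Finset.mem_singleton_self i
  -- On the line, t = (X_{l'}/X_l)^n carries X_l^n to X_{l'}^n. Applying `f` gives the same relation
  -- between the generators of degree `n'`, and comparing exponents at `l'` yields `n = n'`.
  let t : S (ray i) := ⟨ratio l' l n, fun j hj => by
    obtain rfl := Finset.mem_singleton.1 hj
    rw [pairing_ratio, if_neg hl', if_neg hl, sub_zero]⟩
  have hadd : monoGen n l + pairing t = monoGen n l' := by
    funext j
    rw [Pi.add_apply, pairing_ratio]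
    simp [monoGen]
  have h1 : (lineO i n).act t (mono {i} n (ray i) (monoGen n l)) =
      mono {i} n (ray i) (monoGen n l') := by
    rw [mono_pos (hgen n hl.symm (hJ hl) hi), ← hadd]; rfl
  have h2 : (lineO i n').act t (mono {i} n' (ray i) (monoGen n' l)) =
      mono {i} n' (ray i) (monoGen n' l + pairing t) := by
    rw [mono_pos (hgen n' hl.symm (hJ hl) hi)]; rfl
  have h3 := f.map_act t (mono {i} n (ray i) (monoGen n l))
  rw [h1, main l hl.symm, main l' hl'.symm, h2] at h3
  have h4 := congrFun (mono_inj h3 (hgen n' hl'.symm (hJ hl') hi)) l'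
  rw [Pi.add_apply, pairing_ratio] at h4
  simp [monoGen, hll'.symm] at h4
  exact h4.symm

/-! ### Multiplication by X_i and its cokernel -/

theorem shape_add_pairing {n : ℤ} {J : Cone} {a : Fin 3 → ℤ} (ha : Shape ∅ n J a) (s : S J) :
    Shape ∅ n J (a + pairing s) :=
  shape_empty_iff.2 ⟨(sum_add_pairing _ _).trans ha.1,
    fun j hj => add_nonneg (ha.2.1 j hj) (s.2 j hj)⟩

theorem shape_mulX {i : Fin 3} {n : ℤ} {J : Cone} {a : Fin 3 → ℤ} (ha : Shape ∅ (n - 1) J a) :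
    Shape ∅ n J (a + Pi.single i 1) := by
  refine shape_empty_iff.2 ⟨?_, fun j hj => add_nonneg (ha.2.1 j hj) ?_⟩
  · have := ha.1
    fin_cases i <;> simp <;> omega
  · rw [Pi.single_apply]
    split_ifs <;> simp

/-- Multiplication by `X_i`. -/
noncomputable def mulX (i : Fin 3) (n : ℤ) : Hom (O (n - 1)) (O n) where
  app J x := x.elim none fun a => mono ∅ n J (a.1 + Pi.single i 1)
  map_zero _ := rfl
  map_act {J} s x := by
    rcases x with _ | a
    · rfl
    · have h1 : (O (n - 1)).act s (some a) = some ⟨a.1 + pairing s, shape_add_pairing a.2 s⟩ :=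
        mono_pos _
      refine (congrArg (Option.elim · _ _) h1).trans (Eq.trans ?_ (O_act_mono (shape_mulX a.2) s).symm)
      change mono ∅ n J (a.1 + pairing s + Pi.single i 1) = _
      rw [add_right_comm]
  map_res {J K} h x := by
    rcases x with _ | a
    · rfl
    · have h1 : (O (n - 1)).res h (some a) = some ⟨a.1, shape_empty_iff.2
          ⟨a.2.1, fun j hj => a.2.2.1 j (h hj)⟩⟩ := mono_pos _
      exact (congrArg (Option.elim · _ _) h1).trans (O_res_mono h (shape_mulX a.2)).symm
  alpha {J} x y h := by
    rcases x with _ | a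
    · exact Or.inr rfl
    rcases y with _ | b
    · exact Or.inr h
    · exact Or.inl (congrArg some (Subtype.ext (add_right_cancel (mono_inj h (shape_mulX a.2)))))

/-- The restriction of sections to the line `X_i = 0`. -/
noncomputable def restrict (i : Fin 3) (n : ℤ) : Hom (O n) (lineO i n) where
  app J x := x.elim none fun a => mono {i} n J a.1
  map_zero _ := rfl
  map_act {J} s x := by
    rcases x with _ | a
    · rfl
    · have h1 : (O n).act s (some a) = some ⟨a.1 + pairing s, shape_add_pairing a.2 s⟩ :=
        mono_pos _
      refine (congrArg (Option.elim · _ _) h1).trans ?_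
      change mono {i} n J (a.1 + pairing s) = monoAct {i} n s (mono {i} n J a.1)
      by_cases h2 : Shape {i} n J a.1
      · rw [mono_pos h2]; rfl
      · rw [mono_neg h2]
        refine mono_neg fun h3 => h2 ?_
        obtain ⟨h4, hi, h5⟩ := shape_line.1 h3
        have h6 := a.2.2.1 i hi
        have h7 := s.2 i hi
        rw [Pi.add_apply] at h5
        exact shape_line.2 ⟨a.2, hi, by omega⟩
  map_res {J K} h x := by
    rcases x with _ | a
    · rfl
    · have h0 : Shape ∅ n K a.1 := shape_empty_iff.2 ⟨a.2.1, fun j hj => a.2.2.1 j (h hj)⟩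
      have h1 : (O n).res h (some a) = some ⟨a.1, h0⟩ := mono_pos _
      refine (congrArg (Option.elim · _ _) h1).trans ?_
      change mono {i} n K a.1 = monoRes {i} n K (mono {i} n J a.1)
      by_cases h2 : Shape {i} n J a.1
      · rw [mono_pos h2]; rfl
      · rw [mono_neg h2]
        refine mono_neg fun h3 => h2 ?_
        obtain ⟨-, hi, h5⟩ := shape_line.1 h3
        exact shape_line.2 ⟨a.2, h hi, h5⟩
  alpha {J} x y h := by
    rcases x with _ | a
    · exact Or.inr rfl
    rcases y with _ | b
    · exact Or.inr h
    · by_cases h2 : Shape {i} n J a.1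
      · exact Or.inl (congrArg some (Subtype.ext (mono_inj h h2)))
      · exact Or.inr (mono_neg h2)

theorem isExact_mulX (i : Fin 3) (n : ℤ) : IsExact (mulX i n) (restrict i n) where
  inj J x y e := by
    rcases x with _ | a
    · rcases y with _ | b
      · rfl
      · exact absurd e.symm (mono_ne (shape_mulX b.2))
    · exact ((mulX i n).alpha _ _ e).resolve_right (mono_ne (shape_mulX a.2))
  surj J x := by
    rcases x with _ | a
    · exact ⟨none, rfl⟩
    · exact ⟨some ⟨a.1, (shape_line.1 a.2).1⟩, mono_pos a.2⟩
  ker {J z} hz := by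
    rcases z with _ | a
    · exact ⟨none, rfl⟩
    · have h1 : ¬ Shape {i} n J a.1 := fun h => mono_ne h hz
      have h2 : Shape ∅ (n - 1) J (a.1 - Pi.single i 1) := by
        refine shape_empty_iff.2 ⟨?_, fun j hj => ?_⟩
        · have := a.2.1
          fin_cases i <;> simp <;> omega
        · have h3 := a.2.2.1 j hj
          by_cases hij : j = i
          · subst hij
            have h4 : a.1 j ≠ 0 := fun h => h1 (shape_line.2 ⟨a.2, hj, h⟩)
            rw [Pi.sub_apply, Pi.single_eq_same]
            omega
          · rwa [Pi.sub_apply, Pi.single_eq_of_ne hij, sub_zero]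
      refine ⟨some ⟨_, h2⟩, ?_⟩
      change mono ∅ n J (a.1 - Pi.single i 1 + Pi.single i 1) = _
      rw [sub_add_cancel, mono_pos a.2]
  comp {J} y := by
    rcases y with _ | a
    · rfl
    · have h1 : (mulX i n).app J (some a) = some ⟨_, shape_mulX a.2⟩ := mono_pos (shape_mulX a.2)
      refine (congrArg ((restrict i n).app J) h1).trans (mono_neg fun h2 => ?_)
      obtain ⟨-, hi, h3⟩ := shape_line.1 h2
      have h4 := a.2.2.1 i hi
      change a.1 i + (Pi.single i 1 : Fin 3 → ℤ) i = 0 at h3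
      rw [Pi.single_eq_same] at h3
      omega

theorem ncard_subobjects_mulX (i : Fin 3) (n : ℤ) :
    (subobjects (lineO i n) (O (n - 1)) (O n)).ncard = 1 := by
  refine Set.ncard_eq_one.2 ⟨fun J => Set.range ((mulX i n).app J),
    Set.eq_singleton_iff_unique_mem.2 ⟨mem_subobjects.2 ⟨_, _, isExact_mulX i n, fun _ => rfl⟩,
      fun N hN => funext fun J => ?_⟩⟩
  obtain ⟨j, p, h, hj⟩ := mem_subobjects.1 hN
  rw [← hj J, ← h.ker_eq, ← (isExact_mulX i n).ker_eq]
  exact Set.ext fun x => app_eq_zero_iff_of_surj h.surj (isExact_mulX i n).surj x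

/-- The quotient vanishes on the torus, so `Z` has the generic stalk of `O m` and is some `O n'`.
Its kernel agrees with that of `restrict i n'`, and comparing quotients and kernels gives `n' = n`
and `m = n - 1`. -/
theorem eq_of_subobjects_lineO_nonempty {i : Fin 3} {m n : ℤ} {Z : TSheaf} (hZ : IsTorsionFree Z)
    (hL : HasLeast Z) (h : (subobjects (lineO i n) (O m) Z).Nonempty) :
    m = n - 1 ∧ Nonempty (Z ≅ O n) := by
  obtain ⟨N, hN⟩ := h
  obtain ⟨j, p, hjp, -⟩ := mem_subobjects.1 hN
  obtain ⟨x, hx⟩ := exists_O_torus_ne m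
  obtain ⟨n', ⟨e⟩⟩ := nonempty_iso_O hZ hL (hjp.inj.app_ne hx) fun y hy => by
    obtain ⟨x', rfl⟩ := hjp.ker (z := y) (lineO_eq_zero (by simp [torus]) _)
    obtain ⟨s, rfl⟩ := O_transitive hx (j.ne_of_app_ne hy)
    exact ⟨s, (j.map_act _ _).symm⟩
  have h1 := hjp.congr_mid e
  have h2 := isExact_mulX i n'
  have h3 := fun J x => app_eq_zero_iff_of_surj h1.surj h2.surj (J := J) x
  obtain ⟨e1, -⟩ := h1.surj.iso_of_ker h2.surj h3
  obtain ⟨e2, -⟩ := h1.inj.iso_of_range h2.inj fun J => by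
    rw [← h1.ker_eq, ← h2.ker_eq]
    exact Set.ext (h3 J)
  obtain rfl := eq_of_iso_lineO e1
  exact ⟨eq_of_iso_O e2, ⟨e⟩⟩

/- ## The action on the torsion-free subalgebra -/

/-- The elements whose adjoint action preserves a subspace. -/
def adStabilizer {k A : Type*} [CommRing k] [Ring A] [Algebra k A] (V : Submodule k A) :
    LieSubalgebra k A where
  carrier := {x | ∀ t ∈ V, x * t - t * x ∈ V}
  zero_mem' t _ := by rw [zero_mul, mul_zero, sub_zero]; exact V.zero_mem
  add_mem' {x y} hx hy t ht := by
    rw [add_mul, mul_add, add_sub_add_comm]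
    exact V.add_mem (hx t ht) (hy t ht)
  smul_mem' r x hx t ht := by
    rw [smul_mul_assoc, mul_smul_comm, ← smul_sub]
    exact V.smul_mem r (hx t ht)
  lie_mem' {x y} hx hy t ht := by
    -- The Jacobi identity: the adjoint action of a bracket is the commutator of the adjoint
    -- actions.
    have e : ⁅x, y⁆ * t - t * ⁅x, y⁆ =
        (x * (y * t - t * y) - (y * t - t * y) * x) -
          (y * (x * t - t * x) - (x * t - t * x) * y) := by
      rw [LieRing.of_associative_ring_bracket]
      noncomm_ring
    rw [e]
    exact V.sub_mem (hx _ (hy t ht)) (hy _ (hx t ht))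

section Action

variable {k : Type*} [Field k] {h : HallWellDefined}

theorem mem_adStabilizer_of_span {V : Submodule k (HallAlg k h)} {s : Set (HallAlg k h)}
    (hV : V = Submodule.span k s) {x : HallAlg k h} (hx : ∀ t ∈ s, x * t - t * x ∈ V) :
    x ∈ adStabilizer V := by
  intro t ht
  rw [hV] at ht
  induction ht using Submodule.span_induction with
  | mem t ht => exact hx t ht
  | zero => rw [mul_zero, zero_mul, sub_zero]; exact V.zero_mem
  | add t u _ _ ht hu => rw [mul_add, add_mul, add_sub_add_comm]; exact V.add_mem ht hu
  | smul r t _ ht => rw [mul_smul_comm, smul_mul_assoc, ← smul_sub]; exact V.smul_mem r ht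

/-- The classes of the singular torsion-free sheaves span the ideal `nonLocFree`. -/
noncomputable def singularSpan (k : Type*) [CommRing k] (h : HallWellDefined) :
    Submodule k (HallAlg k h) :=
  Submodule.span k {g | ∃ F, IsSingular F ∧ g = δ k h F}

theorem mem_nonLocFree_iff_mem_singularSpan {t : TF k h} :
    t ∈ nonLocFree k h ↔ (t : HallAlg k h) ∈ singularSpan k h :=
  ⟨coe_mem_span_of_mem_nonLocFree, fun ht =>
    mem_nonLocFree_iff.2 fun c => coeff_of_mem_span IsSingular.of_iso ht c⟩

theorem isTorsionFree_of_coeff_commutator_ne {F : TSheaf} {i : Fin 3} {n : ℤ} {c : IsoClass}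
    (hF : IsTorsionFree F)
    (hc : coeff k h c (δ k h (lineO i n) * δ k h F - δ k h F * δ k h (lineO i n)) ≠ 0) :
    IsTorsionFree c.out := by
  by_contra hZ
  rw [coeff_commutator, ncard_subobjects_lineO_comm hF hZ, sub_self] at hc
  exact hc rfl

theorem coeff_commutator_of_isTorsionFree {F : TSheaf} {i : Fin 3} {n : ℤ} {c : IsoClass}
    (hc : IsTorsionFree c.out) :
    coeff k h c (δ k h (lineO i n) * δ k h F - δ k h F * δ k h (lineO i n)) =
      ((subobjects (lineO i n) F c.out).ncard : k) := by
  rw [coeff_commutator, subobjects_eq_empty hc, Set.ncard_empty, Nat.cast_zero, sub_zero]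

theorem δ_lineO_mem_adStabilizer_TF (i : Fin 3) (n : ℤ) :
    δ k h (lineO i n) ∈ adStabilizer (Subalgebra.toSubmodule (TF k h)) := by
  refine mem_adStabilizer_of_span (Submodule.ext fun f => mem_TF_iff_mem_span) ?_
  rintro _ ⟨F, hF, rfl⟩
  exact mem_TF_iff.2 fun c hc => isTorsionFree_of_coeff_commutator_ne hF hc

/-- If a torsion-free extension of the line sheaf by `F` were locally free, then `F`, as a kernel,
would be locally free by `IsExact.hasLeast`. -/
theorem δ_lineO_mem_adStabilizer_singularSpan (i : Fin 3) (n : ℤ) :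
    δ k h (lineO i n) ∈ adStabilizer (singularSpan k h) := by
  refine mem_adStabilizer_of_span rfl ?_
  rintro _ ⟨F, hF, rfl⟩
  refine mem_span_δ fun c hc => ?_
  have hZ := isTorsionFree_of_coeff_commutator_ne hF.1 hc
  refine ⟨hZ, fun hL => ?_⟩
  rw [coeff_commutator_of_isTorsionFree hZ] at hc
  obtain ⟨N, hN⟩ := Set.nonempty_of_ncard_ne_zero fun h0 => hc (by rw [h0, Nat.cast_zero])
  obtain ⟨j, p, hjp, -⟩ := mem_subobjects.1 hN
  exact hF.2 ((isLocallyFree_iff hF.1).2 (hjp.hasLeast ((isLocallyFree_iff hZ).1 hL)))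

theorem lineLie_le {V : LieSubalgebra k (HallAlg k h)} (hV : ∀ i n, δ k h (lineO i n) ∈ V) :
    lineLie k h ≤ V := by
  refine LieSubalgebra.lieSpan_le.2 ?_
  rintro _ ⟨i, n, rfl⟩
  exact hV i n

/-- The adjoint action of `𝔨` on the torsion-free subalgebra. -/
noncomputable def adTF (x : lineLie k h) : TF k h →ₗ[k] TF k h where
  toFun t := ⟨x * t - t * x, lineLie_le δ_lineO_mem_adStabilizer_TF x.2 t t.2⟩
  map_add' s t := Subtype.ext (by
    change (x : HallAlg k h) * (s + t) - (s + t) * x = (x * s - s * x) + (x * t - t * x)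
    noncomm_ring)
  map_smul' r t := Subtype.ext (by
    change (x : HallAlg k h) * (r • t) - (r • t) * x = r • (x * t - t * x)
    rw [smul_mul_assoc, mul_smul_comm, smul_sub])

theorem coe_adTF (x : lineLie k h) (t : TF k h) :
    (adTF x t : HallAlg k h) = x * t - t * x := rfl

theorem adTF_mem_nonLocFree (x : lineLie k h) {t : TF k h} (ht : t ∈ nonLocFree k h) :
    adTF x t ∈ nonLocFree k h := by
  rw [mem_nonLocFree_iff_mem_singularSpan] at ht ⊢
  exact lineLie_le δ_lineO_mem_adStabilizer_singularSpan x.2 _ ht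

theorem adTF_mul (x : lineLie k h) (s t : TF k h) :
    adTF x (s * t) = s * adTF x t + adTF x s * t := Subtype.ext (by
  simp only [Subalgebra.coe_add, Subalgebra.coe_mul, coe_adTF]
  noncomm_ring)

/-- Only locally free extensions matter modulo the ideal. The sole candidate is `O n`, which needs
`m = n - 1` and then occurs with multiplicity one. -/
theorem adTF_lineGen_sub_mem (i : Fin 3) (n m : ℤ) :
    adTF (lineGen k h i n) (xO k h m) - (if m = n - 1 then xO k h n else 0) ∈ nonLocFree k h := by
  refine mem_nonLocFree_iff.2 fun c hc => ?_
  have hcoe : ((adTF (lineGen k h i n) (xO k h m) - (if m = n - 1 then xO k h n else 0) : TF k h) :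
      HallAlg k h) = (δ k h (lineO i n) * δ k h (O m) - δ k h (O m) * δ k h (lineO i n)) -
        if m = n - 1 then δ k h (O n) else 0 := by
    split_ifs <;> rfl
  have hZ : IsTorsionFree c.out := mem_TF_iff.1 (Subtype.property _) c hc
  refine ⟨hZ, fun hL => hc ?_⟩
  rw [hcoe, map_sub, coeff_commutator_of_isTorsionFree hZ, sub_eq_zero]
  by_cases hN : (subobjects (lineO i n) (O m) c.out).Nonempty
  · obtain ⟨rfl, ⟨e⟩⟩ := eq_of_subobjects_lineO_nonempty hZ ((isLocallyFree_iff hZ).1 hL) hN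
    have hc' : c = cls (O n) := by rw [← cls_out c]; exact cls_eq_iff.2 ⟨e⟩
    rw [if_pos rfl, coeff_δ, hc', Set.indicator_of_mem (Set.mem_singleton _), Pi.one_apply,
      ← hallNumber_cls, cls_out, hallNumber_cls, ncard_subobjects_mulX, Nat.cast_one]
  · rw [Set.not_nonempty_iff_eq_empty.1 hN, Set.ncard_empty, Nat.cast_zero]
    split_ifs with hm
    · subst hm
      rw [coeff_δ, Set.indicator_of_notMem]
      intro hc'
      refine hN (Set.nonempty_of_ncard_ne_zero ?_)
      rw [← hallNumber_cls, cls_out, Set.mem_singleton_iff.1 hc', hallNumber_cls,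
        ncard_subobjects_mulX]
      exact one_ne_zero
    · rw [map_zero]

/-! ### The induced derivations of the polynomial ring -/

variable [CharZero k]

theorem projTF_eq_projTF_iff {s t : TF k h} :
    projTF k h s = projTF k h t ↔ s - t ∈ nonLocFree k h := by
  rw [← projTF_eq_zero_iff, map_sub, sub_eq_zero]

theorem projTF_adTF_congr (x : lineLie k h) {s t : TF k h} (e : projTF k h s = projTF k h t) :
    projTF k h (adTF x s) = projTF k h (adTF x t) := by
  rw [projTF_eq_projTF_iff] at e ⊢
  rw [← map_sub]
  exact adTF_mem_nonLocFree x e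

/-- The derivation of `𝕋𝔽/𝕁` induced by an element of `𝔨`. -/
noncomputable def lineDerivation (x : lineLie k h) :
    Derivation k (MvPolynomial ℤ k) (MvPolynomial ℤ k) :=
  -- `evalO` is a multiplicative section of `projTF`, so the Leibniz rule is inherited from the
  -- adjoint action.
  Derivation.mk' ((projTF k h).toLinearMap ∘ₗ adTF x ∘ₗ (evalO k h).toLinearMap) fun p q => by
    simp only [LinearMap.comp_apply, AlgHom.toLinearMap_apply, map_mul, adTF_mul, map_add,
      projTF_evalO, smul_eq_mul]
    ring

theorem lineDerivation_apply (x : lineLie k h) (p : MvPolynomial ℤ k) :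
    lineDerivation x p = projTF k h (adTF x (evalO k h p)) := rfl

theorem lineDerivation_projTF (x : lineLie k h) (t : TF k h) :
    lineDerivation x (projTF k h t) = projTF k h (adTF x t) :=
  projTF_adTF_congr x (projTF_evalO _)

/-- The action of `𝔨` on `𝕋𝔽/𝕁`. -/
noncomputable def lineAction (k : Type*) [Field k] [CharZero k] (h : HallWellDefined) :
    lineLie k h →ₗ⁅k⁆ Derivation k (MvPolynomial ℤ k) (MvPolynomial ℤ k) where
  toFun := lineDerivation
  map_add' x y := Derivation.ext fun p => by
    rw [Derivation.add_apply]
    simp only [lineDerivation_apply]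
    rw [← map_add]
    refine congrArg _ (Subtype.ext ?_)
    rw [Subalgebra.coe_add, coe_adTF, coe_adTF, coe_adTF]
    change ((x : HallAlg k h) + y) * _ - _ * (x + y) = _
    noncomm_ring
  map_smul' r x := Derivation.ext fun p => by
    rw [Derivation.smul_apply]
    simp only [lineDerivation_apply]
    rw [RingHom.id_apply, ← map_smul]
    refine congrArg _ (Subtype.ext ?_)
    rw [Subalgebra.coe_smul, coe_adTF, coe_adTF]
    change (r • (x : HallAlg k h)) * _ - _ * (r • x) = _
    rw [smul_sub, smul_mul_assoc, mul_smul_comm]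
  map_lie' {x y} := Derivation.ext fun p => by
    -- The inner derivations give projections of elements of 𝕋𝔽. The outer ones can be computed on
    -- these elements directly, because the ideal is preserved.
    rw [Derivation.commutator_apply, lineDerivation_apply y, lineDerivation_apply x p,
      lineDerivation_projTF, lineDerivation_projTF, lineDerivation_apply, ← map_sub]
    refine congrArg _ (Subtype.ext ?_)
    simp only [Subalgebra.coe_sub, coe_adTF, LieSubalgebra.coe_bracket,
      LieRing.of_associative_ring_bracket]
    noncomm_ring

theorem lineAction_projTF (x : lineLie k h) (t : TF k h) :
    lineAction k h x (projTF k h t) = projTF k h (adTF x t) := lineDerivation_projTF x t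

theorem lineAction_lineGen (i : Fin 3) (n : ℤ) : lineAction k h (lineGen k h i n) =
    (MvPolynomial.X n : MvPolynomial ℤ k) • MvPolynomial.pderiv (n - 1) := by
  refine MvPolynomial.derivation_ext fun m => ?_
  rw [← projTF_xO (h := h), lineAction_projTF, projTF_eq_projTF_iff.2 (adTF_lineGen_sub_mem i n m),
    Derivation.smul_apply, projTF_xO, MvPolynomial.pderiv_X, Pi.single_apply]
  split_ifs with hm
  · rw [projTF_xO, smul_eq_mul, mul_one]
  · rw [map_zero, smul_zero]

end Action

/- ## The matrices of the action -/

section Matrices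

variable {k : Type*} [Field k]

theorem linearMap_ext_basisVec {M : Type*} [AddCommGroup M] [Module k M] {f g : Vec k →ₗ[k] M}
    (e : ∀ m, f (basisVec k m) = g (basisVec k m)) : f = g :=
  Finsupp.lhom_ext' (M := k) fun m => LinearMap.ext_ring (e m)

theorem toVariables_basisVec (m : ℤ) : toVariables k (basisVec k m) = MvPolynomial.X m := by
  refine (Finsupp.linearCombination_single k 1 m).trans ?_
  rw [one_smul]

theorem toVariables_injective : Function.Injective (toVariables k) :=
  MvPolynomial.linearIndependent_X ℤ k

variable [CharZero k] {h : HallWellDefined}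

/-- `A` is the matrix of the action of `x` on the span of the variables. -/
def IsMatrixOf (x : lineLie k h) (A : glMinus k) : Prop :=
  ∀ v, lineAction k h x (toVariables k v) = toVariables k (A.1 v)

theorem isMatrixOf_iff {x : lineLie k h} {A : glMinus k} : IsMatrixOf x A ↔
    ∀ m, lineAction k h x (MvPolynomial.X m) = toVariables k (A.1 (basisVec k m)) := by
  refine ⟨fun e m => by rw [← toVariables_basisVec]; exact e _, fun e v => ?_⟩
  have h1 : (lineAction k h x : MvPolynomial ℤ k →ₗ[k] MvPolynomial ℤ k) ∘ₗ toVariables k =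
      toVariables k ∘ₗ A.1 := linearMap_ext_basisVec fun m => by
    simp only [LinearMap.comp_apply, toVariables_basisVec]
    exact e m
  exact LinearMap.congr_fun h1 v

/-- The variables are linearly independent. Uniqueness is what makes `lineMatrix` a Lie algebra
homomorphism. -/
theorem IsMatrixOf.unique {x : lineLie k h} {A B : glMinus k} (hA : IsMatrixOf x A)
    (hB : IsMatrixOf x B) : A = B :=
  Subtype.ext (LinearMap.ext fun v => toVariables_injective ((hA v).symm.trans (hB v)))

theorem IsMatrixOf.add {x y : lineLie k h} {A B : glMinus k} (hA : IsMatrixOf x A)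
    (hB : IsMatrixOf y B) : IsMatrixOf (x + y) (A + B) := fun v => by
  rw [map_add, Derivation.add_apply, hA, hB, ← map_add]
  rfl

theorem IsMatrixOf.smul {x : lineLie k h} {A : glMinus k} (r : k) (hA : IsMatrixOf x A) :
    IsMatrixOf (r • x) (r • A) := fun v => by
  rw [map_smul, Derivation.smul_apply, hA, ← map_smul]
  rfl

theorem isMatrixOf_zero : IsMatrixOf (0 : lineLie k h) 0 := fun v => by
  rw [map_zero, Derivation.zero_apply]
  exact (map_zero _).symm

theorem IsMatrixOf.lie {x y : lineLie k h} {A B : glMinus k} (hA : IsMatrixOf x A)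
    (hB : IsMatrixOf y B) : IsMatrixOf ⁅x, y⁆ ⁅A, B⁆ := fun v => by
  rw [LieHom.map_lie, Derivation.commutator_apply, hA, hB, hA, hB, ← map_sub,
    LieSubalgebra.coe_bracket, LieRing.of_associative_ring_bracket, LinearMap.sub_apply]
  rfl

/-- The matrix unit `E_{i,j}` as an element of the Lie algebra. -/
noncomputable def lowerUnit (k : Type*) [CommRing k] {i j : ℤ} (hij : j < i) : glMinus k :=
  ⟨E k i j, Submodule.subset_span ⟨i, j, hij, rfl⟩⟩

theorem isMatrixOf_lineGen (i : Fin 3) (n : ℤ) :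
    IsMatrixOf (lineGen k h i n) (lowerUnit k (sub_one_lt n)) := by
  refine isMatrixOf_iff.2 fun m => ?_
  rw [lineAction_lineGen, Derivation.smul_apply, MvPolynomial.pderiv_X, Pi.single_apply]
  change _ = toVariables k (coord k (n - 1) (basisVec k m) • basisVec k n)
  rw [coord_basisVec, map_smul, toVariables_basisVec]
  by_cases hm : m = n - 1
  · rw [if_pos hm, if_pos hm.symm, smul_eq_mul, mul_one, one_smul]
  · rw [if_neg hm, if_neg (Ne.symm hm), smul_zero, zero_smul]

/-- The property holds for the generators and is stable under sums, scalars and brackets, so it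
holds on the Lie subalgebra they generate. -/
theorem exists_isMatrixOf (x : lineLie k h) : ∃ A, IsMatrixOf x A := by
  obtain ⟨x, hx⟩ := x
  refine LieSubalgebra.lieSpan_induction k
    (p := fun x hx => ∃ A, IsMatrixOf (⟨x, hx⟩ : lineLie k h) A) ?_ ?_ ?_ ?_ ?_ hx
  · rintro _ ⟨i, n, rfl⟩
    exact ⟨lowerUnit k (sub_one_lt n), isMatrixOf_lineGen i n⟩
  · exact ⟨0, isMatrixOf_zero⟩
  · rintro x y hx hy ⟨A, hA⟩ ⟨B, hB⟩
    have h1 := hA.add hB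
    have e : (⟨x, hx⟩ : lineLie k h) + ⟨y, hy⟩ = ⟨x + y, LieSubalgebra.add_mem _ hx hy⟩ := rfl
    rw [e] at h1
    exact ⟨A + B, h1⟩
  · rintro r x hx ⟨A, hA⟩
    have h1 := hA.smul r
    have e : r • (⟨x, hx⟩ : lineLie k h) = ⟨r • x, LieSubalgebra.smul_mem _ r hx⟩ := rfl
    rw [e] at h1
    exact ⟨r • A, h1⟩
  · rintro x y hx hy ⟨A, hA⟩ ⟨B, hB⟩
    have h1 := hA.lie hB
    have e : ⁅(⟨x, hx⟩ : lineLie k h), (⟨y, hy⟩ : lineLie k h)⁆ =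
      ⟨⁅x, y⁆, LieSubalgebra.lie_mem _ hx hy⟩ := rfl
    rw [e] at h1
    exact ⟨⁅A, B⁆, h1⟩

/-- The matrix of the action of an element of `𝔨`. -/
noncomputable def lineMatrix (k : Type*) [Field k] [CharZero k] (h : HallWellDefined) :
    lineLie k h →ₗ⁅k⁆ glMinus k where
  toFun x := (exists_isMatrixOf x).choose
  map_add' x y := (exists_isMatrixOf _).choose_spec.unique
    ((exists_isMatrixOf x).choose_spec.add (exists_isMatrixOf y).choose_spec)
  map_smul' r x := (exists_isMatrixOf _).choose_spec.unique
    ((exists_isMatrixOf x).choose_spec.smul r)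
  map_lie' {x y} := (exists_isMatrixOf _).choose_spec.unique
    ((exists_isMatrixOf x).choose_spec.lie (exists_isMatrixOf y).choose_spec)

theorem isMatrixOf_lineMatrix (x : lineLie k h) : IsMatrixOf x (lineMatrix k h x) :=
  (exists_isMatrixOf x).choose_spec

theorem lineMatrix_lineGen (i : Fin 3) (n : ℤ) :
    lineMatrix k h (lineGen k h i n) = lowerUnit k (sub_one_lt n) :=
  (isMatrixOf_lineMatrix _).unique (isMatrixOf_lineGen i n)

/-- Induction on the distance from the diagonal by `[E_{a,j+1}, E_{j+1,j}] = E_{a,j}`; the opposite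
product vanishes because `a ≠ j`. -/
theorem exists_lineMatrix_eq_E (d : ℕ) (j : ℤ) :
    ∃ x, (lineMatrix k h x).1 = E k (j + 1 + d) j := by
  have hgen : ∀ n, (lineMatrix k h (lineGen k h 0 n)).1 = E k n (n - 1) := fun n =>
    congrArg Subtype.val (lineMatrix_lineGen 0 n)
  induction d generalizing j with
  | zero => exact ⟨lineGen k h 0 (j + 1), by rw [hgen]; congr 1 <;> simp⟩
  | succ d ih =>
    obtain ⟨x, hx⟩ := ih (j + 1)
    refine ⟨⁅x, lineGen k h 0 (j + 1)⁆, ?_⟩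
    rw [LieHom.map_lie, LieSubalgebra.coe_bracket, LieRing.of_associative_ring_bracket, hx, hgen,
      E_mul, E_mul, if_pos rfl, if_neg (by omega), sub_zero]
    congr 1
    · push_cast; ring
    · ring

theorem surjective_lineMatrix : Function.Surjective (lineMatrix k h) := by
  rintro ⟨A, hA⟩
  have key : ∀ A ∈ lowerSpan k, ∃ x, (lineMatrix k h x).1 = A := by
    intro A hA
    induction hA using Submodule.span_induction with
    | mem A hA =>
      obtain ⟨i, j, hij, rfl⟩ := hA
      obtain ⟨d, hd⟩ := Int.eq_ofNat_of_zero_le (show 0 ≤ i - (j + 1) by omega)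
      obtain rfl : i = j + 1 + d := by omega
      exact exists_lineMatrix_eq_E d j
    | zero => exact ⟨0, by rw [map_zero]; rfl⟩
    | add A B _ _ h1 h2 =>
      obtain ⟨x, rfl⟩ := h1
      obtain ⟨y, rfl⟩ := h2
      exact ⟨x + y, by rw [map_add]; rfl⟩
    | smul r A _ h1 =>
      obtain ⟨x, rfl⟩ := h1
      exact ⟨r • x, by rw [map_smul]; rfl⟩
  obtain ⟨x, hx⟩ := key A hA
  exact ⟨x, Subtype.ext hx⟩

end Matrices

end MonoidP2

/-! ### The main theorem -/

open MonoidP2 in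
theorem mainTheorem9 (k : Type*) [Field k] [CharZero k] :
    ∃ h : HallWellDefined,
      (∃ n : LieSubalgebra k (HallAlg k h),
        n.toSubmodule = indecSpan k h ∧ lineLie k h ≤ n) ∧
      (∀ a b : TF k h, a * b = b * a) ∧
      ∃ π : TF k h →ₐ[k] MvPolynomial ℤ k,
        Function.Surjective π ∧ RingHom.ker π = nonLocFree k h ∧
        (∀ m : ℤ, π (xO k h m) = MvPolynomial.X m) ∧
        ∃ ρ : lineLie k h →ₗ⁅k⁆ Derivation k (MvPolynomial ℤ k) (MvPolynomial ℤ k),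
          (∀ (x : lineLie k h) (t : TF k h), ∃ u : TF k h,
            (u : HallAlg k h) = x * t - t * x ∧
            (t ∈ nonLocFree k h → u ∈ nonLocFree k h) ∧ π u = ρ x (π t)) ∧
          (∀ (i : Fin 3) (n : ℤ), ρ (lineGen k h i n) =
            (MvPolynomial.X n : MvPolynomial ℤ k) • MvPolynomial.pderiv (n - 1)) ∧
          ∃ ν : lineLie k h →ₗ⁅k⁆ glMinus k,
            Function.Surjective ν ∧
            (∀ (i : Fin 3) (n : ℤ),
              (ν (lineGen k h i n)).1 = E k n (n - 1)) ∧
            (∀ (x : lineLie k h) (m : ℤ), ρ x (MvPolynomial.X m) =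
              toVariables k ((ν x).1 (basisVec k m))) := by
  refine ⟨hallWellDefined, exists_indecSpan_lieSubalgebra k _, TF_mul_comm, projTF k _,
    surjective_projTF, ker_projTF, projTF_xO, lineAction k _, fun x t => ⟨adTF x t, rfl,
      adTF_mem_nonLocFree x, (lineAction_projTF x t).symm⟩, lineAction_lineGen, lineMatrix k _,
    surjective_lineMatrix, fun i n => congrArg Subtype.val (lineMatrix_lineGen i n), fun x m =>
      isMatrixOf_iff.1 (isMatrixOf_lineMatrix x) m⟩
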